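/- **Setting.** Let $\mathcal V=\{1,\dots,N\}$, $N\ge 1$, be the agents of an undirected graph $\mathcal G=(\mathcal V,\mathcal E)$, and let $x=(x_1,\dots,x_N)$ with $x_i\in\mathbb R^{q_i}$, $q_i\ge1$, $q=\sum_i q_i$, with the Euclidean norm. Let $\xi=(\xi_1,\dots,\xi_N)$, $\xi_i\in\mathbb R^{p_i}$, $p=\sum_ip_i$, be a random vector with distribution $\mathcal D$, let $\mathcal X\subseteq\mathbb R^q$, $h:\mathbb R^q\times\mathbb R^p\to\mathbb R_{\ge0}$, and let $f(x)=\mathbb E_{\xi\sim\mathcal D}[h(x,\xi)]$ be finite and continuously differentiable on $\mathcal X$. Write $f(y_i,x_{-i})$ for the value of $f$ at $x$ with block $i$ replaced by $y_i$. Assume: (A) there are functions $\lambda,\zeta$, continuous on $\mathcal X$, $\zeta>0$, with $|f(x')-f(x)|\le\lambda_x\|x'-x\|$ for all $x\in\mathcal X$, $x'\in\mathbb R^q$ with $\|x'-x\|\le\zeta_x$; (B) there are functions $\phi,\beta$, continuous on $\mathcal X$, $\beta>0$, with $\|\nabla f(x')-\nabla f(x)\|\le\phi_x\|x'-x\|$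 for all $x\in\mathcal X$, $x'\in\mathbb R^q$ with $\|x'-x\|\le\beta_x$; (C) $f$ is coercive: $f(x)\to\infty$ when $x\in\mathcal X$ approaches the boundary of $\mathcal X$ or $\|x\|\to\infty$; (D) for each $i$ there is a measurable local observation $h_i(x,\xi)\ge0$, depending only on $x_j,\xi_j$ for $j=i$ or $j$ adjacent to $i$, such that with $f_i(x)=\mathbb E_{\xi\sim\mathcal D}[h_i(x,\xi)]$ and a constant $c$, for every $x\in\mathcal X$: $h_i(x,\xi)\le c f_i(x)$ almost surely, and $\nabla_{x_i}f_i(x)$ exists and equals $\nabla_{x_i}f(x)$. **Algorithm.** The agents are partitioned into clusters $\mathcal V_1,\dots,\mathcal V_s$ such that no two agents of one cluster are adjacent. Given $x^0\in\mathcal X$, a step size $\eta>0$, radii $r_i>0$, an update order $z_k\in\{1,\dots,s\}$, and weights $w_i^k\ge0$ (which may depend on the samples drawn before step $k$), at step $k=0,1,\dots$ draw $\xi^k\sim\mathcal D$ and $u_i^k$ uniform on the unit sphere of $\mathbb R^{q_i}$, all samples being independent. For $i\in\mathcal V_{z_k}$ put $\hat x_i^k=x_i^k+w_i^k(x_i^k-x_i^{k_{prev}})$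 and $$x_i^{k+1}=\hat x_i^k-\eta\,\frac{q_i}{r_i}\,h_i(\hat x_i^k+r_iu_i^k,\,x_{-i}^k,\,\xi^k)\,u_i^k ,$$ and put $x_i^{k+1}=x_i^k$ for $i\notin\mathcal V_{z_k}$. Here $x_i^{k_{prev}}$ is the value of $x_i$ before its latest update ($x_i^{k_{prev}}=x_i^0$ if there was none). **Constants.** Let $\epsilon,\nu,\gamma>0$, $\alpha\ge 2+\gamma+\frac1\nu+\nu\gamma$, and let $\alpha_i>1$ be so large that $f_i(x)\le\alpha_if_i(x^0)$ for all $i$ and all $x\in\mathcal X$ with $f(x)\le\alpha f(x^0)$. Put $$\mathbb X=\{x\in\mathcal X: f(x)\le\alpha f(x^0),\ f_i(x)\le\alpha_if_i(x^0)\ \forall i\},$$ $\phi_0=\sup_{\mathbb X}\phi_x$, $\lambda_0=\sup_{\mathbb X}\lambda_x$, $\rho_0=\inf_{x\in\mathbb X}\min\{\beta_x,\zeta_x\}$. Let $N_i$ be the size of the cluster containing $i$, $N_0=\max_iN_i$, $q_+=\max_iq_i$, $r_-=\min_ir_i$, $f_0(x^0)=\max_i\alpha_if_i(x^0)$ and $\delta=\frac{q_+}{r_-}c\,[f_0(x^0)+\lambda_0\rho_0]$.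 **Theorem.** Suppose that $T=\lceil\frac{2\alpha\nu f(x^0)}{\eta\epsilon}\rceil$, $$\eta\le\min\Big\{1,\ \frac{\rho_0}{2\delta\sqrt{N_0}},\ \frac{2\alpha f(x^0)}{\gamma\epsilon},\ \frac{\gamma\epsilon}{2\alpha N_0(\phi_0\delta^2+4\phi_0^2+\phi_0+4)}\Big\},\qquad r_i\le\min\Big\{\frac{\rho_0}2,\ \frac1{2\phi_0}\sqrt{\frac{\gamma\epsilon}{\alpha N_0}}\Big\}\ (i\in\mathcal V),$$ and, almost surely, $w_i^k\|x_i^k-x_i^{k_{prev}}\|\le\min\{\eta^{3/2},\frac{\rho_0}{2\sqrt{N_i}}\}$ for all $k<T$ and all $i\in\mathcal V_{z_k}$. (A bound whose denominator vanishes is void.) Then: (i) with probability at least $1-\frac1\alpha(2+\gamma+\frac1\nu+\nu\gamma)$, $$\frac1T\sum_{k=0}^{T-1}\sum_{i\in\mathcal V_{z_k}}\|\nabla_{x_i}f(x^k)\|^2<\epsilon ;$$ (ii) if $T_0\ge s$ is an integer such that each cluster is updated at least once during any $T_0$ consecutive steps among $0,\dots,T-1$, and if $\bar\epsilon\in(0,\rho_0]$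 is such that, almost surely, $2(T_0-1)N_i\,w_i^k\|x_i^k-x_i^{k_{prev}}\|\le\bar\epsilon$ for all $k<T$ and $i\in\mathcal V_{z_k}$, and $2\delta(T_0-1)N_0\,\eta\le\bar\epsilon$, then with probability at least $1-\frac1\alpha(2+\gamma+\frac1\nu+\nu\gamma)$, $$\frac1T\sum_{k=0}^{T-1}\|\nabla f(x^k)\|^2<2T_0(\epsilon+\phi_0^2\bar\epsilon^2).$$ -/

import Mathlib

open MeasureTheory ProbabilityTheory Filter Topology

namespace AsyncZOO

/-- The state space `ℝ^{q₁} × ⋯ × ℝ^{q_N}`, written in blocks (one block for each agent) and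
carrying the Euclidean norm of `ℝ^{q₁ + ⋯ + q_N}`. -/
abbrev BlockVec {ι : Type*} (q : ι → ℕ) : Type _ :=
  PiLp 2 (fun i => EuclideanSpace ℝ (Fin (q i)))

/-- The vector `(y_i, x_{-i})`: block `i` of `x` is replaced by `y`. -/
def setBlock {ι : Type*} [DecidableEq ι] {q : ι → ℕ} (x : BlockVec q) (i : ι)
    (y : EuclideanSpace ℝ (Fin (q i))) : BlockVec q :=
  WithLp.toLp 2 (Function.update x.ofLp i y)

/-- The uniform distribution on the unit sphere of `ℝ^d`, as a measure on `ℝ^d`: the normalized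
surface measure. -/
noncomputable def uniformSphere (d : ℕ) : Measure (EuclideanSpace ℝ (Fin d)) :=
  (((volume : Measure (EuclideanSpace ℝ (Fin d))).toSphere Set.univ)⁻¹ •
    (volume : Measure (EuclideanSpace ℝ (Fin d))).toSphere).map Subtype.val

/-- `f` is coercive on `S`: `f(x) → ∞` when `x ∈ S` approaches the boundary of `S`, and when
`x ∈ S` goes to infinity. -/
def CoerciveOn {E : Type*} [NormedAddCommGroup E] (f : E → ℝ) (S : Set E) : Prop :=
  (∀ y ∈ frontier S, Tendsto f (𝓝[S] y) atTop) ∧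
    Tendsto f (Bornology.cobounded E ⊓ 𝓟 S) atTop

/-- `f` is continuously differentiable on `S`, `(lam_x, zeta_x)` locally Lipschitz in `S`, has a
`(phi_x, beta_x)` locally Lipschitz gradient in `S`, and is coercive. -/
structure RegularCost {E : Type*} [NormedAddCommGroup E] [InnerProductSpace ℝ E]
    [CompleteSpace E] (S : Set E) (f lam zeta phi beta : E → ℝ) : Prop where
  differentiableAt : ∀ x ∈ S, DifferentiableAt ℝ f x
  continuousOn_gradient : ContinuousOn (gradient f) S
  continuousOn_lam : ContinuousOn lam S
  continuousOn_zeta : ContinuousOn zeta S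
  continuousOn_phi : ContinuousOn phi S
  continuousOn_beta : ContinuousOn beta S
  zeta_pos : ∀ x ∈ S, 0 < zeta x
  beta_pos : ∀ x ∈ S, 0 < beta x
  lipschitz : ∀ x ∈ S, ∀ x' : E, ‖x' - x‖ ≤ zeta x → |f x' - f x| ≤ lam x * ‖x' - x‖
  lipschitz_gradient : ∀ x ∈ S, ∀ x' : E, ‖x' - x‖ ≤ beta x →
    ‖gradient f x' - gradient f x‖ ≤ phi x * ‖x' - x‖
  coercive : CoerciveOn f S

/-- The local observations `h_i`, each depending only on the states and noises of agent `i` and of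
its neighbours in the graph `G`, have expectations `f_i` such that, on `S`, `h_i ≤ c f_i` almost
surely and `∇_{x_i} f = ∇_{x_i} f_i`. -/
structure LocalCosts {ι : Type*} [Fintype ι] [DecidableEq ι] {q p : ι → ℕ} (G : SimpleGraph ι)
    (D : Measure (BlockVec p)) (S : Set (BlockVec q)) (f : BlockVec q → ℝ)
    (hl : ι → BlockVec q → BlockVec p → ℝ) (fl : ι → BlockVec q → ℝ) (c : ℝ) : Prop where
  measurable : ∀ i, Measurable (fun a : BlockVec q × BlockVec p => hl i a.1 a.2)
  nonneg : ∀ i x ξ, 0 ≤ hl i x ξ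
  isLocal : ∀ i, ∀ x x' : BlockVec q, ∀ ξ ξ' : BlockVec p,
    (∀ j, (j = i ∨ G.Adj i j) → x j = x' j ∧ ξ j = ξ' j) → hl i x ξ = hl i x' ξ'
  integrable : ∀ i, ∀ x ∈ S, Integrable (hl i x) D
  expectation : ∀ i x, fl i x = ∫ ξ, hl i x ξ ∂D
  le_mul : ∀ i, ∀ x ∈ S, ∀ᵐ ξ ∂D, hl i x ξ ≤ c * fl i x
  gradient_eq : ∀ i, ∀ x ∈ S,
    HasGradientAt (fun y => fl i (setBlock x i y)) ((gradient f x) i) (x i)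

/-- All the randomness drawn in one iteration: the noise and the perturbation directions. -/
abbrev Sample {ι : Type*} (q p : ι → ℕ) : Type _ :=
  BlockVec p × ((i : ι) → EuclideanSpace ℝ (Fin (q i)))

/-- `ω ↦ (ξ^k, (u_i^k)_i)` at iteration `k`. -/
def sample {ι Ω : Type*} {q p : ι → ℕ} (ξ : ℕ → Ω → BlockVec p)
    (u : ℕ → (i : ι) → Ω → EuclideanSpace ℝ (Fin (q i))) (k : ℕ) (ω : Ω) : Sample q p :=
  (ξ k ω, fun i => u k i ω)

/-- The samples of the algorithm: `ξ^k ∼ D` and `u_i^k ∼ Uni(S_{q_i - 1})`, all of them mutually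
independent (within one iteration by the product law, over the iterations by `iIndepFun`). -/
structure IsSampling {ι Ω : Type*} [Fintype ι] [MeasurableSpace Ω] {q p : ι → ℕ} (P : Measure Ω)
    (D : Measure (BlockVec p)) (ξ : ℕ → Ω → BlockVec p)
    (u : ℕ → (i : ι) → Ω → EuclideanSpace ℝ (Fin (q i))) : Prop where
  measurable_noise : ∀ k, Measurable (ξ k)
  measurable_direction : ∀ k i, Measurable (u k i)
  law : ∀ k, P.map (sample ξ u k) = D.prod (Measure.pi fun i => uniformSphere (q i))
  indep : iIndepFun (sample ξ u) P

/-- The σ-algebra generated by the samples of the first `k` iterations (numbers `0, …, k - 1`). -/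
abbrev pastSigma {ι Ω : Type*} {q p : ι → ℕ} (ξ : ℕ → Ω → BlockVec p)
    (u : ℕ → (i : ι) → Ω → EuclideanSpace ℝ (Fin (q i))) (k : ℕ) : MeasurableSpace Ω :=
  ⨆ l : ℕ, ⨆ _ : l < k, MeasurableSpace.comap (sample ξ u l) inferInstance

/-- The extrapolation `x̂_i = x_i + w (x_i - x_i^prev)`. -/
def extrapolate {ι : Type*} {q : ι → ℕ} (w : ℝ) (x xprev : BlockVec q) (i : ι) :
    EuclideanSpace ℝ (Fin (q i)) :=
  x i + w • (x i - xprev i)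

/-- The one-point gradient estimate `(q_i / r_i) h_i(y + r_i u, x_{-i}, ξ) u` of agent `i` at the
point `(y, x_{-i})`. -/
noncomputable def gradEstimate {ι : Type*} [DecidableEq ι] {q p : ι → ℕ}
    (hl : ι → BlockVec q → BlockVec p → ℝ) (r : ι → ℝ) (i : ι)
    (y : EuclideanSpace ℝ (Fin (q i))) (x : BlockVec q) (u : EuclideanSpace ℝ (Fin (q i)))
    (ξ : BlockVec p) : EuclideanSpace ℝ (Fin (q i)) :=
  ((q i : ℝ) / r i * hl i (setBlock x i (y + r i • u)) ξ) • u

/-- The asynchronous zeroth-order algorithm. The value at step `k` is `(x^k, x^{k_prev})`, where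
block `i` of the second component is the value of `x_i` before its latest update (and the initial
value as long as there was no update). At step `k` exactly the agents of cluster `z k` update. -/
noncomputable def iterates {ι Ω : Type*} [DecidableEq ι] {q p : ι → ℕ} {s : ℕ}
    (hl : ι → BlockVec q → BlockVec p → ℝ) (cl : ι → Fin s) (x0 : BlockVec q)
    (η : ℝ) (r : ι → ℝ) (z : ℕ → Fin s) (w : ℕ → ι → Ω → ℝ) (ξ : ℕ → Ω → BlockVec p)
    (u : ℕ → (i : ι) → Ω → EuclideanSpace ℝ (Fin (q i))) :
    ℕ → Ω → BlockVec q × BlockVec q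
  | 0, _ => (x0, x0)
  | k + 1, ω =>
    let x := (iterates hl cl x0 η r z w ξ u k ω).1
    let xprev := (iterates hl cl x0 η r z w ξ u k ω).2
    (WithLp.toLp 2 fun i =>
      if cl i = z k then
        extrapolate (w k i ω) x xprev i -
          η • gradEstimate hl r i (extrapolate (w k i ω) x xprev i) x (u k i ω) (ξ k ω)
      else x i,
     WithLp.toLp 2 fun i => if cl i = z k then x i else xprev i)

/-- `N_i`: the number of agents in the cluster that contains agent `i`. -/
def clusterSize {ι : Type*} [Fintype ι] {s : ℕ} (cl : ι → Fin s) (i : ι) : ℕ :=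
  (Finset.univ.filter fun j => cl j = cl i).card

/-- `N_0`: the largest size of a cluster. -/
def maxClusterSize {ι : Type*} [Fintype ι] {s : ℕ} (cl : ι → Fin s) : ℕ :=
  Finset.univ.sup (clusterSize cl)

/-- Essentially cluster cyclic update over the steps `0, …, T - 1`: each of the `s ≤ T0` clusters
is updated at least once during any `T0` consecutive steps. -/
def EssentiallyCyclic {s : ℕ} (T0 T : ℕ) (z : ℕ → Fin s) : Prop :=
  s ≤ T0 ∧ ∀ j : Fin s, ∀ k₁ k₂ : ℕ, k₂ < T → k₂ + 1 = k₁ + T0 →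
    ∃ k₀, k₁ ≤ k₀ ∧ k₀ ≤ k₂ ∧ z k₀ = j

end AsyncZOO

open AsyncZOO

/-!
# Convergence of an asynchronous zeroth-order method

The argument follows the costs `f (x k)` up to the first exit from the compact sublevel set `XX` of
`x0`, on which `f` is Lipschitz and has a Lipschitz gradient with uniform constants
(`RegularCost.uniformBounds`; compactness is `CoerciveOn.isCompact_sublevel`).

*Bias of the estimate.* By the divergence theorem on the ball, `(d / r) E[F (r u) u]`, with `u`
uniform on the unit sphere of `ℝ^d`, is the average of `∇F` over the ball of radius `r`. Applied to
the local costs this bounds the bias of each block of the estimate by `phi0 (‖m‖ + r)`, where `m` is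
the extrapolation, without a dimensional constant (`abs_sphere_average_sub_inner_le`,
`LocalCosts.norm_integral_gradEstimate_sub_le`). The almost sure bound `h_i ≤ c f_i` bounds the
estimate itself by `δ`, so one iteration from `XX` moves by at most `rho0` and stays in the domain
of `f`.

*Expected descent.* The descent lemma for the displacement of all updated blocks, together with the
independence of the past and the current sample, gives `E f (x (k + 1)) ≤ E f (x k) - (η / 2) E S_k`
up to an error proportional to `η`, on the event that the run has stayed in `XX`; `S_k` is the
squared norm of the updated blocks of the gradient (`agent_descent`, `IsRun.expected_descent`).
The inner product of the extrapolation and the mean estimate `v` is absorbed by the term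
`-η ‖v‖² / 2`, which appears because `v` is compared with the gradient in norm.

*Probability.* Leaving `XX` means that the cost exceeds `α f x0`. The maximal inequality bounds the
probability of this event, and Markov's inequality that of a large `∑ S_k` without it
(`prob_exit_or_large_sum`); for the prescribed number of steps the two add up to the stated failure
probability (`failure_bound`). This is part (i).

*Full gradients.* On the same event, each block of `∇f (x k)` is compared with that block at a step
of the same window of `T0` steps at which it is updated. The displacement over a window is at most
`ε'`, and Young's and the Cauchy–Schwarz inequality give the factor `2 T0` of part (ii)
(`UniformBounds.sum_gradient_le`). If `T < T0`, the cyclicity hypothesis is void. Then the gradient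
at `x0` is already small, because a gradient step from `x0` cannot make `f` negative
(`UniformBounds.sq_norm_gradient_start_lt`), and all iterates stay within `ε'` of `x0`
(`UniformBounds.sum_gradient_lt_of_start`).
-/

/-! ### The uniform distribution on the sphere and the smoothed gradient -/

namespace AsyncZOO

lemma toSphere_univ_ne_zero {d : ℕ} (hd : 0 < d) :
    (volume : Measure (EuclideanSpace ℝ (Fin d))).toSphere Set.univ ≠ 0 := by
  have : Nonempty (Fin d) := ⟨⟨0, hd⟩⟩
  rw [Ne, Measure.measure_univ_eq_zero]
  exact Measure.toSphere_ne_zero _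

lemma isProbabilityMeasure_uniformSphere {d : ℕ} (hd : 0 < d) :
    IsProbabilityMeasure (uniformSphere d) := by
  refine ⟨?_⟩
  rw [uniformSphere, Measure.map_apply measurable_subtype_coe MeasurableSet.univ]
  simp only [Set.preimage_univ, Measure.smul_apply, smul_eq_mul]
  exact ENNReal.inv_mul_cancel (toSphere_univ_ne_zero hd) (measure_ne_top _ _)

lemma ae_norm_eq_one_uniformSphere (d : ℕ) : ∀ᵐ u ∂(uniformSphere d), ‖u‖ = 1 := by
  rw [uniformSphere, ae_map_iff measurable_subtype_coe.aemeasurable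
    (measurableSet_eq_fun measurable_norm measurable_const)]
  exact Eventually.of_forall fun u => by simp

lemma integral_uniformSphere {d : ℕ} (K : EuclideanSpace ℝ (Fin d) → ℝ) :
    ∫ u, K u ∂(uniformSphere d) =
      ((volume : Measure (EuclideanSpace ℝ (Fin d))).toSphere.real Set.univ)⁻¹ *
        ∫ u, K u ∂(volume : Measure (EuclideanSpace ℝ (Fin d))).toSphere := by
  rw [uniformSphere,
    (MeasurableEmbedding.subtype_coe Metric.isClosed_sphere.measurableSet).integral_map,
    integral_smul_measure, ENNReal.toReal_inv, smul_eq_mul, Measure.real]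

/-- Integration in polar coordinates of the product of a radial and an angular function. -/
lemma integral_radial_mul_angular {d : ℕ} (hd : 0 < d) (w : ℝ → ℝ)
    (K : EuclideanSpace ℝ (Fin d) → ℝ) :
    ∫ v : EuclideanSpace ℝ (Fin d), w ‖v‖ * K (‖v‖⁻¹ • v) =
      (∫ v : EuclideanSpace ℝ (Fin d), w ‖v‖) * ∫ u, K u ∂(uniformSphere d) := by
  have : Nonempty (Fin d) := ⟨⟨0, hd⟩⟩
  set μ : Measure (EuclideanSpace ℝ (Fin d)) := volume with hμ
  have key : ∀ K : EuclideanSpace ℝ (Fin d) → ℝ,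
      ∫ v, w ‖v‖ * K (‖v‖⁻¹ • v) ∂μ = (∫ u, K u ∂μ.toSphere) *
        ∫ t : Set.Ioi (0 : ℝ), w t ∂(Measure.volumeIoiPow
          (Module.finrank ℝ (EuclideanSpace ℝ (Fin d)) - 1)) := by
    intro K
    calc ∫ v, w ‖v‖ * K (‖v‖⁻¹ • v) ∂μ
        = ∫ v : ({(0)}ᶜ : Set (EuclideanSpace ℝ (Fin d))),
            w ‖v.1‖ * K (‖v.1‖⁻¹ • v.1) ∂(μ.comap (↑)) := by
          rw [integral_subtype_comap (measurableSet_singleton _).compl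
            fun v ↦ w ‖v‖ * K (‖v‖⁻¹ • v), restrict_compl_singleton]
      _ = ∫ x, K x.1 * w x.2 ∂μ.toSphere.prod (.volumeIoiPow
            (Module.finrank ℝ (EuclideanSpace ℝ (Fin d)) - 1)) := by
          rw [← μ.measurePreserving_homeomorphUnitSphereProd.integral_comp
            (Homeomorph.measurableEmbedding _)
            (fun x => K (x.1 : EuclideanSpace ℝ (Fin d)) * w (x.2 : ℝ))]
          refine integral_congr_ae (Eventually.of_forall fun v => ?_)
          simp [mul_comm]
      _ = _ := integral_prod_mul (fun u : Metric.sphere (0 : EuclideanSpace ℝ (Fin d)) 1 => K u)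
            (fun t : Set.Ioi (0 : ℝ) => w t)
  have h1 := key (fun _ => 1)
  simp only [mul_one, integral_const, smul_eq_mul] at h1
  have hne : μ.toSphere.real Set.univ ≠ 0 :=
    ENNReal.toReal_ne_zero.2 ⟨toSphere_univ_ne_zero hd, measure_ne_top _ _⟩
  rw [key K, h1, integral_uniformSphere, ← hμ]
  field_simp

/-- A smooth radial cutoff function `ψ`, whose gradient at `v` is `-w(‖v‖) v / ‖v‖` with a weight
`w` that lives on the shell of radii between `a` and `b`. -/
lemma exists_radial_cutoff (d : ℕ) {a b : ℝ} (ha : 0 < a) (hab : a < b) :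
    ∃ (ψ : EuclideanSpace ℝ (Fin d) → ℝ) (w : ℝ → ℝ), ContDiff ℝ 1 ψ ∧ Continuous w ∧
      (∀ v, 0 ≤ ψ v) ∧ 0 < ψ 0 ∧ tsupport ψ ⊆ Metric.closedBall 0 b ∧
      (∀ t, 0 ≤ t → 0 ≤ w t) ∧ (∀ t, 0 ≤ t → w t ≠ 0 → a ≤ t ∧ t ≤ b) ∧
      ∀ v e, fderiv ℝ ψ v e = -(w ‖v‖ * inner ℝ (‖v‖⁻¹ • v) e) := by
  set h : ℝ := b ^ 2 - a ^ 2 with hh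
  have hpos : 0 < h := by simp only [hh]; nlinarith
  have hs : ContDiff ℝ 1 Real.smoothTransition := Real.smoothTransition.contDiff (n := 1)
  refine ⟨fun v => Real.smoothTransition ((b ^ 2 - ‖v‖ ^ 2) / h),
    fun t => deriv Real.smoothTransition ((b ^ 2 - t ^ 2) / h) * (2 * t / h), ?_, ?_, ?_, ?_, ?_,
    ?_, ?_, ?_⟩
  · exact hs.comp ((contDiff_const.sub (contDiff_norm_sq ℝ)).div_const _)
  · exact ((hs.continuous_deriv le_rfl).comp (by fun_prop)).mul (by fun_prop)
  · exact fun v => Real.smoothTransition.nonneg _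
  · refine Real.smoothTransition.pos_of_pos ?_
    simp only [norm_zero]
    have : 0 < b := ha.trans hab
    have : 0 < b ^ 2 := by positivity
    exact div_pos (by simpa using this) hpos
  · refine closure_minimal (fun v hv => ?_) Metric.isClosed_closedBall
    rw [mem_closedBall_zero_iff]
    by_contra hlt
    push Not at hlt
    refine hv (Real.smoothTransition.zero_of_nonpos ?_)
    exact div_nonpos_of_nonpos_of_nonneg (by nlinarith) hpos.le
  · intro t ht
    have := Real.smoothTransition.monotone.deriv_nonneg (x := (b ^ 2 - t ^ 2) / h)
    exact mul_nonneg this (by positivity)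
  · intro t ht hw
    have hd := left_ne_zero_of_mul hw
    constructor
    · by_contra hlt
      push Not at hlt
      refine hd ?_
      have h1 : 1 < (b ^ 2 - t ^ 2) / h := by
        rw [lt_div_iff₀ hpos]; simp only [hh]; nlinarith
      have : Real.smoothTransition =ᶠ[𝓝 ((b ^ 2 - t ^ 2) / h)] fun _ => 1 := by
        filter_upwards [lt_mem_nhds h1] with s hs
        exact Real.smoothTransition.one_of_one_le hs.le
      rw [this.deriv_eq, deriv_const]
    · by_contra hlt
      push Not at hlt
      refine hd ?_
      have h1 : (b ^ 2 - t ^ 2) / h < 0 := div_neg_of_neg_of_pos (by nlinarith) hpos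
      have : Real.smoothTransition =ᶠ[𝓝 ((b ^ 2 - t ^ 2) / h)] fun _ => 0 := by
        filter_upwards [gt_mem_nhds h1] with s hs
        exact Real.smoothTransition.zero_of_nonpos hs.le
      rw [this.deriv_eq, deriv_const]
  · intro v e
    have h1 : HasFDerivAt (fun v : EuclideanSpace ℝ (Fin d) => (b ^ 2 - ‖v‖ ^ 2) / h)
        (h⁻¹ • (-(2 • (innerSL ℝ v))) : EuclideanSpace ℝ (Fin d) →L[ℝ] ℝ) v := by
      have := ((HasStrictFDerivAt.hasFDerivAt (hasStrictFDerivAt_norm_sq v)).const_sub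
        (b ^ 2)).const_smul h⁻¹
      refine this.congr_of_eventuallyEq (Eventually.of_forall fun x => ?_)
      simp [div_eq_inv_mul]
    have h2 : HasDerivAt Real.smoothTransition
        (deriv Real.smoothTransition ((b ^ 2 - ‖v‖ ^ 2) / h)) ((b ^ 2 - ‖v‖ ^ 2) / h) :=
      (hs.differentiable one_ne_zero _).hasDerivAt
    have h3 := (h2.comp_hasFDerivAt v h1).fderiv
    have h4 : fderiv ℝ (fun v : EuclideanSpace ℝ (Fin d) =>
        Real.smoothTransition ((b ^ 2 - ‖v‖ ^ 2) / h)) v = _ := h3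
    rw [h4]
    simp only [smul_apply, neg_apply, smul_eq_mul,
      innerSL_apply_apply, inner_smul_left, nsmul_eq_mul]
    rcases eq_or_ne v 0 with rfl | hv
    · simp
    · have : ‖v‖ ≠ 0 := norm_ne_zero_iff.2 hv
      simp
      field_simp

/-- Integration by parts against a radial cutoff `ψ`: the surface term is the average of
`F(v) v/‖v‖` with the weight `w`. -/
lemma integral_cutoff_mul_gradient {d : ℕ} {b : ℝ} {ψ : EuclideanSpace ℝ (Fin d) → ℝ}
    {w : ℝ → ℝ} (hψ : ContDiff ℝ 1 ψ) (hsupp : tsupport ψ ⊆ Metric.closedBall 0 b)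
    (hderiv : ∀ v e, fderiv ℝ ψ v e = -(w ‖v‖ * inner ℝ (‖v‖⁻¹ • v) e))
    {F : EuclideanSpace ℝ (Fin d) → ℝ} {F' : EuclideanSpace ℝ (Fin d) → EuclideanSpace ℝ (Fin d)}
    (hF : ∀ v ∈ Metric.closedBall 0 b, HasGradientAt F (F' v) v)
    (hF' : ContinuousOn F' (Metric.closedBall 0 b)) (e : EuclideanSpace ℝ (Fin d)) :
    ∫ v, ψ v * inner ℝ (F' v) e = ∫ v, w ‖v‖ * (inner ℝ (‖v‖⁻¹ • v) e * F v) := by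
  have hcF : ContinuousOn F (Metric.closedBall 0 b) := fun v hv =>
    (hF v hv).differentiableAt.continuousAt.continuousWithinAt
  have hzero : ∀ v ∉ Metric.closedBall 0 b, ψ v = 0 := fun v hv =>
    image_eq_zero_of_notMem_tsupport fun h => hv (hsupp h)
  have hdzero : ∀ v ∉ Metric.closedBall 0 b, fderiv ℝ ψ v = 0 := fun v hv =>
    image_eq_zero_of_notMem_tsupport fun h => hv (hsupp (tsupport_fderiv_subset ℝ h))
  -- products with functions that are continuous on the closed ball
  have hint : ∀ (p g : EuclideanSpace ℝ (Fin d) → ℝ), Continuous p →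
      (∀ v ∉ Metric.closedBall 0 b, p v = 0) → ContinuousOn g (Metric.closedBall 0 b) →
      Integrable (fun v => p v * g v) := by
    intro p g hp hp0 hg
    have : IntegrableOn (fun v => p v * g v) (Metric.closedBall 0 b) :=
      (hp.continuousOn.mul hg).integrableOn_compact (isCompact_closedBall _ _)
    refine (integrableOn_iff_integrable_of_support_subset fun v hv => ?_).1 this
    by_contra hmem
    exact hv (by simp [hp0 v hmem])
  have hcd : Continuous fun v => fderiv ℝ ψ v e :=
    (hψ.continuous_fderiv one_ne_zero).clm_apply continuous_const
  have hfd : ∀ v ∈ Metric.closedBall 0 b, fderiv ℝ F v e = inner ℝ (F' v) e := fun v hv =>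
    (hF v hv).fderiv_apply
  have h1 := integral_mul_fderiv_eq_neg_fderiv_mul_of_integrable
    (μ := (volume : Measure (EuclideanSpace ℝ (Fin d)))) (f := ψ) (g := F) (v := e)
    (hint _ _ hcd (fun v hv => by simp [hdzero v hv]) hcF)
    (hint _ _ hψ.continuous hzero
      ((hF'.inner continuousOn_const).congr fun v hv => hfd v hv))
    (hint _ _ hψ.continuous hzero hcF)
    (fun v _ => hψ.differentiable one_ne_zero v)
    (fun v hv => (hF v (hsupp hv)).differentiableAt)
  calc ∫ v, ψ v * inner ℝ (F' v) e = ∫ v, ψ v * fderiv ℝ F v e := by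
        refine integral_congr_ae (Eventually.of_forall fun v => ?_)
        by_cases hv : v ∈ Metric.closedBall 0 b
        · simp only [hfd v hv]
        · simp [hzero v hv]
    _ = _ := by
        rw [h1, ← integral_neg]
        refine integral_congr_ae (Eventually.of_forall fun v => ?_)
        simp only [hderiv]
        ring

lemma integrable_radial_mul {d : ℕ} {a b : ℝ} {w : ℝ → ℝ} (hw : Continuous w)
    (hshell : ∀ t, 0 ≤ t → w t ≠ 0 → a ≤ t ∧ t ≤ b) {K : EuclideanSpace ℝ (Fin d) → ℝ}
    (hK : AEStronglyMeasurable K (volume.restrict (Metric.closedBall 0 b))) {C : ℝ}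
    (hC : ∀ v ∈ Metric.closedBall 0 b, |K v| ≤ C) :
    Integrable (fun v : EuclideanSpace ℝ (Fin d) => w ‖v‖ * K v) := by
  have h0 : IntegrableOn (fun v : EuclideanSpace ℝ (Fin d) => w ‖v‖) (Metric.closedBall 0 b) :=
    (hw.comp continuous_norm).continuousOn.integrableOn_compact (isCompact_closedBall _ _)
  have h1 : IntegrableOn (fun v : EuclideanSpace ℝ (Fin d) => w ‖v‖ * K v)
      (Metric.closedBall 0 b) := by
    refine Integrable.mul_bdd (c := C) h0 hK ?_
    filter_upwards [ae_restrict_mem Metric.isClosed_closedBall.measurableSet] with v hv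
    exact hC v hv
  refine (integrableOn_iff_integrable_of_support_subset fun v hv => ?_).1 h1
  exact mem_closedBall_zero_iff.2 (hshell _ (norm_nonneg v) (left_ne_zero_of_mul hv)).2

/-- The divergence identity for the field `v ↦ ψ(v) v`, with a radial cutoff `ψ`. -/
lemma dim_mul_integral_cutoff {d : ℕ} {a b : ℝ} {ψ : EuclideanSpace ℝ (Fin d) → ℝ}
    {w : ℝ → ℝ} (hψ : ContDiff ℝ 1 ψ) (hsupp : tsupport ψ ⊆ Metric.closedBall 0 b)
    (hw : Continuous w) (hshell : ∀ t, 0 ≤ t → w t ≠ 0 → a ≤ t ∧ t ≤ b)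
    (hderiv : ∀ v e, fderiv ℝ ψ v e = -(w ‖v‖ * inner ℝ (‖v‖⁻¹ • v) e)) :
    d * ∫ v, ψ v = ∫ v : EuclideanSpace ℝ (Fin d), w ‖v‖ * ‖v‖ := by
  have h1 : ∀ i : Fin d, ∫ v, ψ v =
      ∫ v : EuclideanSpace ℝ (Fin d), w ‖v‖ * ((‖v‖⁻¹ * v i) * v i) := by
    intro i
    set c : EuclideanSpace ℝ (Fin d) := EuclideanSpace.single i 1 with hc
    have hF : ∀ v : EuclideanSpace ℝ (Fin d), HasGradientAt (fun v => inner ℝ c v) c v := fun v =>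
      hasGradientAt_iff_hasFDerivAt.2 (innerSL ℝ c).hasFDerivAt
    have := integral_cutoff_mul_gradient hψ hsupp hderiv (fun v _ => hF v) continuousOn_const c
    simpa [hc, inner_smul_left, EuclideanSpace.inner_single_left,
      EuclideanSpace.inner_single_right] using this
  have hsum : ∀ v : EuclideanSpace ℝ (Fin d),
      ∑ i, w ‖v‖ * ((‖v‖⁻¹ * v i) * v i) = w ‖v‖ * ‖v‖ := by
    intro v
    rw [← Finset.mul_sum]
    congr 1
    rcases eq_or_ne v 0 with rfl | hv
    · simp
    · have hn : ‖v‖ ≠ 0 := norm_ne_zero_iff.2 hv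
      have : ‖v‖ ^ 2 = ∑ i, v i * v i := by
        rw [EuclideanSpace.norm_sq_eq]
        exact Finset.sum_congr rfl fun i _ => by rw [Real.norm_eq_abs, sq_abs, sq]
      simp only [mul_assoc]
      rw [← Finset.mul_sum, ← this]
      field_simp
  have hint : ∀ i : Fin d, Integrable (fun v : EuclideanSpace ℝ (Fin d) =>
      w ‖v‖ * ((‖v‖⁻¹ * v i) * v i)) := by
    intro i
    refine integrable_radial_mul (C := b) hw hshell ?_ fun v hv => ?_
    · refine Measurable.aestronglyMeasurable ?_
      fun_prop
    · have hi : |v i| ≤ ‖v‖ := by simpa using PiLp.norm_apply_le v i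
      rw [mem_closedBall_zero_iff] at hv
      rw [abs_mul, abs_mul, abs_inv, abs_norm]
      have h2 : ‖v‖⁻¹ * |v i| ≤ 1 := by
        rcases eq_or_ne v 0 with rfl | h0
        · simp
        · rwa [inv_mul_le_iff₀ (norm_pos_iff.2 h0), mul_one]
      nlinarith [abs_nonneg (v i)]
  calc d * ∫ v, ψ v = ∑ i : Fin d, ∫ v, ψ v := by simp
    _ = ∑ i : Fin d, ∫ v : EuclideanSpace ℝ (Fin d), w ‖v‖ * ((‖v‖⁻¹ * v i) * v i) :=
        Finset.sum_congr rfl fun i _ => h1 i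
    _ = _ := by
        rw [← integral_finsetSum _ fun i _ => hint i]
        exact integral_congr_ae (Eventually.of_forall hsum)

/-- One-point gradient estimation on a sphere, with the sharp dimension-free constant: if the
gradient of `F` is within `L` of `g` on the ball of radius `r`, then so is
`(d / r) E[F(r u) u]`, `u` uniform on the unit sphere. By the divergence theorem on the ball this
vector is the average of the gradient over the ball. Radial cutoffs `ψ` that converge to the
indicator of the ball replace the divergence theorem. -/
theorem abs_sphere_average_sub_inner_le {d : ℕ} (hd : 0 < d) {r L : ℝ} (hr : 0 < r)
    {F : EuclideanSpace ℝ (Fin d) → ℝ} {F' : EuclideanSpace ℝ (Fin d) → EuclideanSpace ℝ (Fin d)}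
    {g : EuclideanSpace ℝ (Fin d)}
    (hF : ∀ v ∈ Metric.closedBall 0 r, HasGradientAt F (F' v) v)
    (hF' : ContinuousOn F' (Metric.closedBall 0 r))
    (hL : ∀ v ∈ Metric.closedBall 0 r, ‖F' v - g‖ ≤ L) (e : EuclideanSpace ℝ (Fin d)) :
    |d / r * ∫ u, F (r • u) * inner ℝ u e ∂(uniformSphere d) - inner ℝ g e| ≤ L * ‖e‖ := by
  set I := ∫ u, F (r • u) * inner ℝ u e ∂(uniformSphere d) with hI
  have hcF : ContinuousOn F (Metric.closedBall 0 r) := fun v hv =>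
    (hF v hv).differentiableAt.continuousAt.continuousWithinAt
  have hL0 : 0 ≤ L := (norm_nonneg _).trans (hL 0 (by simp [hr.le]))
  -- the estimate up to an error `κ`, by a cutoff that lives on the shell of radii in `[r - κ, r]`
  have key : ∀ κ > 0, |d * I - r * inner ℝ g e| ≤
      r * (L * ‖e‖) + κ * (d * ‖e‖ + |inner ℝ g e|) := by
    intro κ hκ
    obtain ⟨τ, hτ, hunif⟩ := Metric.uniformContinuousOn_iff.1
      ((isCompact_closedBall _ _).uniformContinuousOn_of_continuous hcF) κ hκ
    set a := r - min (r / 2) (min κ (τ / 2)) with ha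
    have hm : 0 < min (r / 2) (min κ (τ / 2)) := by positivity
    have ha0 : 0 < a := by
      have := min_le_left (r / 2) (min κ (τ / 2))
      linarith
    have har : a < r := by linarith
    have haκ : r - a ≤ κ := by
      have := (min_le_right (r / 2) (min κ (τ / 2))).trans (min_le_left _ _)
      linarith
    have haτ : r - a < τ := by
      have := (min_le_right (r / 2) (min κ (τ / 2))).trans (min_le_right _ _)
      linarith
    obtain ⟨ψ, w, hψ, hw, hψ0, hψpos, hsupp, hw0, hshell, hderiv⟩ := exists_radial_cutoff d ha0 har
    set W := ∫ v : EuclideanSpace ℝ (Fin d), w ‖v‖ with hW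
    set Ψ := ∫ v, ψ v with hΨ
    have hwi : Integrable (fun v : EuclideanSpace ℝ (Fin d) => w ‖v‖) := by
      simpa using integrable_radial_mul (K := fun _ : EuclideanSpace ℝ (Fin d) => (1 : ℝ)) (C := 1)
        hw hshell aestronglyMeasurable_const (by simp)
    have hwn : Integrable (fun v : EuclideanSpace ℝ (Fin d) => w ‖v‖ * ‖v‖) :=
      integrable_radial_mul (C := r) hw hshell continuous_norm.aestronglyMeasurable
        fun v hv => by simpa using hv
    have hcpt : HasCompactSupport ψ :=
      (isCompact_closedBall _ _).of_isClosed_subset (isClosed_tsupport _) hsupp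
    have hψi : Integrable ψ := hψ.continuous.integrable_of_hasCompactSupport hcpt
    have hΨpos : 0 < Ψ :=
      hψ.continuous.integral_pos_of_hasCompactSupport_nonneg_nonzero hcpt hψ0 hψpos.ne'
    have hd' : (0 : ℝ) < d := by exact_mod_cast hd
    have hdΨ := dim_mul_integral_cutoff hψ hsupp hw hshell hderiv
    have hupper : d * Ψ ≤ r * W := by
      rw [hdΨ, hW, ← integral_const_mul]
      refine integral_mono hwn (hwi.const_mul _) fun v => ?_
      by_cases h0 : w ‖v‖ = 0
      · simp [h0]
      · have := (hshell _ (norm_nonneg v) h0).2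
        have := hw0 _ (norm_nonneg v)
        simp only
        nlinarith
    have hlower : a * W ≤ d * Ψ := by
      rw [hdΨ, hW, ← integral_const_mul]
      refine integral_mono (hwi.const_mul _) hwn fun v => ?_
      by_cases h0 : w ‖v‖ = 0
      · simp [h0]
      · have := (hshell _ (norm_nonneg v) h0).1
        have := hw0 _ (norm_nonneg v)
        simp only
        nlinarith
    have hWpos : 0 < W := by
      have : 0 < d * Ψ := by positivity
      exact pos_of_mul_pos_right (this.trans_le hupper) hr.le
    -- the volume term
    have hgrad : ∀ v, |ψ v * inner ℝ (F' v) e - ψ v * inner ℝ g e| ≤ ψ v * (L * ‖e‖) := by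
      intro v
      by_cases hv : v ∈ Metric.closedBall 0 r
      · rw [← mul_sub, ← inner_sub_left, abs_mul, abs_of_nonneg (hψ0 v)]
        refine mul_le_mul_of_nonneg_left ?_ (hψ0 v)
        exact (abs_real_inner_le_norm _ _).trans
          (mul_le_mul_of_nonneg_right (hL v hv) (norm_nonneg e))
      · have : ψ v = 0 := image_eq_zero_of_notMem_tsupport fun h => hv (hsupp h)
        simp [this]
    have hF'i : Integrable (fun v => ψ v * inner ℝ (F' v) e) := by
      have : IntegrableOn (fun v => ψ v * inner ℝ (F' v) e) (Metric.closedBall 0 r) :=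
        (hψ.continuous.continuousOn.mul (hF'.inner continuousOn_const)).integrableOn_compact
          (isCompact_closedBall _ _)
      refine (integrableOn_iff_integrable_of_support_subset fun v hv => ?_).1 this
      exact hsupp (subset_tsupport _ (left_ne_zero_of_mul hv))
    have hvol : |(∫ v, ψ v * inner ℝ (F' v) e) - Ψ * inner ℝ g e| ≤ Ψ * (L * ‖e‖) := by
      rw [hΨ, ← integral_mul_const, ← integral_mul_const,
        ← integral_sub hF'i (hψi.mul_const _)]
      refine (abs_integral_le_integral_abs).trans ?_
      exact integral_mono (hF'i.sub (hψi.mul_const _)).abs (hψi.mul_const _) hgrad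
    -- the surface term
    have hsurf : |(∫ v, w ‖v‖ * (inner ℝ (‖v‖⁻¹ • v) e * F v)) - W * I| ≤ W * (‖e‖ * κ) := by
      have hpolar := integral_radial_mul_angular hd w (fun u => F (r • u) * inner ℝ u e)
      obtain ⟨M, hM⟩ :=
        (isCompact_closedBall (0 : EuclideanSpace ℝ (Fin d)) r).exists_bound_of_continuousOn hcF
      have hunit : ∀ v : EuclideanSpace ℝ (Fin d), ‖‖v‖⁻¹ • v‖ ≤ 1 := fun v => by
        rw [norm_smul, norm_inv, norm_norm]
        exact inv_mul_le_one
      have hproj : ∀ v : EuclideanSpace ℝ (Fin d), r • ‖v‖⁻¹ • v ∈ Metric.closedBall 0 r :=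
        fun v => by
          rw [mem_closedBall_zero_iff, norm_smul, Real.norm_of_nonneg hr.le]
          exact mul_le_of_le_one_right hr.le (hunit v)
      have hinner : ∀ v : EuclideanSpace ℝ (Fin d), |inner ℝ (‖v‖⁻¹ • v) e| ≤ ‖e‖ := fun v =>
        (abs_real_inner_le_norm _ _).trans (mul_le_of_le_one_left (norm_nonneg e) (hunit v))
      have hG : Measurable ((Metric.closedBall 0 r).indicator F) := by
        classical
        rw [← Set.piecewise_eq_indicator]
        exact hcF.measurable_piecewise continuousOn_const Metric.isClosed_closedBall.measurableSet
      have hi1 : Integrable (fun v => w ‖v‖ * (inner ℝ (‖v‖⁻¹ • v) e * F v)) := by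
        refine integrable_radial_mul (C := ‖e‖ * M) hw hshell ?_ fun v hv => ?_
        · refine AEStronglyMeasurable.mul ?_
            (hcF.aestronglyMeasurable Metric.isClosed_closedBall.measurableSet)
          refine Measurable.aestronglyMeasurable ?_
          fun_prop
        · rw [abs_mul]
          exact mul_le_mul (hinner v) (hM v hv) (abs_nonneg _) (norm_nonneg e)
      have hi2 : Integrable (fun v : EuclideanSpace ℝ (Fin d) =>
          w ‖v‖ * (F (r • ‖v‖⁻¹ • v) * inner ℝ (‖v‖⁻¹ • v) e)) := by
        refine integrable_radial_mul (C := M * ‖e‖) hw hshell ?_ fun v hv => ?_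
        · refine Measurable.aestronglyMeasurable ?_
          have : (fun v : EuclideanSpace ℝ (Fin d) => F (r • ‖v‖⁻¹ • v)) =
              fun v => (Metric.closedBall 0 r).indicator F (r • ‖v‖⁻¹ • v) :=
            funext fun v => (Set.indicator_of_mem (hproj v) F).symm
          refine Measurable.mul ?_ (by fun_prop)
          rw [this]
          exact hG.comp (by fun_prop)
        · rw [abs_mul]
          exact mul_le_mul (hM _ (hproj v)) (hinner v) (abs_nonneg _)
            ((norm_nonneg _).trans (hM _ (hproj v)))
      rw [← hpolar, ← integral_sub hi1 hi2, hW, ← integral_mul_const]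
      refine (abs_integral_le_integral_abs).trans ?_
      refine integral_mono (hi1.sub hi2).abs (hwi.mul_const _) fun v => ?_
      by_cases h0 : w ‖v‖ = 0
      · simp [h0]
      · obtain ⟨hva, hvr⟩ := hshell _ (norm_nonneg v) h0
        have hv0 : ‖v‖ ≠ 0 := (ha0.trans_le hva).ne'
        have hdist : dist v (r • ‖v‖⁻¹ • v) < τ := by
          have : v - r • ‖v‖⁻¹ • v = (1 - r * ‖v‖⁻¹) • v := by
            rw [sub_smul, one_smul, mul_smul]
          rw [dist_eq_norm, this, norm_smul, ← abs_norm v, Real.norm_eq_abs, ← abs_mul, abs_norm,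
            sub_mul, one_mul, mul_assoc, inv_mul_cancel₀ hv0, mul_one, abs_lt]
          constructor <;> linarith
        have hFF := (hunif v (mem_closedBall_zero_iff.2 hvr) _ (hproj v) hdist).le
        rw [Real.dist_eq] at hFF
        have : w ‖v‖ * (inner ℝ (‖v‖⁻¹ • v) e * F v) -
            w ‖v‖ * (F (r • ‖v‖⁻¹ • v) * inner ℝ (‖v‖⁻¹ • v) e) =
            w ‖v‖ * (inner ℝ (‖v‖⁻¹ • v) e * (F v - F (r • ‖v‖⁻¹ • v))) := by ring
        simp only [this]
        rw [abs_mul, abs_mul, abs_of_nonneg (hw0 _ (norm_nonneg v))]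
        exact mul_le_mul_of_nonneg_left (mul_le_mul (hinner v) hFF (abs_nonneg _) (norm_nonneg e))
          (hw0 _ (norm_nonneg v))
    rw [← integral_cutoff_mul_gradient hψ hsupp hderiv hF hF' e] at hsurf
    set J := ∫ v, ψ v * inner ℝ (F' v) e with hJ
    have h1 : |d * (J - W * I)| ≤ d * (W * (‖e‖ * κ)) := by
      rw [abs_mul, abs_of_pos hd']
      exact mul_le_mul_of_nonneg_left hsurf hd'.le
    have h2 : |d * (J - Ψ * inner ℝ g e)| ≤ r * W * (L * ‖e‖) := by
      rw [abs_mul, abs_of_pos hd']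
      calc d * |J - Ψ * inner ℝ g e| ≤ d * (Ψ * (L * ‖e‖)) := mul_le_mul_of_nonneg_left hvol hd'.le
        _ = (d * Ψ) * (L * ‖e‖) := by ring
        _ ≤ _ := mul_le_mul_of_nonneg_right hupper (mul_nonneg hL0 (norm_nonneg e))
    have h3 : |(d * Ψ - r * W) * inner ℝ g e| ≤ κ * W * |inner ℝ g e| := by
      rw [abs_mul]
      refine mul_le_mul_of_nonneg_right ?_ (abs_nonneg _)
      rw [abs_le]
      constructor <;> nlinarith
    have h4 : W * (d * I - r * inner ℝ g e) = -(d * (J - W * I)) + d * (J - Ψ * inner ℝ g e) +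
        (d * Ψ - r * W) * inner ℝ g e := by ring
    have h5 : W * |d * I - r * inner ℝ g e| ≤
        W * (r * (L * ‖e‖) + κ * (d * ‖e‖ + |inner ℝ g e|)) := by
      rw [← abs_of_pos hWpos, ← abs_mul, abs_of_pos hWpos, h4]
      refine (abs_add_three _ _ _).trans ?_
      rw [abs_neg]
      linarith
    exact le_of_mul_le_mul_left h5 hWpos
  have hlim : |d * I - r * inner ℝ g e| ≤ r * (L * ‖e‖) := by
    have ht : Tendsto (fun κ : ℝ => r * (L * ‖e‖) + κ * (d * ‖e‖ + |inner ℝ g e|)) (𝓝[>] 0)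
        (𝓝 (r * (L * ‖e‖))) := by
      refine tendsto_nhdsWithin_of_tendsto_nhds ?_
      exact Continuous.tendsto' (by fun_prop) _ _ (by simp)
    refine ge_of_tendsto ht ?_
    filter_upwards [self_mem_nhdsWithin] with κ hκ
    exact key κ hκ
  have h6 : d / r * I - inner ℝ g e = (d * I - r * inner ℝ g e) / r := by
    field_simp
  rw [h6, abs_div, abs_of_pos hr, div_le_iff₀ hr]
  linarith

/-! ### Coercive costs with locally Lipschitz gradient -/

section Coercive

variable {E : Type*} [NormedAddCommGroup E] {f : E → ℝ} {S : Set E}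

/-- The cost cannot blow up at a point of the domain, so the domain has no boundary points. -/
lemma CoerciveOn.isOpen (h : CoerciveOn f S) : IsOpen S := by
  rw [← disjoint_frontier_iff_isOpen, Set.disjoint_left]
  intro y hy hyS
  have := (h.1 y hy).eventually_gt_atTop (f y)
  exact lt_irrefl _ (eventually_pure.1 (this.filter_mono (pure_le_nhdsWithin hyS)))

lemma CoerciveOn.mem_of_mem_closure (h : CoerciveOn f S) {B : Set E} (hBS : B ⊆ S) {a : ℝ}
    (hB : ∀ y ∈ B, f y ≤ a) {y : E} (hy : y ∈ closure B) : y ∈ S := by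
  by_contra hyS
  have hfr : y ∈ frontier S := ⟨closure_mono hBS hy, fun hi => hyS (interior_subset hi)⟩
  have hne : (𝓝[B] y).NeBot := mem_closure_iff_nhdsWithin_neBot.1 hy
  have h1 := ((h.1 y hfr).mono_left (nhdsWithin_mono y hBS)).eventually_gt_atTop a
  obtain ⟨z, hz, hzB⟩ := (h1.and self_mem_nhdsWithin).exists
  exact (hB z hzB).not_gt hz

lemma CoerciveOn.isCompact_sublevel [NormedSpace ℝ E] [FiniteDimensional ℝ E]
    (h : CoerciveOn f S) (hf : ContinuousOn f S) (a : ℝ) : IsCompact {x | x ∈ S ∧ f x ≤ a} := by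
  have : ProperSpace E := FiniteDimensional.proper ℝ E
  refine Metric.isCompact_of_isClosed_isBounded ?_ ?_
  · refine isClosed_of_closure_subset fun y hy => ?_
    have hyS : y ∈ S := h.mem_of_mem_closure (fun x hx => hx.1) (fun x hx => hx.2) hy
    refine ⟨hyS, ?_⟩
    have hne : (𝓝[{x | x ∈ S ∧ f x ≤ a}] y).NeBot := mem_closure_iff_nhdsWithin_neBot.1 hy
    have hsub : {x | x ∈ S ∧ f x ≤ a} ⊆ S := fun x hx => hx.1
    refine le_of_tendsto ((hf y hyS).mono_left (nhdsWithin_mono y hsub)) ?_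
    filter_upwards [self_mem_nhdsWithin] with x hx using hx.2
  · have h1 := h.2.eventually_gt_atTop a
    rw [eventually_inf_principal] at h1
    refine (Bornology.isBounded_def.2 ?_)
    filter_upwards [h1] with x hx hxK
    exact (hx hxK.1).not_ge hxK.2

end Coercive

/-- The consequences of local Lipschitz continuity and of coercivity on a compact sublevel set `K`
with uniform constants: balls of radius `rho0` around points of `K` stay in the domain, and `f` and
its gradient are Lipschitz there with constants `lam0` and `phi0`. -/
structure UniformBounds {E : Type*} [NormedAddCommGroup E] [InnerProductSpace ℝ E]
    [CompleteSpace E] (X K : Set E) (f : E → ℝ) (lam0 phi0 rho0 : ℝ) : Prop where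
  isOpen : IsOpen X
  isCompact : IsCompact K
  subset : K ⊆ X
  differentiableAt : ∀ x ∈ X, DifferentiableAt ℝ f x
  continuousOn_gradient : ContinuousOn (gradient f) X
  rho0_pos : 0 < rho0
  phi0_nonneg : 0 ≤ phi0
  lam0_nonneg : 0 ≤ lam0
  mem : ∀ x ∈ K, ∀ x', ‖x' - x‖ ≤ rho0 → x' ∈ X
  lipschitz : ∀ x ∈ K, ∀ x', ‖x' - x‖ ≤ rho0 → |f x' - f x| ≤ lam0 * ‖x' - x‖
  lipschitz_gradient : ∀ x ∈ K, ∀ x', ‖x' - x‖ ≤ rho0 →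
    ‖gradient f x' - gradient f x‖ ≤ phi0 * ‖x' - x‖
  norm_gradient_le : ∀ x ∈ K, ‖gradient f x‖ ≤ lam0

/-- The modulus of a local Lipschitz estimate is nonnegative, as there are points `x' ≠ x`. -/
lemma modulus_nonneg {E : Type*} [NormedAddCommGroup E] [InnerProductSpace ℝ E] [Nontrivial E]
    {x : E} {a m : ℝ} (ha : 0 < a) {g : E → ℝ}
    (hg : ∀ x', 0 ≤ g x') (h : ∀ x', ‖x' - x‖ ≤ a → g x' ≤ m * ‖x' - x‖) : 0 ≤ m := by
  obtain ⟨v, hv⟩ := exists_norm_eq E ha.le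
  have := h (x + v) (by simp [hv])
  rw [add_sub_cancel_left, hv] at this
  exact nonneg_of_mul_nonneg_left ((hg _).trans this) ha

section Regular

variable {E : Type*} [NormedAddCommGroup E] [InnerProductSpace ℝ E] [CompleteSpace E]
  {S K : Set E} {f lam zeta phi beta : E → ℝ}

lemma RegularCost.continuousOn (h : RegularCost S f lam zeta phi beta) : ContinuousOn f S :=
  fun x hx => (h.differentiableAt x hx).continuousAt.continuousWithinAt

/-- A ball on which `f` is bounded cannot reach the boundary of the domain. -/
lemma RegularCost.mem_of_norm_sub_le (h : RegularCost S f lam zeta phi beta) {x x' : E}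
    (hx : x ∈ S) (hx' : ‖x' - x‖ ≤ zeta x) : x' ∈ S := by
  have hbd : ∀ y ∈ Metric.closedBall x (zeta x), f y ≤ f x + |lam x| * zeta x := by
    intro y hy
    rw [mem_closedBall_iff_norm] at hy
    have h1 := (abs_le.1 (h.lipschitz x hx y hy)).2
    have h2 : lam x * ‖y - x‖ ≤ |lam x| * zeta x :=
      mul_le_mul (le_abs_self _) hy (norm_nonneg _) (abs_nonneg _)
    linarith
  have hball : Metric.ball x (zeta x) ⊆ S := by
    refine (convex_ball x (zeta x)).isPreconnected.subset_of_closure_inter_subset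
      h.coercive.isOpen ⟨x, Metric.mem_ball_self (h.zeta_pos x hx), hx⟩ ?_
    rintro y ⟨hy, hyb⟩
    refine h.coercive.mem_of_mem_closure (B := Metric.ball x (zeta x) ∩ S) Set.inter_subset_right
      (fun z hz => hbd z (Metric.ball_subset_closedBall hz.1)) ?_
    exact Metric.isOpen_ball.inter_closure ⟨hyb, hy⟩
  refine h.coercive.mem_of_mem_closure hball
    (fun z hz => hbd z (Metric.ball_subset_closedBall hz)) ?_
  rw [closure_ball x (h.zeta_pos x hx).ne', mem_closedBall_iff_norm]
  exact hx'

lemma RegularCost.uniformBounds [FiniteDimensional ℝ E] [Nontrivial E]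
    (h : RegularCost S f lam zeta phi beta) (hK : IsCompact K) (hKS : K ⊆ S) (hne : K.Nonempty) :
    UniformBounds S K f (sSup (lam '' K)) (sSup (phi '' K))
      (sInf ((fun x => min (beta x) (zeta x)) '' K)) := by
  have hlamc : BddAbove (lam '' K) :=
    (hK.image_of_continuousOn (h.continuousOn_lam.mono hKS)).bddAbove
  have hphic : BddAbove (phi '' K) :=
    (hK.image_of_continuousOn (h.continuousOn_phi.mono hKS)).bddAbove
  have hminc : ContinuousOn (fun x => min (beta x) (zeta x)) K :=
    (h.continuousOn_beta.mono hKS).inf (h.continuousOn_zeta.mono hKS)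
  obtain ⟨y, hy, hymin⟩ := (hK.image_of_continuousOn hminc).sInf_mem (hne.image _)
  simp only at hymin
  have hrho : ∀ x ∈ K, sInf ((fun x => min (beta x) (zeta x)) '' K) ≤ min (beta x) (zeta x) :=
    fun x hx => csInf_le (hK.image_of_continuousOn hminc).bddBelow (Set.mem_image_of_mem _ hx)
  have hlam : ∀ x ∈ K, lam x ≤ sSup (lam '' K) := fun x hx =>
    le_csSup hlamc (Set.mem_image_of_mem _ hx)
  have hphi : ∀ x ∈ K, phi x ≤ sSup (phi '' K) := fun x hx =>
    le_csSup hphic (Set.mem_image_of_mem _ hx)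
  have hlam0 : ∀ x ∈ K, 0 ≤ lam x := fun x hx =>
    modulus_nonneg (h.zeta_pos x (hKS hx)) (fun _ => abs_nonneg _) (h.lipschitz x (hKS hx))
  have hphi0 : ∀ x ∈ K, 0 ≤ phi x := fun x hx =>
    modulus_nonneg (h.beta_pos x (hKS hx)) (fun _ => norm_nonneg _)
      (h.lipschitz_gradient x (hKS hx))
  refine ⟨h.coercive.isOpen, hK, hKS, h.differentiableAt, h.continuousOn_gradient, ?_,
    (hphi0 y hy).trans (hphi y hy), (hlam0 y hy).trans (hlam y hy), ?_, ?_, ?_, ?_⟩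
  · rw [← hymin]
    exact lt_min (h.beta_pos y (hKS hy)) (h.zeta_pos y (hKS hy))
  · exact fun x hx x' hx' => h.mem_of_norm_sub_le (hKS hx)
      (hx'.trans ((hrho x hx).trans (min_le_right _ _)))
  · exact fun x hx x' hx' => (h.lipschitz x (hKS hx) x'
      (hx'.trans ((hrho x hx).trans (min_le_right _ _)))).trans
      (mul_le_mul_of_nonneg_right (hlam x hx) (norm_nonneg _))
  · exact fun x hx x' hx' => (h.lipschitz_gradient x (hKS hx) x'
      (hx'.trans ((hrho x hx).trans (min_le_left _ _)))).trans
      (mul_le_mul_of_nonneg_right (hphi x hx) (norm_nonneg _))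
  · intro x hx
    have h1 := (h.differentiableAt x (hKS hx)).hasFDerivAt.le_of_lip' (hlam0 x hx)
      (by
        filter_upwards [Metric.closedBall_mem_nhds x (h.zeta_pos x (hKS hx))] with x' hx'
        exact h.lipschitz x (hKS hx) x' (mem_closedBall_iff_norm.1 hx'))
    rw [← toDual_gradient, LinearIsometryEquiv.norm_map] at h1
    exact h1.trans (hlam x hx)

end Regular

section Descent

variable {E : Type*} [NormedAddCommGroup E] [InnerProductSpace ℝ E] [CompleteSpace E]
  {X K : Set E} {f : E → ℝ} {lam0 phi0 rho0 : ℝ}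

lemma UniformBounds.continuousOn (h : UniformBounds X K f lam0 phi0 rho0) : ContinuousOn f X :=
  fun x hx => (h.differentiableAt x hx).continuousAt.continuousWithinAt

/-- The descent lemma: the quadratic upper bound of a function with Lipschitz gradient. -/
lemma UniformBounds.le_quadratic (h : UniformBounds X K f lam0 phi0 rho0) {x d : E} (hx : x ∈ K)
    (hd : ‖d‖ ≤ rho0) : f (x + d) ≤ f x + inner ℝ (gradient f x) d + phi0 / 2 * ‖d‖ ^ 2 := by
  have hnear : ∀ t ∈ Set.Icc (0 : ℝ) 1, ‖x + t • d - x‖ ≤ rho0 ∧ ‖x + t • d - x‖ = t * ‖d‖ := by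
    intro t ht
    have : ‖x + t • d - x‖ = t * ‖d‖ := by
      rw [add_sub_cancel_left, norm_smul, Real.norm_of_nonneg ht.1]
    exact ⟨this ▸ (mul_le_of_le_one_left (norm_nonneg d) ht.2).trans hd, this⟩
  set g : ℝ → ℝ := fun t => f (x + t • d) - t * inner ℝ (gradient f x) d -
    phi0 / 2 * t ^ 2 * ‖d‖ ^ 2 with hg
  have hderiv : ∀ t ∈ Set.Icc (0 : ℝ) 1, HasDerivAt g (inner ℝ (gradient f (x + t • d)) d -
      inner ℝ (gradient f x) d - phi0 * t * ‖d‖ ^ 2) t := by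
    intro t ht
    have h1 : HasFDerivAt f (fderiv ℝ f (x + t • d)) (x + t • d) :=
      (h.differentiableAt _ (h.mem x hx _ (hnear t ht).1)).hasFDerivAt
    have h2 : HasDerivAt (fun t : ℝ => x + t • d) d t := by
      simpa using ((hasDerivAt_id t).smul_const d).const_add x
    have h3 := h1.comp_hasDerivAt t h2
    rw [← inner_gradient_left] at h3
    have h4 : HasDerivAt (fun t : ℝ => t * inner ℝ (gradient f x) d)
        (inner ℝ (gradient f x) d) t := by
      simpa using (hasDerivAt_id t).mul_const (inner ℝ (gradient f x) d)
    have h5 : HasDerivAt (fun t : ℝ => phi0 / 2 * t ^ 2 * ‖d‖ ^ 2) (phi0 * t * ‖d‖ ^ 2) t := by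
      have := ((hasDerivAt_pow 2 t).const_mul (phi0 / 2)).mul_const (‖d‖ ^ 2)
      refine this.congr_deriv ?_
      push_cast
      ring
    exact (h3.sub h4).sub h5
  have hanti : AntitoneOn g (Set.Icc 0 1) := by
    refine antitoneOn_of_deriv_nonpos (convex_Icc 0 1)
      (fun t ht => (hderiv t ht).continuousAt.continuousWithinAt)
      (fun t ht => (hderiv t (interior_subset ht)).differentiableAt.differentiableWithinAt) ?_
    intro t ht
    have ht' := interior_subset ht
    rw [(hderiv t ht').deriv, ← inner_sub_left]
    have h1 := (real_inner_le_norm (gradient f (x + t • d) - gradient f x) d).trans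
      (mul_le_mul_of_nonneg_right (h.lipschitz_gradient x hx _ (hnear t ht').1) (norm_nonneg d))
    rw [(hnear t ht').2] at h1
    nlinarith
  have := hanti (Set.left_mem_Icc.2 zero_le_one) (Set.right_mem_Icc.2 zero_le_one) zero_le_one
  simp only [hg, one_smul, zero_smul, add_zero] at this
  linarith

end Descent

/-! ### Blocks of the state -/

section Block

variable {ι : Type*} {q : ι → ℕ}

lemma norm_apply_le [Fintype ι] (x : BlockVec q) (i : ι) : ‖x i‖ ≤ ‖x‖ := PiLp.norm_apply_le x i

variable [DecidableEq ι]

@[simp]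
lemma setBlock_same (x : BlockVec q) (i : ι) (y : EuclideanSpace ℝ (Fin (q i))) :
    setBlock x i y i = y := by
  simp [setBlock]

@[simp]
lemma setBlock_setBlock (x : BlockVec q) (i : ι) (y y' : EuclideanSpace ℝ (Fin (q i))) :
    setBlock (setBlock x i y) i y' = setBlock x i y' := by
  simp [setBlock]

@[simp]
lemma setBlock_self (x : BlockVec q) (i : ι) : setBlock x i (x i) = x := by
  simp [setBlock]

variable [Fintype ι]

lemma norm_setBlock_sub (x : BlockVec q) (i : ι) (y : EuclideanSpace ℝ (Fin (q i))) :
    ‖setBlock x i y - x‖ = ‖y - x i‖ := by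
  have : setBlock x i y - x = PiLp.single 2 i (y - x i) := by
    ext j : 1
    by_cases hj : j = i
    · subst hj; simp
    · simp [setBlock, hj]
  rw [this]
  exact PiLp.norm_single ..

lemma hasGradientAt_setBlock {f : BlockVec q → ℝ} {x : BlockVec q} {i : ι}
    {y : EuclideanSpace ℝ (Fin (q i))} (h : DifferentiableAt ℝ f (setBlock x i y)) :
    HasGradientAt (fun y => f (setBlock x i y)) (gradient f (setBlock x i y) i) y := by
  have h1 : HasFDerivAt (fun y => setBlock x i y)
      (((PiLp.continuousLinearEquiv 2 ℝ fun i => EuclideanSpace ℝ (Fin (q i))).symm :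
        ((i : ι) → EuclideanSpace ℝ (Fin (q i))) →L[ℝ] BlockVec q) ∘L
        (ContinuousLinearMap.pi (Pi.single i (ContinuousLinearMap.id ℝ _)))) y :=
    ((PiLp.continuousLinearEquiv 2 ℝ fun i => EuclideanSpace ℝ (Fin (q i))).symm.hasFDerivAt).comp y
      (hasFDerivAt_update (𝕜 := ℝ) x.ofLp y)
  have h2 := h.hasFDerivAt.comp y h1
  rw [hasGradientAt_iff_hasFDerivAt]
  refine h2.congr_fderiv ?_
  ext v
  simp only [ContinuousLinearMap.comp_apply]
  rw [← inner_gradient_left, PiLp.inner_apply, Finset.sum_eq_single i]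
  · simp
  · intro j _ hj
    simp [hj]
  · simp

end Block

/-! ### Bound and bias of the one-point gradient estimate -/

section Measurability

variable {ι : Type*} [Fintype ι] [DecidableEq ι] {q p : ι → ℕ}

omit [Fintype ι] in
lemma continuous_setBlock (i : ι) : Continuous fun a : BlockVec q × EuclideanSpace ℝ (Fin (q i)) =>
    setBlock a.1 i a.2 :=
  (PiLp.continuous_toLp 2 _).comp
    (((PiLp.continuous_ofLp 2 _).comp continuous_fst).update i continuous_snd)

lemma measurable_setBlock {α : Type*} {mα : MeasurableSpace α} {i : ι} {x : α → BlockVec q}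
    {y : α → EuclideanSpace ℝ (Fin (q i))} (hx : Measurable x) (hy : Measurable y) :
    Measurable fun a => setBlock (x a) i (y a) :=
  (continuous_setBlock i).measurable.comp (hx.prodMk hy)

lemma measurable_gradEstimate {α : Type*} {mα : MeasurableSpace α}
    {hl : ι → BlockVec q → BlockVec p → ℝ}
    (hmeas : ∀ i, Measurable (fun a : BlockVec q × BlockVec p => hl i a.1 a.2)) (r : ι → ℝ) {i : ι}
    {y u : α → EuclideanSpace ℝ (Fin (q i))} {x : α → BlockVec q} {ξ : α → BlockVec p}
    (hy : Measurable y) (hx : Measurable x) (hu : Measurable u) (hξ : Measurable ξ) :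
    Measurable fun a => gradEstimate hl r i (y a) (x a) (u a) (ξ a) := by
  have h1 : Measurable fun a => hl i (setBlock (x a) i (y a + r i • u a)) (ξ a) :=
    (hmeas i).comp ((measurable_setBlock hx (hy.add (hu.const_smul (r i)))).prodMk hξ)
  exact (h1.const_mul _).smul hu

end Measurability

section Law

variable {ι : Type*} [Fintype ι] {q p : ι → ℕ} {D : Measure (BlockVec p)}

/-- The law of the randomness drawn in one iteration. -/
noncomputable abbrev sampleLaw (q : ι → ℕ) (D : Measure (BlockVec p)) : Measure (Sample q p) :=
  D.prod (Measure.pi fun i => uniformSphere (q i))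

lemma measurePreserving_sample_block (hq : ∀ i, 0 < q i) [IsProbabilityMeasure D] (i : ι) :
    MeasurePreserving (fun s : Sample q p => (s.1, s.2 i)) (sampleLaw q D)
      (D.prod (uniformSphere (q i))) := by
  have : ∀ i, IsProbabilityMeasure (uniformSphere (q i)) := fun i =>
    isProbabilityMeasure_uniformSphere (hq i)
  exact (MeasurePreserving.id D).prod (measurePreserving_eval (fun i => uniformSphere (q i)) i)

lemma isProbabilityMeasure_sampleLaw (hq : ∀ i, 0 < q i) [IsProbabilityMeasure D] :
    IsProbabilityMeasure (sampleLaw q D) := by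
  have : ∀ i, IsProbabilityMeasure (uniformSphere (q i)) := fun i =>
    isProbabilityMeasure_uniformSphere (hq i)
  infer_instance

end Law

lemma norm_perturbed_sub_le {d : ℕ} {x y u : EuclideanSpace ℝ (Fin d)} {r R : ℝ} (hr : 0 ≤ r)
    (hR : ‖y - x‖ + r ≤ R) (hu : ‖u‖ ≤ 1) : ‖y + r • u - x‖ ≤ R := by
  have h1 : y + r • u - x = (y - x) + r • u := by abel
  have h2 : ‖r • u‖ ≤ r := by
    rw [norm_smul, Real.norm_of_nonneg hr]
    exact mul_le_of_le_one_right hr hu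
  rw [h1]
  exact (norm_add_le _ _).trans (by linarith)

section Estimate

variable {ι : Type*} [Fintype ι] [DecidableEq ι] {q p : ι → ℕ} {G : SimpleGraph ι}
  {D : Measure (BlockVec p)} {X K : Set (BlockVec q)} {f : BlockVec q → ℝ}
  {hl : ι → BlockVec q → BlockVec p → ℝ} {fl : ι → BlockVec q → ℝ} {c lam0 phi0 rho0 : ℝ}

lemma LocalCosts.fl_nonneg (h : LocalCosts G D X f hl fl c) (i : ι) (x : BlockVec q) :
    0 ≤ fl i x := by
  rw [h.expectation]
  exact integral_nonneg fun ξ => h.nonneg i x ξ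

lemma LocalCosts.hasGradientAt (h : LocalCosts G D X f hl fl c) {i : ι} {x : BlockVec q}
    {y : EuclideanSpace ℝ (Fin (q i))} (hy : setBlock x i y ∈ X) :
    HasGradientAt (fun y => fl i (setBlock x i y)) (gradient f (setBlock x i y) i) y := by
  simpa using h.gradient_eq i _ hy

/-- The local and the global cost have the same block gradient, so that they change by the same
amount along block `i`. -/
lemma LocalCosts.fl_sub_eq (h : LocalCosts G D X f hl fl c)
    (hb : UniformBounds X K f lam0 phi0 rho0) {i : ι} {x : BlockVec q} (hx : x ∈ K)
    {y : EuclideanSpace ℝ (Fin (q i))} (hy : ‖y - x i‖ ≤ rho0) :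
    fl i (setBlock x i y) - fl i x = f (setBlock x i y) - f x := by
  have hmem : ∀ y ∈ Metric.closedBall (x i) rho0, setBlock x i y ∈ X := fun y hy =>
    hb.mem x hx _ (by rw [norm_setBlock_sub]; exact mem_closedBall_iff_norm.1 hy)
  have hd : ∀ y ∈ Metric.closedBall (x i) rho0,
      HasFDerivWithinAt (fun y => fl i (setBlock x i y) - f (setBlock x i y))
        (0 : EuclideanSpace ℝ (Fin (q i)) →L[ℝ] ℝ) (Metric.closedBall (x i) rho0) y := by
    intro y hy
    have h1 := hasGradientAt_iff_hasFDerivAt.1 (h.hasGradientAt (hmem y hy))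
    have h2 := hasGradientAt_iff_hasFDerivAt.1
      (hasGradientAt_setBlock (hb.differentiableAt _ (hmem y hy)))
    have h3 := h1.sub h2
    rw [sub_self] at h3
    exact h3.hasFDerivWithinAt
  have := (convex_closedBall (x i) rho0).norm_image_sub_le_of_norm_hasFDerivWithin_le (C := 0) hd
    (fun _ _ => by simp) (Metric.mem_closedBall_self hb.rho0_pos.le) (mem_closedBall_iff_norm.2 hy)
  simp only [setBlock_self, zero_mul, norm_le_zero_iff] at this
  linarith

lemma LocalCosts.fl_setBlock_le (h : LocalCosts G D X f hl fl c)
    (hb : UniformBounds X K f lam0 phi0 rho0) {i : ι} {x : BlockVec q} (hx : x ∈ K)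
    {y : EuclideanSpace ℝ (Fin (q i))} (hy : ‖y - x i‖ ≤ rho0) :
    fl i (setBlock x i y) ≤ fl i x + lam0 * rho0 := by
  have h1 := h.fl_sub_eq hb hx hy
  have h2 := hb.lipschitz x hx (setBlock x i y) (by rwa [norm_setBlock_sub])
  rw [norm_setBlock_sub] at h2
  have h3 := mul_le_mul_of_nonneg_left hy hb.lam0_nonneg
  linarith [le_abs_self (f (setBlock x i y) - f x)]

variable (h : LocalCosts G D X f hl fl c) (hb : UniformBounds X K f lam0 phi0 rho0)
  {r : ι → ℝ}

include h hb in
/-- All local costs observed by the estimate are at most `c (F0 + lam0 rho0)`. -/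
lemma LocalCosts.ae_norm_gradEstimate_le [IsProbabilityMeasure D] (hq : ∀ i, 0 < q i) (hc : 0 ≤ c)
    (hr : ∀ i, 0 < r i) {F0 : ℝ} (hF0 : ∀ x ∈ K, ∀ i, fl i x ≤ F0) {i : ι} {x : BlockVec q}
    (hx : x ∈ K) {y : EuclideanSpace ℝ (Fin (q i))} (hy : ‖y - x i‖ + r i ≤ rho0) :
    ∀ᵐ s ∂(sampleLaw q D), ‖gradEstimate hl r i y x (s.2 i) s.1‖ ≤
      q i / r i * (c * (F0 + lam0 * rho0)) := by
  have hprob := isProbabilityMeasure_uniformSphere (hq i)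
  have hmeas : Measurable fun a : BlockVec p × EuclideanSpace ℝ (Fin (q i)) =>
      ‖gradEstimate hl r i y x a.2 a.1‖ :=
    (measurable_gradEstimate h.measurable r measurable_const measurable_const measurable_snd
      measurable_fst).norm
  have hset : MeasurableSet {a : BlockVec p × EuclideanSpace ℝ (Fin (q i)) |
      ‖gradEstimate hl r i y x a.2 a.1‖ ≤ q i / r i * (c * (F0 + lam0 * rho0))} :=
    measurableSet_le hmeas measurable_const
  suffices hs : ∀ᵐ a ∂(D.prod (uniformSphere (q i))), ‖gradEstimate hl r i y x a.2 a.1‖ ≤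
      q i / r i * (c * (F0 + lam0 * rho0)) from
    (measurePreserving_sample_block hq i).quasiMeasurePreserving.ae hs
  rw [Measure.ae_prod_iff_ae_ae hset, Measure.ae_ae_comm hset]
  filter_upwards [ae_norm_eq_one_uniformSphere (q i)] with u hu
  have hnear : ‖y + r i • u - x i‖ ≤ rho0 := norm_perturbed_sub_le (hr i).le hy hu.le
  have hmem : setBlock x i (y + r i • u) ∈ X := hb.mem x hx _ (by rwa [norm_setBlock_sub])
  filter_upwards [h.le_mul i _ hmem] with ξ hξ
  have h1 : hl i (setBlock x i (y + r i • u)) ξ ≤ c * (F0 + lam0 * rho0) := by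
    refine hξ.trans (mul_le_mul_of_nonneg_left ?_ hc)
    have := h.fl_setBlock_le hb hx hnear
    linarith [hF0 x hx i]
  have h2 : 0 ≤ (q i : ℝ) / r i := div_nonneg (Nat.cast_nonneg _) (hr i).le
  rw [gradEstimate, norm_smul, hu, mul_one, Real.norm_of_nonneg (mul_nonneg h2 (h.nonneg _ _ _))]
  exact mul_le_mul_of_nonneg_left h1 h2

include h hb in
/-- The bias of the gradient estimate, by the sphere average theorem for the local cost. -/
lemma LocalCosts.norm_integral_gradEstimate_sub_le [IsProbabilityMeasure D] (hq : ∀ i, 0 < q i)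
    (hr : ∀ i, 0 < r i) {i : ι} {x : BlockVec q} (hx : x ∈ K)
    {y : EuclideanSpace ℝ (Fin (q i))} (hy : ‖y - x i‖ + r i ≤ rho0)
    (hint : Integrable (fun s => gradEstimate hl r i y x (s.2 i) s.1) (sampleLaw q D)) :
    ‖∫ s, gradEstimate hl r i y x (s.2 i) s.1 ∂(sampleLaw q D) - gradient f x i‖ ≤
      phi0 * (‖y - x i‖ + r i) := by
  have hprob := isProbabilityMeasure_uniformSphere (hq i)
  have hri := hr i
  set V := ∫ s, gradEstimate hl r i y x (s.2 i) s.1 ∂(sampleLaw q D) with hV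
  have hmeas : Measurable fun a : BlockVec p × EuclideanSpace ℝ (Fin (q i)) =>
      gradEstimate hl r i y x a.2 a.1 :=
    measurable_gradEstimate h.measurable r measurable_const measurable_const measurable_snd
      measurable_fst
  have hmp := measurePreserving_sample_block (D := D) hq i
  have hint' : Integrable (fun a : BlockVec p × EuclideanSpace ℝ (Fin (q i)) =>
      gradEstimate hl r i y x a.2 a.1) (D.prod (uniformSphere (q i))) :=
    (hmp.integrable_comp hmeas.aestronglyMeasurable).1 hint
  have hnear : ∀ v ∈ Metric.closedBall (0 : EuclideanSpace ℝ (Fin (q i))) (r i),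
      ‖setBlock x i (y + v) - x‖ ≤ ‖y - x i‖ + r i := by
    intro v hv
    rw [norm_setBlock_sub]
    have : y + v - x i = (y - x i) + v := by abel
    rw [this]
    exact (norm_add_le _ _).trans (by linarith [mem_closedBall_zero_iff.1 hv])
  have hmem : ∀ v ∈ Metric.closedBall (0 : EuclideanSpace ℝ (Fin (q i))) (r i),
      setBlock x i (y + v) ∈ X := fun v hv => hb.mem x hx _ ((hnear v hv).trans hy)
  have hval : ∀ e, inner ℝ V e = q i / r i *
      ∫ u, fl i (setBlock x i (y + r i • u)) * inner ℝ u e ∂(uniformSphere (q i)) := by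
    intro e
    have h1 : V = ∫ a, gradEstimate hl r i y x a.2 a.1 ∂(D.prod (uniformSphere (q i))) := by
      rw [hV, ← hmp.map_eq, integral_map hmp.measurable.aemeasurable hmeas.aestronglyMeasurable]
    rw [h1, real_inner_comm, ← integral_inner hint',
      integral_prod_symm _ (hint'.const_inner e), ← integral_const_mul]
    refine integral_congr_ae (Eventually.of_forall fun u => ?_)
    simp only [gradEstimate, inner_smul_right, h.expectation]
    rw [integral_mul_const, integral_const_mul, real_inner_comm]
    ring
  have hgrad : ∀ v ∈ Metric.closedBall (0 : EuclideanSpace ℝ (Fin (q i))) (r i),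
      HasGradientAt (fun v => fl i (setBlock x i (y + v))) (gradient f (setBlock x i (y + v)) i)
        v := by
    intro v hv
    have h1 := hasGradientAt_iff_hasFDerivAt.1 (h.hasGradientAt (hmem v hv))
    rw [hasGradientAt_iff_hasFDerivAt]
    exact (hasFDerivAt_comp_add_left (f := fun y => fl i (setBlock x i y)) y).2 h1
  have hcont : ContinuousOn (fun v => gradient f (setBlock x i (y + v)) i)
      (Metric.closedBall 0 (r i)) := by
    have h1 : Continuous fun v : EuclideanSpace ℝ (Fin (q i)) => setBlock x i (y + v) :=
      (continuous_setBlock i).comp (continuous_const.prodMk (continuous_const.add continuous_id))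
    have h2 := hb.continuousOn_gradient.comp h1.continuousOn hmem
    exact (PiLp.continuous_apply 2 _ i).comp_continuousOn h2
  have hbias : ∀ e, inner ℝ (V - gradient f x i) e ≤ phi0 * (‖y - x i‖ + r i) * ‖e‖ := by
    intro e
    have h1 := abs_sphere_average_sub_inner_le (hq i) hri hgrad hcont (g := gradient f x i)
      (L := phi0 * (‖y - x i‖ + r i)) (fun v hv => by
        have h2 := hb.lipschitz_gradient x hx _ ((hnear v hv).trans hy)
        have h3 := norm_apply_le (gradient f (setBlock x i (y + v)) - gradient f x) i
        rw [PiLp.sub_apply] at h3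
        exact (h3.trans h2).trans (mul_le_mul_of_nonneg_left (hnear v hv) hb.phi0_nonneg)) e
    rw [inner_sub_left, hval]
    exact (le_abs_self _).trans h1
  have h1 := hbias (V - gradient f x i)
  rw [real_inner_self_eq_norm_sq, sq] at h1
  rcases eq_or_ne ‖V - gradient f x i‖ 0 with h0 | h0
  · rw [h0]
    exact mul_nonneg hb.phi0_nonneg (add_nonneg (norm_nonneg _) hri.le)
  · exact le_of_mul_le_mul_right h1 (lt_of_le_of_ne (norm_nonneg _) h0.symm)

end Estimate

/-! ### Expected descent in one iteration -/

/-- The expected descent achieved by one agent. Here `a` is the true block gradient, `v` the mean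
of the estimate and `m` the extrapolation. The identity
`-⟪a, v⟫ = (‖v - a‖² - ‖a‖² - ‖v‖²) / 2` produces the term `-η‖v‖²/2`, which absorbs the interaction
of the extrapolation with the mean step. -/
lemma agent_descent {E : Type*} [NormedAddCommGroup E] [InnerProductSpace ℝ E] {a v m : E}
    {η φ δ r B : ℝ} (hη : 0 < η) (hη1 : η ≤ 1) (hφ : 0 ≤ φ) (hm : ‖m‖ ^ 2 ≤ η ^ 3)
    (he : ‖v - a‖ ≤ φ * (‖m‖ + r)) (hr : (φ * r) ^ 2 ≤ B / 2)
    (hB : η * (φ * δ ^ 2 + 4 * φ ^ 2 + φ + 4) ≤ B) :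
    inner ℝ a m - η * inner ℝ a v + φ / 2 * (‖m‖ ^ 2 - 2 * η * inner ℝ m v + η ^ 2 * δ ^ 2) ≤
      -(η / 2) * ‖a‖ ^ 2 + η * B := by
  obtain ⟨e, rfl⟩ : ∃ e, v = a + e := ⟨v - a, by abel⟩
  rw [add_sub_cancel_left] at he
  set v := a + e with hv
  have hav : a = v - e := by rw [hv]; abel
  have h1 : inner ℝ a v = (‖a‖ ^ 2 + ‖v‖ ^ 2 - ‖e‖ ^ 2) / 2 := by
    have : e = v - a := by rw [hv]; abel
    rw [this, norm_sub_sq_real, real_inner_comm]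
    ring
  have h2 : inner ℝ a m = inner ℝ v m - inner ℝ e m := by
    rw [← inner_sub_left, ← hav]
  have h3 : -inner ℝ e m ≤ ‖e‖ * ‖m‖ := (neg_le_abs _).trans (abs_real_inner_le_norm _ _)
  have h4 : 2 * η * ((1 - φ * η) * inner ℝ v m) ≤
      η ^ 2 * ‖v‖ ^ 2 + (1 - φ * η) ^ 2 * ‖m‖ ^ 2 := by
    have h := sq_nonneg ‖η • v - (1 - φ * η) • m‖
    rw [norm_sub_sq_real, norm_smul, norm_smul, inner_smul_left, inner_smul_right, mul_pow, mul_pow,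
      Real.norm_eq_abs, Real.norm_eq_abs, sq_abs, sq_abs] at h
    simp only [conj_trivial] at h
    linarith
  rw [h1, h2, real_inner_comm v m]
  -- in units of the step size the extrapolation has length `t ≤ √η`
  obtain ⟨t, ht0, htm⟩ : ∃ t, 0 ≤ t ∧ ‖m‖ = η * t :=
    ⟨‖m‖ / η, by positivity, by field_simp⟩
  have ht : t ^ 2 ≤ η := by
    have : η ^ 2 * t ^ 2 ≤ η ^ 2 * η := by rw [← mul_pow, ← htm]; linarith
    exact le_of_mul_le_mul_left this (by positivity)
  have hE : ‖e‖ ≤ φ * r + φ * η * t := by rw [htm] at he; linarith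
  set b := φ * r with hb
  set y := φ * η with hy
  have hy0 : 0 ≤ y := by positivity
  have hyφ : y ≤ φ := mul_le_of_le_one_right hφ hη1
  have hEt : (‖e‖ + t) ^ 2 ≤ 2 * b ^ 2 + 2 * ((y + 1) * t) ^ 2 := by
    have h5 : ‖e‖ + t ≤ b + (y + 1) * t := by linarith
    have h6 : (‖e‖ + t) ^ 2 ≤ (b + (y + 1) * t) ^ 2 :=
      pow_le_pow_left₀ (by positivity) h5 2
    nlinarith [sq_nonneg (b - (y + 1) * t)]
  have hcoef : (3 * y ^ 2 + 3 * y + 2) * t ^ 2 ≤ η * (4 * φ ^ 2 + φ + 4) := by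
    have h7 : 3 * y ^ 2 + 3 * y + 2 ≤ 4 * φ ^ 2 + φ + 4 := by
      nlinarith [sq_nonneg (φ - 1), mul_self_le_mul_self hy0 hyφ]
    calc (3 * y ^ 2 + 3 * y + 2) * t ^ 2 ≤ (4 * φ ^ 2 + φ + 4) * t ^ 2 :=
          mul_le_mul_of_nonneg_right h7 (sq_nonneg t)
      _ ≤ (4 * φ ^ 2 + φ + 4) * η := mul_le_mul_of_nonneg_left ht (by positivity)
      _ = _ := by ring
  have hmain : ‖e‖ ^ 2 / 2 + ‖e‖ * t + (1 - y) ^ 2 * t ^ 2 / 2 + y * t ^ 2 / 2 +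
      y * δ ^ 2 / 2 ≤ B := by
    nlinarith
  have hmain' := mul_le_mul_of_nonneg_left hmain hη.le
  have h4' : (1 - y) * inner ℝ v m ≤ η / 2 * ‖v‖ ^ 2 + η * ((1 - y) ^ 2 * t ^ 2 / 2) := by
    have : 2 * η * ((1 - y) * inner ℝ v m) ≤
        2 * η * (η / 2 * ‖v‖ ^ 2 + η * ((1 - y) ^ 2 * t ^ 2 / 2)) := by
      rw [htm] at h4
      linarith
    exact le_of_mul_le_mul_left this (by positivity)
  rw [htm] at h3 ⊢
  have e1 : φ / 2 * ((η * t) ^ 2 - 2 * η * inner ℝ v m + η ^ 2 * δ ^ 2) =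
      η * (y * t ^ 2 / 2) - y * inner ℝ v m + η * (y * δ ^ 2 / 2) := by
    rw [hy]; ring
  rw [e1]
  linarith

section OneStep

variable {ι : Type*} [Fintype ι] [DecidableEq ι] {q : ι → ℕ}
  {X K : Set (BlockVec q)} {f : BlockVec q → ℝ} {lam0 phi0 rho0 : ℝ}

/-- The displacement in one iteration: the active agents move by `m_i - η g_i`. -/
noncomputable def blockStep (I : Finset ι) (η : ℝ) (m g : (i : ι) → EuclideanSpace ℝ (Fin (q i))) :
    BlockVec q :=
  WithLp.toLp 2 fun i => if i ∈ I then m i - η • g i else 0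

lemma norm_sq_blockStep (I : Finset ι) (η : ℝ) (m g : (i : ι) → EuclideanSpace ℝ (Fin (q i))) :
    ‖blockStep I η m g‖ ^ 2 = ∑ i ∈ I, ‖m i - η • g i‖ ^ 2 := by
  rw [PiLp.norm_sq_eq_of_L2, ← Finset.sum_subset (Finset.subset_univ I)]
  · exact Finset.sum_congr rfl fun i hi => by simp [blockStep, hi]
  · exact fun i _ hi => by simp [blockStep, hi]

lemma norm_blockStep_le {I : Finset ι} {η R : ℝ} {m g : (i : ι) → EuclideanSpace ℝ (Fin (q i))}
    (hR : 0 ≤ R) (h : ∀ i ∈ I, ‖m i - η • g i‖ ≤ R / √(I.card)) : ‖blockStep I η m g‖ ≤ R := by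
  refine (sq_le_sq₀ (norm_nonneg _) hR).1 ?_
  rw [norm_sq_blockStep]
  rcases I.eq_empty_or_nonempty with rfl | hI
  · simpa using sq_nonneg R
  have hc : (0 : ℝ) < I.card := by exact_mod_cast hI.card_pos
  calc ∑ i ∈ I, ‖m i - η • g i‖ ^ 2 ≤ ∑ _i ∈ I, (R / √(I.card)) ^ 2 :=
        Finset.sum_le_sum fun i hi => pow_le_pow_left₀ (norm_nonneg _) (h i hi) 2
    _ = R ^ 2 := by
        rw [Finset.sum_const, nsmul_eq_mul, div_pow, Real.sq_sqrt hc.le]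
        field_simp

/-- Descent in one iteration, up to the terms with the centred estimates `g_i - v_i`. -/
lemma UniformBounds.one_step (hb : UniformBounds X K f lam0 phi0 rho0) {x : BlockVec q}
    (hx : x ∈ K) {I : Finset ι} {m g v : (i : ι) → EuclideanSpace ℝ (Fin (q i))} {r : ι → ℝ}
    {η δ B : ℝ} (hη : 0 < η) (hη1 : η ≤ 1)
    (hm : ∀ i ∈ I, ‖m i‖ ^ 2 ≤ η ^ 3) (hg : ∀ i ∈ I, ‖g i‖ ≤ δ)
    (hstep : ‖blockStep I η m g‖ ≤ rho0)
    (hv : ∀ i ∈ I, ‖v i - gradient f x i‖ ≤ phi0 * (‖m i‖ + r i))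
    (hr : ∀ i ∈ I, (phi0 * r i) ^ 2 ≤ B / 2)
    (hB : η * (phi0 * δ ^ 2 + 4 * phi0 ^ 2 + phi0 + 4) ≤ B) :
    f (x + blockStep I η m g) ≤ f x - η / 2 * ∑ i ∈ I, ‖gradient f x i‖ ^ 2 + I.card * (η * B) +
      η * ∑ i ∈ I, (inner ℝ (gradient f x i + phi0 • m i) (v i) -
        inner ℝ (gradient f x i + phi0 • m i) (g i)) := by
  have h1 := hb.le_quadratic hx hstep
  have h2 : inner ℝ (gradient f x) (blockStep I η m g) =
      ∑ i ∈ I, inner ℝ (gradient f x i) (m i - η • g i) := by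
    rw [PiLp.inner_apply, ← Finset.sum_subset (Finset.subset_univ I)]
    · exact Finset.sum_congr rfl fun i hi => by simp [blockStep, hi]
    · exact fun i _ hi => by simp [blockStep, hi]
  rw [h2, norm_sq_blockStep] at h1
  have h3 : ∀ i ∈ I, inner ℝ (gradient f x i) (m i - η • g i) +
      phi0 / 2 * ‖m i - η • g i‖ ^ 2 ≤ -(η / 2) * ‖gradient f x i‖ ^ 2 + η * B +
      η * (inner ℝ (gradient f x i + phi0 • m i) (v i) -
        inner ℝ (gradient f x i + phi0 • m i) (g i)) := by
    intro i hi
    have h4 := agent_descent hη hη1 hb.phi0_nonneg (hm i hi) (hv i hi) (hr i hi) hB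
    have h5 : ‖g i‖ ^ 2 ≤ δ ^ 2 := pow_le_pow_left₀ (norm_nonneg _) (hg i hi) 2
    have h6 : phi0 / 2 * (η ^ 2 * ‖g i‖ ^ 2) ≤ phi0 / 2 * (η ^ 2 * δ ^ 2) :=
      mul_le_mul_of_nonneg_left (mul_le_mul_of_nonneg_left h5 (by positivity))
        (by linarith [hb.phi0_nonneg])
    rw [norm_sub_sq_real, norm_smul, inner_sub_right, inner_smul_right, inner_smul_right, mul_pow,
      Real.norm_eq_abs, sq_abs]
    simp only [inner_add_left, inner_smul_left, conj_trivial]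
    linarith
  have h7 := Finset.sum_le_sum h3
  simp only [Finset.sum_add_distrib, ← Finset.mul_sum, Finset.sum_const, nsmul_eq_mul] at h7
  linarith

end OneStep

/-! ### Independence of the past and the current sample -/

section Freezing

variable {Ω α β : Type*} [MeasurableSpace Ω] [MeasurableSpace α] [MeasurableSpace β]
  {P : Measure Ω} [IsProbabilityMeasure P] {Y : Ω → α} {S : Ω → β}

lemma ae_of_indepFun (hY : Measurable Y) (hS : Measurable S) (hind : IndepFun Y S P)
    {p : α × β → Prop} (hp : MeasurableSet {a | p a}) (h : ∀ y, ∀ᵐ s ∂(P.map S), p (y, s)) :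
    ∀ᵐ ω ∂P, p (Y ω, S ω) := by
  have h1 := (indepFun_iff_map_prod_eq_prod_map_map hY.aemeasurable hS.aemeasurable).1 hind
  have : IsProbabilityMeasure (P.map S) := Measure.isProbabilityMeasure_map hS.aemeasurable
  have h2 : ∀ᵐ a ∂(P.map fun ω => (Y ω, S ω)), p a := by
    rw [h1, Measure.ae_prod_iff_ae_ae hp]
    exact Eventually.of_forall h
  exact ae_of_ae_map (hY.prodMk hS).aemeasurable h2

/-- Integration over an independent variable with the other one frozen. -/
lemma integral_of_indepFun (hY : Measurable Y) (hS : Measurable S) (hind : IndepFun Y S P)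
    {F : α × β → ℝ} (hF : Measurable F) (hint : Integrable (fun ω => F (Y ω, S ω)) P) :
    ∫ ω, F (Y ω, S ω) ∂P = ∫ ω, ∫ s, F (Y ω, s) ∂(P.map S) ∂P := by
  have h1 := (indepFun_iff_map_prod_eq_prod_map_map hY.aemeasurable hS.aemeasurable).1 hind
  have : IsProbabilityMeasure (P.map S) := Measure.isProbabilityMeasure_map hS.aemeasurable
  have : IsProbabilityMeasure (P.map Y) := Measure.isProbabilityMeasure_map hY.aemeasurable
  have hYS := hY.prodMk hS
  have h2 : Integrable F (P.map fun ω => (Y ω, S ω)) :=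
    (integrable_map_measure hF.aestronglyMeasurable hYS.aemeasurable).2 hint
  rw [← integral_map (f := F) hYS.aemeasurable hF.aestronglyMeasurable]
  rw [h1] at h2 ⊢
  rw [integral_prod _ h2, integral_map hY.aemeasurable]
  exact (StronglyMeasurable.integral_prod_right' hF.stronglyMeasurable).aestronglyMeasurable

end Freezing

/-! ### Summation over the iterations -/

section Summation

variable {Ω : Type*} [MeasurableSpace Ω] {P : Measure Ω} [IsProbabilityMeasure P]

/-- Maximal inequality and Markov inequality for a nonnegative process `Y` with expected decrease
`η S_k / 2` and drift `θ` as long as it stays below the level `M`. The event `A k` says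
that the process has not left before time `k`. -/
lemma prob_exit_or_large_sum {A : ℕ → Set Ω} (hAm : ∀ k, MeasurableSet (A k)) (hA : Antitone A)
    (hA0 : A 0 = Set.univ) {Y S : ℕ → Ω → ℝ} {y0 M θ η ε : ℝ} {T : ℕ} (hY0 : ∀ ω, Y 0 ω = y0)
    (hYnn : ∀ k ω, 0 ≤ Y k ω) (hSnn : ∀ k ω, 0 ≤ S k ω) (hM : 0 < M) (hη : 0 < η)
    (hε : 0 < ε) (hT : 0 < T)
    (hYi : ∀ k, IntegrableOn (Y k) (A k) P) (hYi' : ∀ k < T, IntegrableOn (Y (k + 1)) (A k) P)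
    (hSi : ∀ k, IntegrableOn (S k) (A k) P)
    (hexit : ∀ k < T, ∀ᵐ ω ∂P, ω ∈ A k → ω ∉ A (k + 1) → M ≤ Y (k + 1) ω)
    (hstep : ∀ k < T, ∫ ω in A k, Y (k + 1) ω ∂P ≤
      ∫ ω in A k, Y k ω ∂P - η / 2 * ∫ ω in A k, S k ω ∂P + θ) :
    1 - (y0 + T * θ) * (1 / M + 2 / (η * T * ε)) ≤
      P.real {ω | ω ∈ A T ∧ ∑ k ∈ Finset.range T, S k ω < T * ε} := by
  have hdiff : ∀ k < T, ∫ ω in A (k + 1), Y (k + 1) ω ∂P + M * P.real (A k \ A (k + 1)) ≤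
      ∫ ω in A k, Y (k + 1) ω ∂P := by
    intro k hk
    have hsub : A (k + 1) ⊆ A k := hA (Nat.le_succ k)
    have h1 : ∫ ω in A k \ A (k + 1), Y (k + 1) ω ∂P + ∫ ω in A (k + 1), Y (k + 1) ω ∂P =
        ∫ ω in A k, Y (k + 1) ω ∂P := by
      rw [← setIntegral_union Set.disjoint_sdiff_left (hAm _)
        ((hYi' k hk).mono_set Set.sdiff_subset) (hYi (k + 1)), Set.sdiff_union_of_subset hsub]
    have h2 : M * P.real (A k \ A (k + 1)) ≤ ∫ ω in A k \ A (k + 1), Y (k + 1) ω ∂P := by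
      have h3 : ∫ _ω in A k \ A (k + 1), M ∂P = M * P.real (A k \ A (k + 1)) := by
        rw [setIntegral_const, smul_eq_mul, mul_comm]
      rw [← h3]
      refine setIntegral_mono_on_ae (integrableOn_const (measure_ne_top _ _))
        ((hYi' k hk).mono_set Set.sdiff_subset) ((hAm k).diff (hAm (k + 1))) ?_
      filter_upwards [hexit k hk] with ω hω hmem
      exact hω hmem.1 hmem.2
    linarith
  -- telescoping
  have htel : ∀ n ≤ T, ∫ ω in A n, Y n ω ∂P + M * P.real (A n)ᶜ +
      η / 2 * ∑ k ∈ Finset.range n, ∫ ω in A k, S k ω ∂P ≤ y0 + n * θ := by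
    intro n
    induction n with
    | zero =>
      intro _
      simp [hA0, hY0]
    | succ n ih =>
      intro hn
      have h1 := ih (by omega)
      have h2 := hdiff n (by omega)
      have h3 := hstep n (by omega)
      have h4 : P.real (A (n + 1))ᶜ = P.real (A n)ᶜ + P.real (A n \ A (n + 1)) := by
        have hsub : A (n + 1) ⊆ A n := hA (Nat.le_succ n)
        rw [probReal_compl_eq_one_sub (hAm _), probReal_compl_eq_one_sub (hAm _),
          measureReal_sdiff hsub (hAm _)]
        ring
      rw [h4, Finset.sum_range_succ]
      push_cast
      linarith
  have hmain := htel T le_rfl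
  have hY : 0 ≤ ∫ ω in A T, Y T ω ∂P := integral_nonneg fun ω => hYnn T ω
  have hSk : ∀ k, 0 ≤ ∫ ω in A k, S k ω ∂P := fun k => integral_nonneg fun ω => hSnn k ω
  have hT' : (0 : ℝ) < T := by exact_mod_cast hT
  set b := y0 + T * θ with hb
  have hexitP : P.real (A T)ᶜ ≤ b * (1 / M) := by
    rw [mul_one_div, le_div_iff₀ hM]
    have := Finset.sum_nonneg fun k (_ : k ∈ Finset.range T) => hSk k
    nlinarith
  have hsumint : IntegrableOn (fun ω => ∑ k ∈ Finset.range T, S k ω) (A T) P :=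
    integrable_finsetSum _ fun k hk =>
      (hSi k).mono_set (hA (Finset.mem_range.1 hk).le)
  have hsum : ∫ ω in A T, ∑ k ∈ Finset.range T, S k ω ∂P ≤ 2 / η * b := by
    rw [integral_finsetSum _ fun k hk => (hSi k).mono_set (hA (Finset.mem_range.1 hk).le)]
    have h1 : ∑ k ∈ Finset.range T, ∫ ω in A T, S k ω ∂P ≤
        ∑ k ∈ Finset.range T, ∫ ω in A k, S k ω ∂P :=
      Finset.sum_le_sum fun k hk => setIntegral_mono_set (hSi k)
        (Eventually.of_forall fun ω => hSnn k ω)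
        (LE.le.eventuallyLE (hA (Finset.mem_range.1 hk).le))
    have h2 : 0 ≤ M * P.real (A T)ᶜ := by positivity
    have h3 : η / 2 * ∑ k ∈ Finset.range T, ∫ ω in A k, S k ω ∂P ≤ b := by linarith
    refine h1.trans ?_
    rw [div_mul_eq_mul_div, le_div_iff₀ hη]
    linarith
  have hmarkov : P.real {ω | ω ∈ A T ∧ T * ε ≤ ∑ k ∈ Finset.range T, S k ω} ≤
      b * (2 / (η * T * ε)) := by
    have h1 := mul_meas_ge_le_integral_of_nonneg (μ := P.restrict (A T))
      (f := fun ω => ∑ k ∈ Finset.range T, S k ω)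
      (Eventually.of_forall fun ω => Finset.sum_nonneg fun k _ => hSnn k ω) hsumint (T * ε)
    have h2 : P.real {ω | ω ∈ A T ∧ T * ε ≤ ∑ k ∈ Finset.range T, S k ω} ≤
        (P.restrict (A T)).real {ω | T * ε ≤ ∑ k ∈ Finset.range T, S k ω} := by
      rw [measureReal_restrict_apply' (hAm T)]
      exact measureReal_mono fun ω hω => ⟨hω.2, hω.1⟩
    have h3 : b * (2 / (η * T * ε)) = (2 / η * b) / (T * ε) := by field_simp
    rw [h3, le_div_iff₀ (by positivity)]
    nlinarith [mul_le_mul_of_nonneg_left h2 (show (0 : ℝ) ≤ T * ε by positivity)]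
  have hcover : Set.univ ⊆ {ω | ω ∈ A T ∧ ∑ k ∈ Finset.range T, S k ω < T * ε} ∪ ((A T)ᶜ ∪
      {ω | ω ∈ A T ∧ T * ε ≤ ∑ k ∈ Finset.range T, S k ω}) := by
    intro ω _
    by_cases h1 : ω ∈ A T
    · rcases lt_or_ge (∑ k ∈ Finset.range T, S k ω) (T * ε) with h2 | h2
      · exact Or.inl ⟨h1, h2⟩
      · exact Or.inr (Or.inr ⟨h1, h2⟩)
    · exact Or.inr (Or.inl h1)
  have h1 : (1 : ℝ) ≤ _ := (probReal_univ (μ := P)).symm.le.trans (measureReal_mono hcover)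
  have h2 := h1.trans ((measureReal_union_le _ _).trans
    (add_le_add_right (measureReal_union_le _ _) _))
  rw [mul_add]
  linarith

end Summation

/-! ### The run of the algorithm -/

section Iterates

variable {ι Ω : Type*} [Fintype ι] [DecidableEq ι] {q p : ι → ℕ} {s : ℕ}

lemma measurable_iterates [mΩ : MeasurableSpace Ω] {hl : ι → BlockVec q → BlockVec p → ℝ}
    (hmeas : ∀ i, Measurable (fun a : BlockVec q × BlockVec p => hl i a.1 a.2))
    (cl : ι → Fin s) (x0 : BlockVec q) (η : ℝ) (r : ι → ℝ) (z : ℕ → Fin s)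
    {w : ℕ → ι → Ω → ℝ} {ξ : ℕ → Ω → BlockVec p}
    {u : ℕ → (i : ι) → Ω → EuclideanSpace ℝ (Fin (q i))} {k : ℕ}
    (hξ : ∀ l < k, Measurable (ξ l)) (hu : ∀ l < k, ∀ i, Measurable (u l i))
    (hw : ∀ l < k, ∀ i, Measurable (w l i)) :
    Measurable (iterates hl cl x0 η r z w ξ u k) := by
  induction k with
  | zero => exact measurable_const
  | succ k ih =>
    have ih' := ih (fun l hl => hξ l (by omega)) (fun l hl => hu l (by omega))
      (fun l hl => hw l (by omega))
    have hx : Measurable fun ω => (iterates hl cl x0 η r z w ξ u k ω).1 := measurable_fst.comp ih'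
    have hxp : Measurable fun ω => (iterates hl cl x0 η r z w ξ u k ω).2 := measurable_snd.comp ih'
    have happly : ∀ {x : Ω → BlockVec q}, Measurable x → ∀ i, Measurable fun ω => x ω i :=
      fun hx i => (PiLp.continuous_apply 2 _ i).measurable.comp hx
    have htoLp : ∀ {y : (i : ι) → Ω → EuclideanSpace ℝ (Fin (q i))}, (∀ i, Measurable (y i)) →
        Measurable fun ω => (WithLp.toLp 2 fun i => y i ω : BlockVec q) := fun hy =>
      (PiLp.continuous_toLp 2 _).measurable.comp (measurable_pi_lambda _ hy)
    have hext : ∀ i, Measurable fun ω => extrapolate (w k i ω)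
        (iterates hl cl x0 η r z w ξ u k ω).1 (iterates hl cl x0 η r z w ξ u k ω).2 i := fun i =>
      (happly hx i).add ((hw k (by omega) i).smul ((happly hx i).sub (happly hxp i)))
    simp only [iterates]
    refine Measurable.prodMk (htoLp fun i => ?_) (htoLp fun i => ?_)
    · by_cases hi : cl i = z k
      · simp only [hi, if_true]
        exact (hext i).sub ((measurable_gradEstimate hmeas r (hext i) hx (hu k (by omega) i)
          (hξ k (by omega))).const_smul η)
      · simp only [hi, if_false]
        exact happly hx i
    · by_cases hi : cl i = z k
      · simp only [hi, if_true]
        exact happly hx i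
      · simp only [hi, if_false]
        exact happly hxp i

end Iterates

section Past

variable {ι Ω : Type*} [Fintype ι] [mΩ : MeasurableSpace Ω] {q p : ι → ℕ} {P : Measure Ω}
  {D : Measure (BlockVec p)} {ξ : ℕ → Ω → BlockVec p}
  {u : ℕ → (i : ι) → Ω → EuclideanSpace ℝ (Fin (q i))}

lemma measurable_sample (h : IsSampling P D ξ u) (k : ℕ) : Measurable (sample ξ u k) :=
  (h.measurable_noise k).prodMk (measurable_pi_lambda _ fun i => h.measurable_direction k i)

lemma pastSigma_le (h : IsSampling P D ξ u) (k : ℕ) : pastSigma ξ u k ≤ mΩ :=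
  iSup₂_le fun l _ => (measurable_sample h l).comap_le

omit [Fintype ι] mΩ in
lemma pastSigma_mono {k l : ℕ} (hkl : k ≤ l) : pastSigma ξ u k ≤ pastSigma ξ u l :=
  iSup₂_le fun j hj => le_iSup₂_of_le j (hj.trans_le hkl) le_rfl

omit [Fintype ι] mΩ in
lemma measurable_sample_pastSigma {k l : ℕ} (hl : l < k) :
    Measurable[pastSigma ξ u k] (sample ξ u l) :=
  Measurable.mono (comap_measurable _)
    (le_iSup₂ (f := fun l (_ : l < k) => MeasurableSpace.comap (sample ξ u l) inferInstance) l hl)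
    le_rfl

lemma indepFun_past_sample [IsProbabilityMeasure P] (h : IsSampling P D ξ u) {k : ℕ} {α : Type*}
    [MeasurableSpace α] {Y : Ω → α} (hY : Measurable[pastSigma ξ u k] Y) :
    IndepFun Y (sample ξ u k) P := by
  have h1 := indep_iSup_of_disjoint (fun l => (measurable_sample h l).comap_le) h.indep
    (S := {l | l < k}) (T := {k}) (by simp)
  have h2 : Indep (pastSigma ξ u k) (MeasurableSpace.comap (sample ξ u k) inferInstance) P := by
    simpa [pastSigma] using h1
  exact indep_of_indep_of_le_left h2 hY.comap_le

end Past

/-- The hypotheses on a run of the algorithm that the analysis uses, with the numerical conditions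
in product form. `K` is the sublevel set of level `M`, `δ` bounds the gradient estimates, and
`B` is the error budget for one agent and one unit of step size. -/
structure IsRun {ι Ω : Type*} [Fintype ι] [DecidableEq ι] [MeasurableSpace Ω] {q p : ι → ℕ}
    {s : ℕ} (G : SimpleGraph ι) (D : Measure (BlockVec p)) (X K : Set (BlockVec q))
    (f : BlockVec q → ℝ) (hl : ι → BlockVec q → BlockVec p → ℝ) (fl : ι → BlockVec q → ℝ)
    (c lam0 phi0 rho0 : ℝ) (x0 : BlockVec q) (cl : ι → Fin s) (P : Measure Ω)
    (ξ : ℕ → Ω → BlockVec p) (u : ℕ → (i : ι) → Ω → EuclideanSpace ℝ (Fin (q i)))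
    (z : ℕ → Fin s) (w : ℕ → ι → Ω → ℝ) (η : ℝ) (r : ι → ℝ) (δ B M : ℝ) (T : ℕ) : Prop where
  bounds : UniformBounds X K f lam0 phi0 rho0
  mem_iff : ∀ x, x ∈ K ↔ x ∈ X ∧ f x ≤ M
  start_mem : x0 ∈ K
  cost_nonneg : ∀ x, 0 ≤ f x
  localCosts : LocalCosts G D X f hl fl c
  sampling : IsSampling P D ξ u
  dim_pos : ∀ i, 0 < q i
  c_nonneg : 0 ≤ c
  weight_nonneg : ∀ k i ω, 0 ≤ w k i ω
  weight_adapted : ∀ k i, Measurable[pastSigma ξ u k] (w k i)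
  estimate_le : ∃ F0, (∀ x ∈ K, ∀ i, fl i x ≤ F0) ∧
    ∀ i, q i / r i * (c * (F0 + lam0 * rho0)) ≤ δ
  step_pos : 0 < η
  step_le_one : η ≤ 1
  step_mul_le : ∀ i, η * δ ≤ rho0 / (2 * √(clusterSize cl i : ℝ))
  step_budget : η * (phi0 * δ ^ 2 + 4 * phi0 ^ 2 + phi0 + 4) ≤ B
  radius_pos : ∀ i, 0 < r i
  radius_le : ∀ i, r i ≤ rho0 / 2
  radius_budget : ∀ i, (phi0 * r i) ^ 2 ≤ B / 2
  extrapolation_le : ∀ k < T, ∀ i, cl i = z k → ∀ᵐ ω ∂P,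
    w k i ω * ‖(iterates hl cl x0 η r z w ξ u k ω).1 i -
      (iterates hl cl x0 η r z w ξ u k ω).2 i‖ ≤
      min (η ^ (3 / 2 : ℝ)) (rho0 / (2 * √(clusterSize cl i : ℝ)))

section Cluster

variable {ι : Type*} [Fintype ι] {s : ℕ} (cl : ι → Fin s)

/-- The agents of cluster `j`. -/
def cluster (j : Fin s) : Finset ι := Finset.univ.filter fun i => cl i = j

variable {cl}

@[simp]
lemma mem_cluster {j : Fin s} {i : ι} : i ∈ cluster cl j ↔ cl i = j := by simp [cluster]

lemma card_cluster {j : Fin s} {i : ι} (h : cl i = j) : (cluster cl j).card = clusterSize cl i := by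
  subst h; rfl

lemma clusterSize_pos (i : ι) : 0 < clusterSize cl i :=
  Finset.card_pos.2 ⟨i, by simp⟩

lemma clusterSize_le_max (i : ι) : clusterSize cl i ≤ maxClusterSize cl :=
  Finset.le_sup (f := clusterSize cl) (Finset.mem_univ i)

lemma card_cluster_le_max (j : Fin s) : (cluster cl j).card ≤ maxClusterSize cl := by
  rcases (cluster cl j).eq_empty_or_nonempty with h | ⟨i, hi⟩
  · simp [h]
  · rw [card_cluster (mem_cluster.1 hi)]
    exact clusterSize_le_max i

end Cluster

namespace IsRun

variable {ι Ω : Type*} [Fintype ι] [DecidableEq ι] [MeasurableSpace Ω] {q p : ι → ℕ}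
  {s : ℕ} {G : SimpleGraph ι} {D : Measure (BlockVec p)} {X K : Set (BlockVec q)}
  {f : BlockVec q → ℝ} {hl : ι → BlockVec q → BlockVec p → ℝ} {fl : ι → BlockVec q → ℝ}
  {c lam0 phi0 rho0 : ℝ} {x0 : BlockVec q} {cl : ι → Fin s} {P : Measure Ω}
  {ξ : ℕ → Ω → BlockVec p} {u : ℕ → (i : ι) → Ω → EuclideanSpace ℝ (Fin (q i))}
  {z : ℕ → Fin s} {w : ℕ → ι → Ω → ℝ} {η : ℝ} {r : ι → ℝ} {δ B M : ℝ} {T : ℕ}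

/-- The state `x^k`. -/
noncomputable def state (_ : IsRun G D X K f hl fl c lam0 phi0 rho0 x0 cl P ξ u z w η r δ B M T)
    (k : ℕ) (ω : Ω) : BlockVec q :=
  (iterates hl cl x0 η r z w ξ u k ω).1

/-- The extrapolation step `w_i^k (x_i^k - x_i^{k_prev})`. -/
noncomputable def extra (_ : IsRun G D X K f hl fl c lam0 phi0 rho0 x0 cl P ξ u z w η r δ B M T)
    (k : ℕ) (ω : Ω) (i : ι) : EuclideanSpace ℝ (Fin (q i)) :=
  w k i ω • ((iterates hl cl x0 η r z w ξ u k ω).1 i - (iterates hl cl x0 η r z w ξ u k ω).2 i)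

/-- The gradient estimate that agent `i` forms at step `k`. -/
noncomputable def estimate (H : IsRun G D X K f hl fl c lam0 phi0 rho0 x0 cl P ξ u z w η r δ B M T)
    (k : ℕ) (ω : Ω) (i : ι) : EuclideanSpace ℝ (Fin (q i)) :=
  gradEstimate hl r i (H.state k ω i + H.extra k ω i) (H.state k ω) (u k i ω) (ξ k ω)

/-- The conditional mean of the gradient estimate given the past. -/
noncomputable def meanEstimate
    (H : IsRun G D X K f hl fl c lam0 phi0 rho0 x0 cl P ξ u z w η r δ B M T)
    (k : ℕ) (ω : Ω) (i : ι) : EuclideanSpace ℝ (Fin (q i)) :=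
  ∫ a, gradEstimate hl r i (H.state k ω i + H.extra k ω i) (H.state k ω) (a.2 i) a.1
    ∂(sampleLaw q D)

variable (H : IsRun G D X K f hl fl c lam0 phi0 rho0 x0 cl P ξ u z w η r δ B M T)

lemma state_zero (ω : Ω) : H.state 0 ω = x0 := rfl

lemma state_succ (k : ℕ) (ω : Ω) : H.state (k + 1) ω = H.state k ω +
    blockStep (cluster cl (z k)) η (H.extra k ω) (H.estimate k ω) := by
  ext i : 1
  by_cases hi : cl i = z k
  · simp [state, iterates, blockStep, hi, extrapolate, extra, estimate, add_sub_assoc]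
  · simp [state, iterates, blockStep, hi]

include H in
lemma measurable_iterates_past (k : ℕ) :
    Measurable[pastSigma ξ u k] (iterates hl cl x0 η r z w ξ u k) := by
  refine measurable_iterates (mΩ := pastSigma ξ u k) H.localCosts.measurable cl x0 η r z
    (fun l hl => measurable_fst.comp (measurable_sample_pastSigma hl))
    (fun l hl i => ((measurable_pi_apply i).comp measurable_snd).comp
      (measurable_sample_pastSigma hl))
    (fun l hl i => (H.weight_adapted l i).mono (pastSigma_mono hl.le) le_rfl)

lemma measurable_state_past (k : ℕ) : Measurable[pastSigma ξ u k] (H.state k) :=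
  measurable_fst.comp (H.measurable_iterates_past k)

lemma measurable_extra_past (k : ℕ) (i : ι) :
    Measurable[pastSigma ξ u k] fun ω => H.extra k ω i := by
  have h1 := H.measurable_iterates_past k
  have happly := (PiLp.continuous_apply 2 (fun i => EuclideanSpace ℝ (Fin (q i))) i).measurable
  exact (H.weight_adapted k i).smul
    ((happly.comp (measurable_fst.comp h1)).sub (happly.comp (measurable_snd.comp h1)))

lemma measurable_state (k : ℕ) : Measurable (H.state k) :=
  (H.measurable_state_past k).mono (pastSigma_le H.sampling k) le_rfl

lemma measurable_extra (k : ℕ) (i : ι) : Measurable fun ω => H.extra k ω i :=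
  (H.measurable_extra_past k i).mono (pastSigma_le H.sampling k) le_rfl

lemma measurable_estimate (k : ℕ) (i : ι) : Measurable fun ω => H.estimate k ω i := by
  have h1 : Measurable fun ω => H.state k ω i :=
    (PiLp.continuous_apply 2 _ i).measurable.comp (H.measurable_state k)
  exact measurable_gradEstimate H.localCosts.measurable r (h1.add (H.measurable_extra k i))
    (H.measurable_state k) (H.sampling.measurable_direction k i) (H.sampling.measurable_noise k)

lemma norm_extra (k : ℕ) (ω : Ω) (i : ι) : ‖H.extra k ω i‖ =
    w k i ω * ‖(iterates hl cl x0 η r z w ξ u k ω).1 i -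
      (iterates hl cl x0 η r z w ξ u k ω).2 i‖ := by
  rw [extra, norm_smul, Real.norm_of_nonneg (H.weight_nonneg k i ω)]

include H in
lemma rho0_div_le (i : ι) : rho0 / (2 * √(clusterSize cl i : ℝ)) ≤ rho0 / 2 := by
  have h1 : (1 : ℝ) ≤ √(clusterSize cl i : ℝ) :=
    Real.one_le_sqrt.2 (by exact_mod_cast clusterSize_pos i)
  have := H.bounds.rho0_pos
  gcongr
  linarith

/-- The estimates are bounded by `δ` as long as the state is in `K`. -/
lemma ae_norm_estimate_le [IsProbabilityMeasure D] [IsProbabilityMeasure P] (k : ℕ) (i : ι) :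
    ∀ᵐ ω ∂P, H.state k ω ∈ K → ‖H.extra k ω i‖ ≤ rho0 / 2 → ‖H.estimate k ω i‖ ≤ δ := by
  obtain ⟨F0, hF0, hδ⟩ := H.estimate_le
  have hY : Measurable[pastSigma ξ u k] fun ω => (H.state k ω, H.extra k ω i) :=
    (H.measurable_state_past k).prodMk (H.measurable_extra_past k i)
  have hG : Measurable fun a : (BlockVec q × EuclideanSpace ℝ (Fin (q i))) × Sample q p =>
      gradEstimate hl r i (a.1.1 i + a.1.2) a.1.1 (a.2.2 i) a.2.1 := by
    refine measurable_gradEstimate H.localCosts.measurable r (Measurable.add ?_ ?_) ?_ ?_ ?_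
    · exact (PiLp.continuous_apply 2 (fun i => EuclideanSpace ℝ (Fin (q i))) i).measurable.comp
        (measurable_fst.comp measurable_fst)
    · exact measurable_snd.comp measurable_fst
    · exact measurable_fst.comp measurable_fst
    · exact ((measurable_pi_apply i).comp measurable_snd).comp measurable_snd
    · exact measurable_fst.comp measurable_snd
  have hset : MeasurableSet {a : (BlockVec q × EuclideanSpace ℝ (Fin (q i))) × Sample q p |
      a.1.1 ∈ K → ‖a.1.2‖ ≤ rho0 / 2 →
        ‖gradEstimate hl r i (a.1.1 i + a.1.2) a.1.1 (a.2.2 i) a.2.1‖ ≤ δ} := by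
    have h1 : MeasurableSet {a : (BlockVec q × EuclideanSpace ℝ (Fin (q i))) × Sample q p |
        a.1.1 ∈ K} := (measurable_fst.comp measurable_fst) H.bounds.isCompact.measurableSet
    have h2 : MeasurableSet {a : (BlockVec q × EuclideanSpace ℝ (Fin (q i))) × Sample q p |
        ‖a.1.2‖ ≤ rho0 / 2} :=
      measurableSet_le (measurable_snd.comp measurable_fst).norm measurable_const
    exact h1.imp (h2.imp (measurableSet_le hG.norm measurable_const))
  refine ae_of_indepFun (hY.mono (pastSigma_le H.sampling k) le_rfl)
    (measurable_sample H.sampling k) (indepFun_past_sample H.sampling hY) hset ?_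
  intro y
  rw [H.sampling.law]
  by_cases hy : y.1 ∈ K ∧ ‖y.2‖ ≤ rho0 / 2
  · have h1 : ‖y.1 i + y.2 - y.1 i‖ + r i ≤ rho0 := by
      rw [add_sub_cancel_left]
      linarith [H.radius_le i]
    filter_upwards [H.localCosts.ae_norm_gradEstimate_le H.bounds H.dim_pos H.c_nonneg
      H.radius_pos hF0 hy.1 h1] with a ha _ _
    exact ha.trans (hδ i)
  · exact Eventually.of_forall fun a h1 h2 => absurd ⟨h1, h2⟩ hy

lemma norm_meanEstimate_sub_le [IsProbabilityMeasure D] {k : ℕ} {ω : Ω} {i : ι}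
    (hx : H.state k ω ∈ K) (hm : ‖H.extra k ω i‖ ≤ rho0 / 2) :
    ‖H.meanEstimate k ω i - gradient f (H.state k ω) i‖ ≤ phi0 * (‖H.extra k ω i‖ + r i) := by
  obtain ⟨F0, hF0, -⟩ := H.estimate_le
  have := isProbabilityMeasure_sampleLaw (D := D) H.dim_pos
  have h1 : ‖H.state k ω i + H.extra k ω i - H.state k ω i‖ + r i ≤ rho0 := by
    rw [add_sub_cancel_left]
    linarith [H.radius_le i]
  have hint : Integrable (fun a : Sample q p => gradEstimate hl r i
      (H.state k ω i + H.extra k ω i) (H.state k ω) (a.2 i) a.1) (sampleLaw q D) :=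
    Integrable.of_bound (measurable_gradEstimate H.localCosts.measurable r measurable_const
      measurable_const ((measurable_pi_apply i).comp measurable_snd)
      measurable_fst).aestronglyMeasurable _
      (H.localCosts.ae_norm_gradEstimate_le H.bounds H.dim_pos H.c_nonneg H.radius_pos hF0 hx h1)
  have h2 := H.localCosts.norm_integral_gradEstimate_sub_le H.bounds H.dim_pos H.radius_pos hx h1
    hint
  rwa [add_sub_cancel_left] at h2

lemma measurable_meanEstimate [IsProbabilityMeasure D] (k : ℕ) (i : ι) :
    Measurable fun ω => H.meanEstimate k ω i := by
  have := isProbabilityMeasure_sampleLaw (D := D) H.dim_pos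
  have hG : Measurable fun a : Ω × Sample q p =>
      gradEstimate hl r i (H.state k a.1 i + H.extra k a.1 i) (H.state k a.1) (a.2.2 i) a.2.1 := by
    refine measurable_gradEstimate H.localCosts.measurable r (Measurable.add ?_ ?_) ?_ ?_ ?_
    · exact (PiLp.continuous_apply 2 (fun i => EuclideanSpace ℝ (Fin (q i))) i).measurable.comp
        ((H.measurable_state k).comp measurable_fst)
    · exact (H.measurable_extra k i).comp measurable_fst
    · exact (H.measurable_state k).comp measurable_fst
    · exact ((measurable_pi_apply i).comp measurable_snd).comp measurable_snd
    · exact measurable_fst.comp measurable_snd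
  exact (StronglyMeasurable.integral_prod_right' hG.stronglyMeasurable).measurable

/-- The centred estimate is orthogonal in expectation to vectors `Z` that depend on the past. -/
lemma integral_inner_estimate [IsProbabilityMeasure D] [IsProbabilityMeasure P] {k : ℕ} {i : ι}
    {Z : Ω → EuclideanSpace ℝ (Fin (q i))} (hZ : Measurable[pastSigma ξ u k] Z) {C : ℝ}
    (hC : ∀ᵐ ω ∂P, ‖Z ω‖ ≤ C)
    (hZ0 : ∀ᵐ ω ∂P, Z ω ≠ 0 → H.state k ω ∈ K ∧ ‖H.extra k ω i‖ ≤ rho0 / 2) :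
    Integrable (fun ω => inner ℝ (Z ω) (H.estimate k ω i)) P ∧
    ∫ ω, inner ℝ (Z ω) (H.estimate k ω i) ∂P = ∫ ω, inner ℝ (Z ω) (H.meanEstimate k ω i) ∂P := by
  obtain ⟨F0, hF0, hδ⟩ := H.estimate_le
  have hprob := isProbabilityMeasure_sampleLaw (D := D) H.dim_pos
  have hZm : Measurable Z := hZ.mono (pastSigma_le H.sampling k) le_rfl
  have hint : Integrable (fun ω => inner ℝ (Z ω) (H.estimate k ω i)) P := by
    refine Integrable.of_bound (C := C * δ)
      (hZm.inner (H.measurable_estimate k i)).aestronglyMeasurable ?_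
    filter_upwards [hC, hZ0, H.ae_norm_estimate_le k i] with ω h1 h2 h3
    by_cases h0 : Z ω = 0
    · have hδ0 : 0 ≤ δ := by
        refine le_trans ?_ (hδ i)
        have := H.localCosts.fl_nonneg i x0
        have := hF0 x0 H.start_mem i
        have := mul_nonneg H.bounds.lam0_nonneg H.bounds.rho0_pos.le
        have := H.radius_pos i
        have := H.c_nonneg
        have : 0 ≤ F0 + lam0 * rho0 := by linarith
        positivity
      have : 0 ≤ C := (norm_nonneg _).trans h1
      simpa [h0] using mul_nonneg this hδ0
    · exact (norm_inner_le_norm _ _).trans (mul_le_mul h1 (h3 (h2 h0).1 (h2 h0).2) (norm_nonneg _)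
        ((norm_nonneg _).trans h1))
  refine ⟨hint, ?_⟩
  have hY : Measurable[pastSigma ξ u k] fun ω => (H.state k ω, H.extra k ω i, Z ω) :=
    (H.measurable_state_past k).prodMk ((H.measurable_extra_past k i).prodMk hZ)
  have hF : Measurable fun a : (BlockVec q × EuclideanSpace ℝ (Fin (q i)) ×
      EuclideanSpace ℝ (Fin (q i))) × Sample q p =>
      (inner ℝ a.1.2.2 (gradEstimate hl r i (a.1.1 i + a.1.2.1) a.1.1 (a.2.2 i) a.2.1) : ℝ) := by
    have hx : Measurable fun a : (BlockVec q × EuclideanSpace ℝ (Fin (q i)) ×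
      EuclideanSpace ℝ (Fin (q i))) × Sample q p => a.1.1 := measurable_fst.comp measurable_fst
    have hm : Measurable fun a : (BlockVec q × EuclideanSpace ℝ (Fin (q i)) ×
      EuclideanSpace ℝ (Fin (q i))) × Sample q p => a.1.2 := measurable_snd.comp measurable_fst
    refine (measurable_snd.comp hm).inner
      (measurable_gradEstimate H.localCosts.measurable r (Measurable.add ?_ ?_) hx ?_ ?_)
    · exact (PiLp.continuous_apply 2 (fun i => EuclideanSpace ℝ (Fin (q i))) i).measurable.comp hx
    · exact measurable_fst.comp hm
    · exact ((measurable_pi_apply i).comp measurable_snd).comp measurable_snd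
    · exact measurable_fst.comp measurable_snd
  have h1 := integral_of_indepFun (hY.mono (pastSigma_le H.sampling k) le_rfl)
    (measurable_sample H.sampling k) (indepFun_past_sample H.sampling hY) hF hint
  refine h1.trans (integral_congr_ae ?_)
  filter_upwards [hZ0] with ω hω
  simp only [H.sampling.law]
  by_cases h0 : Z ω = 0
  · simp [h0]
  · obtain ⟨hx, hm⟩ := hω h0
    have h2 : ‖H.state k ω i + H.extra k ω i - H.state k ω i‖ + r i ≤ rho0 := by
      rw [add_sub_cancel_left]
      linarith [H.radius_le i]
    refine integral_inner (Integrable.of_bound (measurable_gradEstimate H.localCosts.measurable r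
      measurable_const measurable_const ((measurable_pi_apply i).comp measurable_snd)
      measurable_fst).aestronglyMeasurable _
      (H.localCosts.ae_norm_gradEstimate_le H.bounds H.dim_pos H.c_nonneg H.radius_pos hF0 hx h2)) _

end IsRun

/-! ### The run up to its exit from the sublevel set -/

namespace IsRun

variable {ι Ω : Type*} [Fintype ι] [DecidableEq ι] [MeasurableSpace Ω] {q p : ι → ℕ}
  {s : ℕ} {G : SimpleGraph ι} {D : Measure (BlockVec p)} {X K : Set (BlockVec q)}
  {f : BlockVec q → ℝ} {hl : ι → BlockVec q → BlockVec p → ℝ} {fl : ι → BlockVec q → ℝ}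
  {c lam0 phi0 rho0 : ℝ} {x0 : BlockVec q} {cl : ι → Fin s} {P : Measure Ω}
  {ξ : ℕ → Ω → BlockVec p} {u : ℕ → (i : ι) → Ω → EuclideanSpace ℝ (Fin (q i))}
  {z : ℕ → Fin s} {w : ℕ → ι → Ω → ℝ} {η : ℝ} {r : ι → ℝ} {δ B M : ℝ} {T : ℕ}

variable (H : IsRun G D X K f hl fl c lam0 phi0 rho0 x0 cl P ξ u z w η r δ B M T)

/-- The event that the state stays in `K` up to time `k`. -/
def stay (k : ℕ) : Set Ω := {ω | ∀ l ≤ k, H.state l ω ∈ K}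

/-- The squared norm of the gradient in the blocks updated at step `k`. -/
noncomputable def activeGrad (k : ℕ) (ω : Ω) : ℝ :=
  ∑ i ∈ cluster cl (z k), ‖gradient f (H.state k ω) i‖ ^ 2

lemma activeGrad_nonneg (k : ℕ) (ω : Ω) : 0 ≤ H.activeGrad k ω :=
  Finset.sum_nonneg fun _ _ => sq_nonneg _

lemma measurableSet_stay_past (k : ℕ) : MeasurableSet[pastSigma ξ u k] (H.stay k) := by
  have : H.stay k = ⋂ l ≤ k, H.state l ⁻¹' K := by ext; simp [stay]
  rw [this]
  refine MeasurableSet.iInter fun l => MeasurableSet.iInter fun hl => ?_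
  exact ((H.measurable_state_past l).mono (pastSigma_mono hl) le_rfl)
    H.bounds.isCompact.measurableSet

lemma measurableSet_stay (k : ℕ) : MeasurableSet (H.stay k) :=
  pastSigma_le H.sampling k _ (H.measurableSet_stay_past k)

lemma antitone_stay : Antitone H.stay := fun _ _ hkl _ hω l hl => hω l (hl.trans hkl)

lemma state_mem {k : ℕ} {ω : Ω} (hω : ω ∈ H.stay k) : H.state k ω ∈ K := hω k le_rfl

/-- The almost sure bounds on the extrapolations and on the estimates at one step. -/
lemma ae_regular [IsProbabilityMeasure D] [IsProbabilityMeasure P] {k : ℕ} (hk : k < T) :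
    ∀ᵐ ω ∂P, ∀ i, cl i = z k → ‖H.extra k ω i‖ ^ 2 ≤ η ^ 3 ∧
      ‖H.extra k ω i‖ ≤ rho0 / (2 * √(clusterSize cl i : ℝ)) ∧
      (H.state k ω ∈ K → ‖H.estimate k ω i‖ ≤ δ) := by
  rw [ae_all_iff]
  intro i
  by_cases hi : cl i = z k
  · filter_upwards [H.extrapolation_le k hk i hi, H.ae_norm_estimate_le k i] with ω h1 h2 _
    rw [← H.norm_extra] at h1
    have h3 := h1.trans (min_le_right _ _)
    refine ⟨?_, h3, fun hx => h2 hx (h3.trans (H.rho0_div_le i))⟩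
    have h4 := pow_le_pow_left₀ (norm_nonneg _) (h1.trans (min_le_left _ _)) 2
    have h5 : (η ^ (3 / 2 : ℝ)) ^ 2 = η ^ 3 := by
      rw [← Real.rpow_natCast, ← Real.rpow_mul H.step_pos.le, ← Real.rpow_natCast]
      norm_num
    rwa [h5] at h4
  · exact Eventually.of_forall fun ω h => absurd h hi

lemma norm_displacement_le {k : ℕ} {ω : Ω}
    (hm : ∀ i, cl i = z k → ‖H.extra k ω i‖ ≤ rho0 / (2 * √(clusterSize cl i : ℝ)))
    (hg : ∀ i, cl i = z k → ‖H.estimate k ω i‖ ≤ δ) :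
    ‖blockStep (cluster cl (z k)) η (H.extra k ω) (H.estimate k ω)‖ ≤ rho0 := by
  refine norm_blockStep_le H.bounds.rho0_pos.le fun i hi => ?_
  have hi' := mem_cluster.1 hi
  rw [card_cluster hi']
  have h1 := hm i hi'
  have h2 : ‖η • H.estimate k ω i‖ ≤ rho0 / (2 * √(clusterSize cl i : ℝ)) := by
    rw [norm_smul, Real.norm_of_nonneg H.step_pos.le]
    exact (mul_le_mul_of_nonneg_left (hg i hi') H.step_pos.le).trans (H.step_mul_le i)
  have h3 : rho0 / √(clusterSize cl i : ℝ) = rho0 / (2 * √(clusterSize cl i : ℝ)) +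
      rho0 / (2 * √(clusterSize cl i : ℝ)) := by
    have : (0 : ℝ) < √(clusterSize cl i : ℝ) :=
      Real.sqrt_pos.2 (by exact_mod_cast clusterSize_pos i)
    field_simp
    norm_num
  rw [h3]
  exact (norm_sub_le _ _).trans (add_le_add h1 h2)

lemma ae_next_mem [IsProbabilityMeasure D] [IsProbabilityMeasure P] {k : ℕ} (hk : k < T) :
    ∀ᵐ ω ∂P, H.state k ω ∈ K → ‖H.state (k + 1) ω - H.state k ω‖ ≤ rho0 := by
  filter_upwards [H.ae_regular hk] with ω hω hx
  rw [H.state_succ, add_sub_cancel_left]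
  exact H.norm_displacement_le (fun i hi => (hω i hi).2.1) (fun i hi => (hω i hi).2.2 hx)

include H in
lemma budget_nonneg : 0 ≤ B := by
  have := H.bounds.phi0_nonneg
  have := H.step_pos
  exact le_trans (by positivity) H.step_budget

include H in
lemma measurable_indicator_gradient : Measurable (K.indicator (gradient f)) := by
  classical
  rw [← Set.piecewise_eq_indicator]
  exact (H.bounds.continuousOn_gradient.mono H.bounds.subset).measurable_piecewise
    continuousOn_const H.bounds.isCompact.measurableSet

include H in
lemma measurable_indicator_cost : Measurable (X.indicator f) := by
  classical
  rw [← Set.piecewise_eq_indicator]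
  exact H.bounds.continuousOn.measurable_piecewise continuousOn_const H.bounds.isOpen.measurableSet

lemma cost_le_level {k : ℕ} {ω : Ω} (hω : ω ∈ H.stay k) : f (H.state k ω) ≤ M :=
  ((H.mem_iff _).1 (H.state_mem hω)).2

lemma integrableOn_cost [IsProbabilityMeasure P] (k : ℕ) :
    IntegrableOn (fun ω => f (H.state k ω)) (H.stay k) P := by
  refine Integrable.of_bound (C := M) ?_ ?_
  · refine AEStronglyMeasurable.congr
      (H.measurable_indicator_cost.comp (H.measurable_state k)).aestronglyMeasurable ?_
    filter_upwards [ae_restrict_mem (H.measurableSet_stay k)] with ω hω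
    exact Set.indicator_of_mem (H.bounds.subset (H.state_mem hω)) f
  · filter_upwards [ae_restrict_mem (H.measurableSet_stay k)] with ω hω
    rw [Real.norm_of_nonneg (H.cost_nonneg _)]
    exact H.cost_le_level hω

lemma integrableOn_cost_succ [IsProbabilityMeasure D] [IsProbabilityMeasure P] {k : ℕ}
    (hk : k < T) : IntegrableOn (fun ω => f (H.state (k + 1) ω)) (H.stay k) P := by
  refine Integrable.of_bound (C := M + lam0 * rho0) ?_ ?_
  · refine AEStronglyMeasurable.congr
      (H.measurable_indicator_cost.comp (H.measurable_state (k + 1))).aestronglyMeasurable ?_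
    filter_upwards [ae_restrict_mem (H.measurableSet_stay k),
      ae_restrict_of_ae (H.ae_next_mem hk)] with ω hω h1
    exact Set.indicator_of_mem (H.bounds.mem _ (H.state_mem hω) _ (h1 (H.state_mem hω))) f
  · filter_upwards [ae_restrict_mem (H.measurableSet_stay k),
      ae_restrict_of_ae (H.ae_next_mem hk)] with ω hω h1
    have h2 := h1 (H.state_mem hω)
    have h3 := H.bounds.lipschitz _ (H.state_mem hω) _ h2
    have h4 := mul_le_mul_of_nonneg_left h2 H.bounds.lam0_nonneg
    rw [Real.norm_of_nonneg (H.cost_nonneg _)]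
    linarith [H.cost_le_level hω, le_abs_self (f (H.state (k + 1) ω) - f (H.state k ω))]

lemma integrableOn_activeGrad [IsProbabilityMeasure P] (k : ℕ) :
    IntegrableOn (H.activeGrad k) (H.stay k) P := by
  refine integrable_finsetSum _ fun i _ => ?_
  refine Integrable.of_bound (C := lam0 ^ 2) ?_ ?_
  · have h1 : Measurable fun ω => K.indicator (gradient f) (H.state k ω) i :=
      (PiLp.continuous_apply 2 (fun i => EuclideanSpace ℝ (Fin (q i))) i).measurable.comp
        (H.measurable_indicator_gradient.comp (H.measurable_state k))
    refine AEStronglyMeasurable.congr (h1.norm.pow_const 2).aestronglyMeasurable ?_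
    filter_upwards [ae_restrict_mem (H.measurableSet_stay k)] with ω hω
    rw [Set.indicator_of_mem (H.state_mem hω)]
  · filter_upwards [ae_restrict_mem (H.measurableSet_stay k)] with ω hω
    rw [Real.norm_of_nonneg (sq_nonneg _)]
    exact pow_le_pow_left₀ (norm_nonneg _)
      ((norm_apply_le _ i).trans (H.bounds.norm_gradient_le _ (H.state_mem hω))) 2

/-- The expected descent of the cost in one step, on the event that the state has stayed in `K`. -/
lemma expected_descent [IsProbabilityMeasure D] [IsProbabilityMeasure P] {k : ℕ} (hk : k < T) :
    ∫ ω in H.stay k, f (H.state (k + 1) ω) ∂P ≤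
      ∫ ω in H.stay k, f (H.state k ω) ∂P - η / 2 * ∫ ω in H.stay k, H.activeGrad k ω ∂P +
        maxClusterSize cl * (η * B) := by
  classical
  set A := H.stay k with hA
  have hAm := H.measurableSet_stay k
  set I := cluster cl (z k) with hI
  -- the weights of the centred estimates
  set Z : (i : ι) → Ω → EuclideanSpace ℝ (Fin (q i)) := fun i =>
    A.indicator fun ω => gradient f (H.state k ω) i + phi0 • H.extra k ω i with hZ
  have hreg := H.ae_regular hk
  have hφ := H.bounds.phi0_nonneg
  have hρ := H.bounds.rho0_pos
  have hZm : ∀ i, Measurable[pastSigma ξ u k] (Z i) := by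
    intro i
    have h1 : Z i = A.indicator fun ω =>
        K.indicator (gradient f) (H.state k ω) i + phi0 • H.extra k ω i := by
      refine funext fun ω => ?_
      by_cases hω : ω ∈ A
      · simp only [hZ, Set.indicator_of_mem hω, Set.indicator_of_mem (H.state_mem hω)]
      · simp only [hZ, Set.indicator_of_notMem hω]
    rw [h1]
    refine Measurable.indicator (Measurable.add ?_ ((H.measurable_extra_past k i).const_smul phi0))
      (H.measurableSet_stay_past k)
    exact (PiLp.continuous_apply 2 (fun i => EuclideanSpace ℝ (Fin (q i))) i).measurable.comp
      (H.measurable_indicator_gradient.comp (H.measurable_state_past k))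
  have hgradb : ∀ ω ∈ A, ∀ i, ‖gradient f (H.state k ω) i‖ ≤ lam0 := fun ω hω i =>
    (norm_apply_le _ i).trans (H.bounds.norm_gradient_le _ (H.state_mem hω))
  have hZb : ∀ i ∈ I, ∀ᵐ ω ∂P, ‖Z i ω‖ ≤ lam0 + phi0 * (rho0 / 2) := by
    intro i hi
    filter_upwards [hreg] with ω hω
    by_cases hωA : ω ∈ A
    · simp only [hZ, Set.indicator_of_mem hωA]
      refine (norm_add_le _ _).trans (add_le_add (hgradb ω hωA i) ?_)
      rw [norm_smul, Real.norm_of_nonneg hφ]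
      exact mul_le_mul_of_nonneg_left
        ((hω i (mem_cluster.1 hi)).2.1.trans (H.rho0_div_le i)) hφ
    · simp only [hZ, Set.indicator_of_notMem hωA, norm_zero]
      have := H.bounds.lam0_nonneg
      positivity
  have hZ0 : ∀ i ∈ I, ∀ᵐ ω ∂P, Z i ω ≠ 0 →
      H.state k ω ∈ K ∧ ‖H.extra k ω i‖ ≤ rho0 / 2 := by
    intro i hi
    filter_upwards [hreg] with ω hω hne
    have hωA : ω ∈ A := by
      by_contra hωA
      exact hne (by simp only [hZ, Set.indicator_of_notMem hωA])
    exact ⟨H.state_mem hωA, (hω i (mem_cluster.1 hi)).2.1.trans (H.rho0_div_le i)⟩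
  have hest : ∀ i ∈ I, Integrable (fun ω => inner ℝ (Z i ω) (H.estimate k ω i)) P ∧
      ∫ ω, inner ℝ (Z i ω) (H.estimate k ω i) ∂P =
        ∫ ω, inner ℝ (Z i ω) (H.meanEstimate k ω i) ∂P := fun i hi =>
    H.integral_inner_estimate (hZm i) (hZb i hi) (hZ0 i hi)
  have hmean : ∀ i ∈ I, Integrable (fun ω => inner ℝ (Z i ω) (H.meanEstimate k ω i)) P := by
    intro i hi
    refine Integrable.of_bound
      (C := (lam0 + phi0 * (rho0 / 2)) * (lam0 + phi0 * (rho0 / 2 + rho0 / 2)))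
      (((hZm i).mono (pastSigma_le H.sampling k) le_rfl).inner
        (H.measurable_meanEstimate k i)).aestronglyMeasurable ?_
    filter_upwards [hZb i hi, hZ0 i hi] with ω h1 h2
    have hlam := H.bounds.lam0_nonneg
    by_cases h0 : Z i ω = 0
    · rw [h0, inner_zero_left, norm_zero]
      positivity
    · obtain ⟨hx, hm⟩ := h2 h0
      have hωA : ω ∈ A := by
        by_contra hωA
        exact h0 (by simp only [hZ, Set.indicator_of_notMem hωA])
      have h3 := H.norm_meanEstimate_sub_le hx hm
      have h4 : ‖H.meanEstimate k ω i‖ ≤ lam0 + phi0 * (rho0 / 2 + rho0 / 2) := by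
        have h5 := norm_le_norm_add_norm_sub' (H.meanEstimate k ω i) (gradient f (H.state k ω) i)
        have h6 : phi0 * (‖H.extra k ω i‖ + r i) ≤ phi0 * (rho0 / 2 + rho0 / 2) :=
          mul_le_mul_of_nonneg_left (add_le_add hm (H.radius_le i)) hφ
        linarith [hgradb ω hωA i]
      exact (norm_inner_le_norm _ _).trans (mul_le_mul h1 h4 (norm_nonneg _) (by positivity))
  set θ : ℝ := maxClusterSize cl * (η * B) with hθ
  have hηB : 0 ≤ η * B := mul_nonneg H.step_pos.le H.budget_nonneg
  have hpoint : ∀ᵐ ω ∂P, A.indicator (fun ω => f (H.state (k + 1) ω)) ω ≤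
      A.indicator (fun ω => f (H.state k ω) - η / 2 * H.activeGrad k ω + θ) ω +
      η * ∑ i ∈ I, (inner ℝ (Z i ω) (H.meanEstimate k ω i) -
        inner ℝ (Z i ω) (H.estimate k ω i)) := by
    filter_upwards [hreg] with ω hω
    by_cases hωA : ω ∈ A
    · have hx := H.state_mem hωA
      simp only [hZ, Set.indicator_of_mem hωA]
      rw [H.state_succ]
      have h1 := H.bounds.one_step hx (I := I) (m := H.extra k ω) (g := H.estimate k ω)
        (v := H.meanEstimate k ω) (r := r) (δ := δ) (B := B) H.step_pos H.step_le_one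
        (fun i hi => (hω i (mem_cluster.1 hi)).1)
        (fun i hi => (hω i (mem_cluster.1 hi)).2.2 hx)
        (H.norm_displacement_le (fun i hi => (hω i hi).2.1) (fun i hi => (hω i hi).2.2 hx))
        (fun i hi => H.norm_meanEstimate_sub_le hx
          ((hω i (mem_cluster.1 hi)).2.1.trans (H.rho0_div_le i)))
        (fun i _ => H.radius_budget i) H.step_budget
      have h2 : (I.card : ℝ) * (η * B) ≤ θ :=
        mul_le_mul_of_nonneg_right (by exact_mod_cast card_cluster_le_max (z k)) hηB
      simp only [activeGrad]
      linarith
    · simp only [hZ, Set.indicator_of_notMem hωA, inner_zero_left, sub_self,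
        Finset.sum_const_zero, mul_zero, add_zero, le_refl]
  have hi1 := H.integrableOn_cost k
  have hi2 := H.integrableOn_cost_succ hk
  have hi3 := H.integrableOn_activeGrad k
  have hi6 : IntegrableOn (fun ω => f (H.state k ω) - η / 2 * H.activeGrad k ω) A P :=
    hi1.sub (hi3.const_mul _)
  have hi4 : IntegrableOn (fun ω => f (H.state k ω) - η / 2 * H.activeGrad k ω + θ) A P :=
    hi6.add (integrableOn_const (measure_ne_top _ _))
  have hi5 : ∀ i ∈ I, Integrable (fun ω => inner ℝ (Z i ω) (H.meanEstimate k ω i) -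
      inner ℝ (Z i ω) (H.estimate k ω i)) P := fun i hi => (hmean i hi).sub (hest i hi).1
  have hmono := integral_mono_ae (hi2.integrable_indicator hAm)
    ((hi4.integrable_indicator hAm).add ((integrable_finsetSum I hi5).const_mul η)) hpoint
  simp only [Pi.add_apply] at hmono
  rw [integral_indicator hAm, integral_add (hi4.integrable_indicator hAm)
    ((integrable_finsetSum I hi5).const_mul η), integral_indicator hAm, integral_const_mul,
    integral_finsetSum I hi5,
    Finset.sum_eq_zero (fun i hi => by
      rw [integral_sub (hmean i hi) (hest i hi).1, (hest i hi).2, sub_self]),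
    mul_zero, add_zero, integral_add hi6 (integrableOn_const (measure_ne_top _ _)),
    integral_sub hi1 (hi3.const_mul _), integral_const_mul, setIntegral_const, smul_eq_mul] at hmono
  have hP : P.real A * θ ≤ θ :=
    mul_le_of_le_one_left (by positivity) measureReal_le_one
  linarith

/-- The probability that the run stays in `K` and that the gradients in the updated blocks are
small on average. -/
lemma prob_stay_and_small [IsProbabilityMeasure D] [IsProbabilityMeasure P] {ε : ℝ} (hε : 0 < ε)
    (hM : 0 < M) (hT : 0 < T) :
    1 - (f x0 + T * (maxClusterSize cl * (η * B))) * (1 / M + 2 / (η * T * ε)) ≤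
      P.real {ω | ω ∈ H.stay T ∧ ∑ k ∈ Finset.range T, H.activeGrad k ω < T * ε} := by
  refine prob_exit_or_large_sum (Y := fun k ω => f (H.state k ω)) (S := H.activeGrad)
    H.measurableSet_stay H.antitone_stay ?_ (fun ω => by rw [H.state_zero])
    (fun k ω => H.cost_nonneg _) H.activeGrad_nonneg hM H.step_pos hε hT H.integrableOn_cost
    (fun k hk => H.integrableOn_cost_succ hk) H.integrableOn_activeGrad ?_
    (fun k hk => H.expected_descent hk)
  · refine Set.eq_univ_of_forall fun ω l hl => ?_
    obtain rfl : l = 0 := by omega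
    exact H.start_mem
  · intro k hk
    filter_upwards [H.ae_next_mem hk] with ω hω hA hA'
    by_contra hlt
    push Not at hlt
    refine hA' fun l hl => ?_
    rcases Nat.lt_or_ge k l with h1 | h1
    · obtain rfl : l = k + 1 := by omega
      exact (H.mem_iff _).2
        ⟨H.bounds.mem _ (H.state_mem hA) _ (hω (H.state_mem hA)), hlt.le⟩
    · exact hA l h1

end IsRun

/-! ### From the updated blocks to the full gradient -/

/-- Each index `l` is hit by at most `2n + 1` indices at distance at most `n`. -/
lemma sum_comp_le_of_near {T n : ℕ} {φ : ℕ → ℕ} {p : ℕ → Prop} [DecidablePred p] {a : ℕ → ℝ}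
    (ha : ∀ l, 0 ≤ a l) (hφ : ∀ k < T, φ k < T ∧ p (φ k) ∧ k ≤ φ k + n ∧ φ k ≤ k + n) :
    ∑ k ∈ Finset.range T, a (φ k) ≤
      (2 * n + 1) * ∑ l ∈ (Finset.range T).filter p, a l := by
  rw [← Finset.sum_fiberwise_of_maps_to (s := Finset.range T) (t := (Finset.range T).filter p)
    (g := φ) (fun k hk => by
      have := hφ k (Finset.mem_range.1 hk)
      simp [this.1, this.2.1]), Finset.mul_sum]
  refine Finset.sum_le_sum fun l _ => ?_
  rw [Finset.sum_congr rfl (g := fun _ => a l) (fun k hk => by rw [(Finset.mem_filter.1 hk).2]),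
    Finset.sum_const, nsmul_eq_mul]
  refine mul_le_mul_of_nonneg_right ?_ (ha l)
  have hsub : (Finset.range T).filter (fun k => φ k = l) ⊆ Finset.Icc (l - n) (l + n) := by
    intro k hk
    obtain ⟨hkT, rfl⟩ := Finset.mem_filter.1 hk
    have := hφ k (Finset.mem_range.1 hkT)
    rw [Finset.mem_Icc]
    omega
  have hcard := Finset.card_le_card hsub
  rw [Nat.card_Icc] at hcard
  have : ((Finset.range T).filter (fun k => φ k = l)).card ≤ 2 * n + 1 := by omega
  exact_mod_cast this

/-- The squared distance of two terms of a sequence in a window of `n + 1` indices. -/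
lemma norm_sq_sub_le_window {E : Type*} [NormedAddCommGroup E] (g : ℕ → E) {a n k l : ℕ}
    (hk : a ≤ k ∧ k ≤ a + n) (hl : a ≤ l ∧ l ≤ a + n) :
    ‖g k - g l‖ ^ 2 ≤ n * ∑ j ∈ Finset.Ico a (a + n), ‖g (j + 1) - g j‖ ^ 2 := by
  wlog hkl : k ≤ l generalizing k l
  · rw [norm_sub_rev]
    exact this hl hk (by omega)
  have h1 : ‖g k - g l‖ ≤ ∑ j ∈ Finset.Ico a (a + n), ‖g (j + 1) - g j‖ := by
    have h2 := dist_le_Ico_sum_dist g hkl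
    simp only [dist_eq_norm] at h2
    refine h2.trans ?_
    rw [Finset.sum_congr rfl fun j _ => norm_sub_rev (g j) (g (j + 1))]
    exact Finset.sum_le_sum_of_subset_of_nonneg (Finset.Ico_subset_Ico hk.1 hl.2)
      fun _ _ _ => norm_nonneg _
  have h3 := sq_sum_le_card_mul_sum_sq (s := Finset.Ico a (a + n))
    (f := fun j => ‖g (j + 1) - g j‖)
  rw [Nat.card_Ico, Nat.add_sub_cancel_left] at h3
  exact (pow_le_pow_left₀ (norm_nonneg _) h1 2).trans h3

section Windows

variable {ι : Type*} [Fintype ι] {q : ι → ℕ} {X K : Set (BlockVec q)}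
  {f : BlockVec q → ℝ} {lam0 phi0 rho0 : ℝ} {s : ℕ} {cl : ι → Fin s} {z : ℕ → Fin s}

/-- If each cluster is updated in every window of `n + 1` steps, the full gradients are controlled
by the gradients in the updated blocks. Block `i` of the gradient at step `k` is compared with the
one at an update of block `i` in a common window around `k`. Young's inequality with weight
`1 / (2n + 1)` compensates the multiplicity `2n + 1` of the comparison steps, and the changes
of the different blocks add up to the change of the full gradient over the window. -/
lemma UniformBounds.sum_gradient_le (hb : UniformBounds X K f lam0 phi0 rho0)
    {x : ℕ → BlockVec q} {T n : ℕ} {ε' : ℝ} (hnT : n + 1 ≤ T)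
    (hx : ∀ k ≤ T, x k ∈ K) (hρ : ∀ k < T, ‖x (k + 1) - x k‖ ≤ rho0)
    (hstep : ∀ k < T, n * ‖x (k + 1) - x k‖ ≤ ε')
    (hcyc : ∀ j : Fin s, ∀ a, a + n < T → ∃ k, a ≤ k ∧ k ≤ a + n ∧ z k = j) :
    ∑ k ∈ Finset.range T, ‖gradient f (x k)‖ ^ 2 ≤ 2 * (n + 1) *
      (∑ k ∈ Finset.range T, ∑ i ∈ cluster cl (z k), ‖gradient f (x k) i‖ ^ 2 +
        T * (phi0 ^ 2 * ε' ^ 2)) := by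
  classical
  set g : ℕ → BlockVec q := fun k => gradient f (x k) with hg
  -- the window around step `k` starts at `k - n`, or at `0` if this is negative
  have hsel : ∀ (j : Fin s) (k : ℕ), ∃ l, k < T →
      (k - n ≤ l ∧ l ≤ k - n + n) ∧ l < T ∧ z l = j := by
    intro j k
    by_cases hk : k < T
    · obtain ⟨l, h1, h2, h3⟩ := hcyc j (k - n) (by omega)
      exact ⟨l, fun _ => ⟨⟨h1, h2⟩, by omega, h3⟩⟩
    · exact ⟨0, fun h => absurd h hk⟩
  choose φ hφ using hsel
  have hn : (0 : ℝ) < 2 * n + 1 := by positivity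
  have hdrift : ∀ k < T, ∑ i, ‖g k i - g (φ (cl i) k) i‖ ^ 2 ≤ phi0 ^ 2 * ε' ^ 2 := by
    intro k hk
    have h1 : ∀ i, ‖g k i - g (φ (cl i) k) i‖ ^ 2 ≤
        n * ∑ l ∈ Finset.Ico (k - n) (k - n + n), ‖g (l + 1) i - g l i‖ ^ 2 := fun i =>
      norm_sq_sub_le_window (fun k => g k i) (by omega) (hφ (cl i) k hk).1
    have h2 : ∀ l ∈ Finset.Ico (k - n) (k - n + n),
        n ^ 2 * ∑ i, ‖g (l + 1) i - g l i‖ ^ 2 ≤ phi0 ^ 2 * ε' ^ 2 := by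
      intro l hl
      have hlT : l < T := by
        have := Finset.mem_Ico.1 hl
        omega
      have h3 : ∑ i, ‖g (l + 1) i - g l i‖ ^ 2 = ‖g (l + 1) - g l‖ ^ 2 := by
        rw [PiLp.norm_sq_eq_of_L2]
        rfl
      rw [h3, ← mul_pow, ← mul_pow]
      refine pow_le_pow_left₀ (by positivity) ?_ 2
      have h4 := hb.lipschitz_gradient (x l) (hx l hlT.le) (x (l + 1)) (hρ l hlT)
      calc (n : ℝ) * ‖g (l + 1) - g l‖ ≤ n * (phi0 * ‖x (l + 1) - x l‖) :=
            mul_le_mul_of_nonneg_left h4 (Nat.cast_nonneg _)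
        _ = phi0 * (n * ‖x (l + 1) - x l‖) := by ring
        _ ≤ phi0 * ε' := mul_le_mul_of_nonneg_left (hstep l hlT) hb.phi0_nonneg
    have h5 : ∑ i, ‖g k i - g (φ (cl i) k) i‖ ^ 2 ≤
        n * ∑ l ∈ Finset.Ico (k - n) (k - n + n), ∑ i, ‖g (l + 1) i - g l i‖ ^ 2 := by
      rw [Finset.sum_comm, Finset.mul_sum]
      exact Finset.sum_le_sum fun i _ => h1 i
    refine h5.trans ?_
    rcases Nat.eq_zero_or_pos n with rfl | hn0
    · simp only [Nat.cast_zero, zero_mul]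
      positivity
    · have hn0' : (0 : ℝ) < n := by exact_mod_cast hn0
      have h6 := Finset.sum_le_sum h2
      rw [← Finset.mul_sum, Finset.sum_const, Nat.card_Ico, Nat.add_sub_cancel_left,
        nsmul_eq_mul, sq, mul_assoc] at h6
      exact le_of_mul_le_mul_left h6 hn0'
  have hyoung : ∀ k i, ‖g k i‖ ^ 2 ≤ (1 + 1 / (2 * n + 1)) * ‖g (φ (cl i) k) i‖ ^ 2 +
      2 * (n + 1) * ‖g k i - g (φ (cl i) k) i‖ ^ 2 := by
    intro k i
    set A := ‖g (φ (cl i) k) i‖ with hA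
    set C := ‖g k i - g (φ (cl i) k) i‖ with hC
    have h1 : ‖g k i‖ ≤ A + C := by
      have := norm_le_norm_add_norm_sub' (g k i) (g (φ (cl i) k) i)
      exact this
    have h2 : (1 + 1 / (2 * n + 1)) * A ^ 2 + 2 * (n + 1) * C ^ 2 - (A + C) ^ 2 =
        (A - (2 * n + 1) * C) ^ 2 / (2 * n + 1) := by
      field_simp
      ring
    have h3 : 0 ≤ (A - (2 * n + 1) * C) ^ 2 / (2 * n + 1) := by positivity
    have h4 := pow_le_pow_left₀ (norm_nonneg _) h1 2
    linarith
  have hmult : ∀ i, ∑ k ∈ Finset.range T, ‖g (φ (cl i) k) i‖ ^ 2 ≤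
      (2 * n + 1) * ∑ l ∈ (Finset.range T).filter (fun l => z l = cl i), ‖g l i‖ ^ 2 := by
    intro i
    refine sum_comp_le_of_near (a := fun l => ‖g l i‖ ^ 2) (fun l => sq_nonneg _) fun k hk => ?_
    have := hφ (cl i) k hk
    exact ⟨this.2.1, this.2.2, by omega, by omega⟩
  have hswap : ∑ i, ∑ l ∈ (Finset.range T).filter (fun l => z l = cl i), ‖g l i‖ ^ 2 =
      ∑ k ∈ Finset.range T, ∑ i ∈ cluster cl (z k), ‖g k i‖ ^ 2 := by
    simp only [cluster, Finset.sum_filter]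
    rw [Finset.sum_comm]
    exact Finset.sum_congr rfl fun k _ => Finset.sum_congr rfl fun i _ => by simp only [eq_comm]
  have hsplit : ∑ k ∈ Finset.range T, ‖g k‖ ^ 2 ≤
      (1 + 1 / (2 * n + 1)) * ∑ i, ∑ k ∈ Finset.range T, ‖g (φ (cl i) k) i‖ ^ 2 +
        2 * (n + 1) * ∑ k ∈ Finset.range T, ∑ i, ‖g k i - g (φ (cl i) k) i‖ ^ 2 := by
    rw [Finset.sum_comm, Finset.mul_sum, Finset.mul_sum, ← Finset.sum_add_distrib]
    refine Finset.sum_le_sum fun k _ => ?_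
    rw [PiLp.norm_sq_eq_of_L2, Finset.mul_sum, Finset.mul_sum, ← Finset.sum_add_distrib]
    exact Finset.sum_le_sum fun i _ => hyoung k i
  have h1 := Finset.sum_le_sum fun i (_ : i ∈ Finset.univ) => hmult i
  rw [← Finset.mul_sum, hswap] at h1
  have h2 := Finset.sum_le_sum fun k (hk : k ∈ Finset.range T) => hdrift k (Finset.mem_range.1 hk)
  rw [Finset.sum_const, Finset.card_range, nsmul_eq_mul] at h2
  have h3 := mul_le_mul_of_nonneg_left h1 (show (0 : ℝ) ≤ 1 + 1 / (2 * n + 1) by positivity)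
  have h4 := mul_le_mul_of_nonneg_left h2 (show (0 : ℝ) ≤ 2 * (n + 1) by positivity)
  have h5 : ∀ y : ℝ, (1 + 1 / (2 * n + 1)) * ((2 * n + 1) * y) = 2 * (n + 1) * y := by
    intro y
    field_simp
    ring
  rw [h5] at h3
  rw [mul_add]
  linarith

/-- The gradient does not change by more than `phi0 ε'` over `n` steps of total length `ε'`. -/
lemma UniformBounds.norm_gradient_sub_start_le (hb : UniformBounds X K f lam0 phi0 rho0)
    {x : ℕ → BlockVec q} {T n : ℕ} {ε' : ℝ} (hε' : 0 ≤ ε')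
    (hx : ∀ k ≤ T, x k ∈ K) (hρ : ∀ k < T, ‖x (k + 1) - x k‖ ≤ rho0)
    (hstep : ∀ k < T, n * ‖x (k + 1) - x k‖ ≤ ε') {k : ℕ} (hk : k ≤ T) (hkn : k ≤ n) :
    ‖gradient f (x k) - gradient f (x 0)‖ ≤ phi0 * ε' := by
  have hφ := hb.phi0_nonneg
  rcases Nat.eq_zero_or_pos n with rfl | hn
  · obtain rfl : k = 0 := by omega
    simpa using mul_nonneg hφ hε'
  have hn' : (0 : ℝ) < n := by exact_mod_cast hn
  have h1 : ∀ l < k, ‖gradient f (x (l + 1)) - gradient f (x l)‖ ≤ phi0 * (ε' / n) := by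
    intro l hl
    refine (hb.lipschitz_gradient (x l) (hx l (by omega)) _ (hρ l (by omega))).trans ?_
    refine mul_le_mul_of_nonneg_left ?_ hφ
    rw [le_div_iff₀ hn', mul_comm]
    exact hstep l (by omega)
  have h2 := dist_le_range_sum_of_dist_le (f := fun k => gradient f (x k))
    (d := fun _ => phi0 * (ε' / n)) k (fun {l} hl => by
      rw [dist_eq_norm, norm_sub_rev]
      exact h1 l hl)
  rw [dist_eq_norm, norm_sub_rev, Finset.sum_const, Finset.card_range, nsmul_eq_mul] at h2
  refine h2.trans ?_
  have h3 : (k : ℝ) ≤ n := by exact_mod_cast hkn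
  calc (k : ℝ) * (phi0 * (ε' / n)) ≤ n * (phi0 * (ε' / n)) :=
        mul_le_mul_of_nonneg_right h3 (by positivity)
    _ = phi0 * ε' := by field_simp

end Windows

/-! ### Runs that are too short for the cyclic update rule, and the failure probability -/

/-- A gradient step of length `η ≤ 1 / phi0` decreases a nonnegative function by at least half of
`η ‖∇f‖²`, which bounds the gradient. -/
lemma UniformBounds.sq_norm_gradient_le {E : Type*} [NormedAddCommGroup E] [InnerProductSpace ℝ E]
    [CompleteSpace E] {X K : Set E} {f : E → ℝ} {lam0 phi0 rho0 : ℝ}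
    (hb : UniformBounds X K f lam0 phi0 rho0) {x : E} (hx : x ∈ K) (hf : ∀ y, 0 ≤ f y) {η : ℝ}
    (hη : 0 < η) (hφη : phi0 * η ≤ 1) (hρ : η * ‖gradient f x‖ ≤ rho0) :
    η * ‖gradient f x‖ ^ 2 ≤ 2 * f x := by
  have hnorm : ‖-(η • gradient f x)‖ = η * ‖gradient f x‖ := by
    rw [norm_neg, norm_smul, Real.norm_of_nonneg hη.le]
  have h1 := hb.le_quadratic hx (d := -(η • gradient f x)) (by rwa [hnorm])
  rw [hnorm, inner_neg_right, inner_smul_right, real_inner_self_eq_norm_sq] at h1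
  have h2 := hf (x + -(η • gradient f x))
  have h3 : phi0 * η * (η * ‖gradient f x‖ ^ 2) ≤ 1 * (η * ‖gradient f x‖ ^ 2) :=
    mul_le_mul_of_nonneg_right hφη (by positivity)
  nlinarith

/-- If there are only `T ≤ n` steps, then the gradient at the starting point is small: either
`phi0 η ≤ 1`, and a gradient step decreases `f x ≤ T η ε / 2`, or `η > 1 / phi0` is so large that
the bound on `η` forces a small gradient. -/
lemma UniformBounds.sq_norm_gradient_start_lt {E : Type*} [NormedAddCommGroup E]
    [InnerProductSpace ℝ E] [CompleteSpace E] {X K : Set E} {f : E → ℝ} {lam0 phi0 rho0 : ℝ}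
    (hb : UniformBounds X K f lam0 phi0 rho0) {x : E} (hx : x ∈ K) (hf : ∀ y, 0 ≤ f y)
    {η δ ε ε' : ℝ} {N n T : ℕ} (hη : 0 < η) (hε : 0 < ε) (hN : 1 ≤ N) (hT : 0 < T) (hTn : T ≤ n)
    (hδ : 2 * ‖gradient f x‖ ≤ δ) (hηρ : η * (2 * δ * √(N : ℝ)) ≤ rho0)
    (hηε' : η * (2 * δ * n * N) ≤ ε') (hfx : 2 * f x ≤ T * (η * ε)) :
    ‖gradient f x‖ ^ 2 < (n + 1) * ε + n * (phi0 ^ 2 * ε' ^ 2) := by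
  have hφ := hb.phi0_nonneg
  have hTn' : (T : ℝ) ≤ n := by exact_mod_cast hTn
  have hn1 : (1 : ℝ) ≤ n := by exact_mod_cast (Nat.succ_le_of_lt hT).trans hTn
  have hN1 : (1 : ℝ) ≤ N := by exact_mod_cast hN
  have ha0 : 0 ≤ ‖gradient f x‖ := norm_nonneg _
  have hδ0 : 0 ≤ δ := by linarith
  rcases le_or_gt (phi0 * η) 1 with hφη | hφη
  · have h1 : η * ‖gradient f x‖ ≤ rho0 := by
      have h2 : 1 ≤ √(N : ℝ) := Real.one_le_sqrt.2 hN1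
      have h3 : δ * 1 ≤ δ * √(N : ℝ) := mul_le_mul_of_nonneg_left h2 hδ0
      have h4 : ‖gradient f x‖ ≤ 2 * δ * √(N : ℝ) := by linarith
      exact (mul_le_mul_of_nonneg_left h4 hη.le).trans hηρ
    have h2 := hb.sq_norm_gradient_le hx hf hη hφη h1
    have h4 : η * ‖gradient f x‖ ^ 2 ≤ η * (T * ε) := by linarith
    have h5 : ‖gradient f x‖ ^ 2 ≤ T * ε := le_of_mul_le_mul_left h4 hη
    have h6 : (T : ℝ) * ε < (n + 1) * ε := mul_lt_mul_of_pos_right (by linarith) hε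
    have h7 : 0 ≤ n * (phi0 ^ 2 * ε' ^ 2) := by positivity
    linarith
  · have h1 : η * ‖gradient f x‖ ≤ ε' := by
      have h2 : 1 ≤ (n : ℝ) * N := one_le_mul_of_one_le_of_one_le hn1 hN1
      have h3 : δ * 1 ≤ δ * (n * N) := mul_le_mul_of_nonneg_left h2 hδ0
      have h4 : ‖gradient f x‖ ≤ 2 * δ * n * N := by linarith
      exact (mul_le_mul_of_nonneg_left h4 hη.le).trans hηε'
    have h2 : ‖gradient f x‖ ≤ phi0 * ε' := by
      calc ‖gradient f x‖ = 1 * ‖gradient f x‖ := (one_mul _).symm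
        _ ≤ phi0 * η * ‖gradient f x‖ := mul_le_mul_of_nonneg_right hφη.le ha0
        _ = phi0 * (η * ‖gradient f x‖) := by ring
        _ ≤ phi0 * ε' := mul_le_mul_of_nonneg_left h1 hφ
    have h3 := pow_le_pow_left₀ ha0 h2 2
    rw [mul_pow] at h3
    have h4 : 1 * (phi0 ^ 2 * ε' ^ 2) ≤ n * (phi0 ^ 2 * ε' ^ 2) :=
      mul_le_mul_of_nonneg_right hn1 (by positivity)
    have h5 : 0 < ((n : ℝ) + 1) * ε := by positivity
    linarith

section Degenerate

variable {ι : Type*} [Fintype ι] [DecidableEq ι] {q p : ι → ℕ} {G : SimpleGraph ι}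
  {D : Measure (BlockVec p)} {X : Set (BlockVec q)} {f : BlockVec q → ℝ}
  {hl : ι → BlockVec q → BlockVec p → ℝ} {fl : ι → BlockVec q → ℝ} {c : ℝ}
  {K : Set (BlockVec q)} {lam0 phi0 rho0 : ℝ}

/-- A constant `c < 1` forces the local costs, and thus the gradient, to vanish. -/
lemma LocalCosts.gradient_eq_zero [IsProbabilityMeasure D] (h : LocalCosts G D X f hl fl c)
    (hX : IsOpen X) (hc : c < 1) {x : BlockVec q} (hx : x ∈ X) : gradient f x = 0 := by
  have hfl : ∀ i, ∀ x ∈ X, fl i x = 0 := by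
    intro i x hx
    have h1 : fl i x ≤ c * fl i x := by
      calc fl i x = ∫ ξ, hl i x ξ ∂D := h.expectation i x
        _ ≤ ∫ _ξ, c * fl i x ∂D :=
            integral_mono_ae (h.integrable i x hx) (integrable_const _) (h.le_mul i x hx)
        _ = c * fl i x := by simp
    have h2 := h.fl_nonneg i x
    nlinarith
  ext i : 1
  have h1 := h.gradient_eq i x hx
  have hcont : Continuous fun y => setBlock x i y :=
    (continuous_setBlock i).comp (continuous_const.prodMk continuous_id)
  have h2 : (fun y => fl i (setBlock x i y)) =ᶠ[𝓝 (x i)] fun _ => 0 := by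
    filter_upwards [(hX.preimage hcont).mem_nhds (by simpa using hx)] with y hy
    exact hfl i _ hy
  exact h1.unique ((hasGradientAt_const (x i) (0 : ℝ)).congr_of_eventuallyEq h2)

lemma LocalCosts.mono_const (h : LocalCosts G D X f hl fl c) {c' : ℝ} (hc : c ≤ c') :
    LocalCosts G D X f hl fl c' :=
  { h with
    le_mul := fun i x hx => (h.le_mul i x hx).mono fun _ hξ =>
      hξ.trans (mul_le_mul_of_nonneg_right hc (h.fl_nonneg i x)) }

omit [Fintype ι] [DecidableEq ι] in
lemma nontrivial_blockVec [Nonempty ι] (hq : ∀ i, 0 < q i) : Nontrivial (BlockVec q) := by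
  classical
  obtain ⟨i⟩ := ‹Nonempty ι›
  refine ⟨setBlock 0 i (EuclideanSpace.single ⟨0, hq i⟩ 1), 0, fun h => ?_⟩
  have h1 := congrArg (fun x : BlockVec q => x i ⟨0, hq i⟩) h
  simp at h1

omit [DecidableEq ι] in
/-- Over a run of at most `n` steps all gradients stay close to the initial one. -/
lemma UniformBounds.sum_gradient_lt_of_start (hb : UniformBounds X K f lam0 phi0 rho0)
    {x : ℕ → BlockVec q} {T n : ℕ} {ε ε' : ℝ} (hε' : 0 ≤ ε') (hT : 0 < T)
    (hTn : T ≤ n) (hx : ∀ k ≤ T, x k ∈ K) (hρ : ∀ k < T, ‖x (k + 1) - x k‖ ≤ rho0)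
    (hstep : ∀ k < T, n * ‖x (k + 1) - x k‖ ≤ ε')
    (hstart : ‖gradient f (x 0)‖ ^ 2 < (n + 1) * ε + n * (phi0 ^ 2 * ε' ^ 2)) :
    ∑ k ∈ Finset.range T, ‖gradient f (x k)‖ ^ 2 <
      T * (2 * (n + 1) * (ε + phi0 ^ 2 * ε' ^ 2)) := by
  have hterm : ∀ k ∈ Finset.range T, ‖gradient f (x k)‖ ^ 2 <
      2 * (n + 1) * (ε + phi0 ^ 2 * ε' ^ 2) := by
    intro k hk
    have hkT := Finset.mem_range.1 hk
    have h1 := hb.norm_gradient_sub_start_le hε' hx hρ hstep hkT.le (by omega)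
    have h2 := norm_le_norm_add_norm_sub' (gradient f (x k)) (gradient f (x 0))
    have h3 := pow_le_pow_left₀ (norm_nonneg _) (h2.trans (add_le_add_right h1 _)) 2
    have h4 := sq_nonneg (‖gradient f (x 0)‖ - phi0 * ε')
    linarith
  calc ∑ k ∈ Finset.range T, ‖gradient f (x k)‖ ^ 2
      < ∑ _k ∈ Finset.range T, 2 * (n + 1) * (ε + phi0 ^ 2 * ε' ^ 2) :=
        Finset.sum_lt_sum_of_nonempty (Finset.nonempty_range_iff.2 hT.ne') hterm
    _ = _ := by rw [Finset.sum_const, Finset.card_range, nsmul_eq_mul]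

end Degenerate

namespace IsRun

variable {ι Ω : Type*} [Fintype ι] [DecidableEq ι] [MeasurableSpace Ω] {q p : ι → ℕ}
  {s : ℕ} {G : SimpleGraph ι} {D : Measure (BlockVec p)} {X K : Set (BlockVec q)}
  {f : BlockVec q → ℝ} {hl : ι → BlockVec q → BlockVec p → ℝ} {fl : ι → BlockVec q → ℝ}
  {c lam0 phi0 rho0 : ℝ} {x0 : BlockVec q} {cl : ι → Fin s} {P : Measure Ω}
  {ξ : ℕ → Ω → BlockVec p} {u : ℕ → (i : ι) → Ω → EuclideanSpace ℝ (Fin (q i))}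
  {z : ℕ → Fin s} {w : ℕ → ι → Ω → ℝ} {η : ℝ} {r : ι → ℝ} {δ B M : ℝ} {T : ℕ}

variable (H : IsRun G D X K f hl fl c lam0 phi0 rho0 x0 cl P ξ u z w η r δ B M T)

lemma mul_norm_displacement_le {k n : ℕ} {ω : Ω} {ε' : ℝ} (hδ0 : 0 ≤ δ) (hε' : 0 ≤ ε')
    (hm : ∀ i, cl i = z k → 2 * n * clusterSize cl i * ‖H.extra k ω i‖ ≤ ε')
    (hg : ∀ i, cl i = z k → ‖H.estimate k ω i‖ ≤ δ)
    (hδ : η * (2 * δ * n * maxClusterSize cl) ≤ ε') :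
    n * ‖blockStep (cluster cl (z k)) η (H.extra k ω) (H.estimate k ω)‖ ≤ ε' := by
  rcases Nat.eq_zero_or_pos n with rfl | hn
  · simpa using hε'
  have hn' : (0 : ℝ) < n := by exact_mod_cast hn
  rw [mul_comm, ← le_div_iff₀ hn']
  refine norm_blockStep_le (by positivity) fun i hi => ?_
  have hi' := mem_cluster.1 hi
  rw [card_cluster hi']
  have hN : (1 : ℝ) ≤ clusterSize cl i := by exact_mod_cast clusterSize_pos i
  have hN0 : (clusterSize cl i : ℝ) ≤ maxClusterSize cl := by exact_mod_cast clusterSize_le_max i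
  have hs : √(clusterSize cl i : ℝ) ≤ clusterSize cl i := by
    rw [Real.sqrt_le_left (by linarith)]
    nlinarith
  have hs0 : 0 < √(clusterSize cl i : ℝ) := Real.sqrt_pos.2 (by linarith)
  have hη := H.step_pos
  have h1 : ‖H.extra k ω i - η • H.estimate k ω i‖ ≤ ‖H.extra k ω i‖ + η * δ := by
    refine (norm_sub_le _ _).trans (add_le_add_right ?_ _)
    rw [norm_smul, Real.norm_of_nonneg hη.le]
    exact mul_le_mul_of_nonneg_left (hg i hi') hη.le
  have h2 : n * clusterSize cl i * (η * δ) ≤ n * maxClusterSize cl * (η * δ) :=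
    mul_le_mul_of_nonneg_right (mul_le_mul_of_nonneg_left hN0 hn'.le) (by positivity)
  have h3 : n * clusterSize cl i * (‖H.extra k ω i‖ + η * δ) ≤ ε' := by
    have := hm i hi'
    linarith
  rw [div_div, le_div_iff₀ (by positivity)]
  calc ‖H.extra k ω i - η • H.estimate k ω i‖ * (n * √(clusterSize cl i : ℝ))
      ≤ (‖H.extra k ω i‖ + η * δ) * (n * clusterSize cl i) :=
        mul_le_mul h1 (mul_le_mul_of_nonneg_left hs hn'.le) (by positivity)
          ((norm_nonneg _).trans h1)
    _ ≤ ε' := by linarith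

end IsRun

/-- The failure probability in closed form: the number of steps is
`T = ⌈2ανy / (ηε)⌉` for the initial cost `y`. -/
lemma failure_bound {y η ε α ν γ : ℝ} {T : ℕ} (hy : 0 < y) (hη : 0 < η) (hε : 0 < ε) (hα : 0 < α)
    (hν : 0 < ν) (hγ : 0 < γ) (hT : T = ⌈2 * α * ν * y / (η * ε)⌉₊)
    (hηy : η * (γ * ε) ≤ 2 * α * y) :
    (y + T * (η * (γ * ε / (2 * α)))) * (1 / (α * y) + 2 / (η * T * ε)) ≤
      1 / α * (2 + γ + 1 / ν + ν * γ) := by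
  have hpos : 0 < 2 * α * ν * y / (η * ε) := by positivity
  have hTle : 2 * α * ν * y / (η * ε) ≤ T := hT ▸ Nat.le_ceil _
  have hTlt : (T : ℝ) < 2 * α * ν * y / (η * ε) + 1 := hT ▸ Nat.ceil_lt_add_one hpos.le
  have hT0 : (0 : ℝ) < T := hpos.trans_le hTle
  set θ := η * (γ * ε / (2 * α)) with hθ
  have hθ0 : 0 < θ := by positivity
  have hθy : θ ≤ y := by
    rw [hθ, mul_div_assoc', div_le_iff₀ (by positivity)]
    linarith
  have h1 : T * θ ≤ ν * γ * y + y := by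
    have : (2 * α * ν * y / (η * ε) + 1) * θ = ν * γ * y + θ := by
      rw [hθ]
      field_simp
    have := mul_le_mul_of_nonneg_right hTlt.le hθ0.le
    linarith
  have h2 : (y + T * θ) * (1 / (α * y)) ≤ 1 / α * (2 + ν * γ) := by
    have : 1 / α * (2 + ν * γ) = (2 * y + ν * γ * y) * (1 / (α * y)) := by field_simp
    rw [this]
    exact mul_le_mul_of_nonneg_right (by linarith) (by positivity)
  have h3 : (y + T * θ) * (2 / (η * T * ε)) = 2 * y / (η * T * ε) + γ / α := by
    rw [hθ]
    field_simp
  have h4 : 2 * y / (η * T * ε) ≤ 1 / α * (1 / ν) := by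
    rw [div_le_iff₀ (by positivity)] at hTle
    rw [one_div_mul_one_div, div_le_div_iff₀ (by positivity) (by positivity)]
    linarith
  rw [mul_add, h3]
  have h5 : 1 / α * (2 + γ + 1 / ν + ν * γ) =
      1 / α * (2 + ν * γ) + (1 / α * (1 / ν) + γ / α) := by ring
  rw [h5]
  linarith

end AsyncZOO

theorem theorem1 {ι Ω : Type*} [Fintype ι] [DecidableEq ι] [Nonempty ι]
    -- the agents, the dimensions of their states and noises, and the interaction graph
    (q p : ι → ℕ) (hq : ∀ i, 0 < q i) (G : SimpleGraph ι)
    -- the distribution of the noise, the feasible domain, and the global cost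
    (D : Measure (BlockVec p)) [IsProbabilityMeasure D] (X : Set (BlockVec q))
    (h : BlockVec q → BlockVec p → ℝ) (h_nonneg : ∀ x ξ, 0 ≤ h x ξ)
    (h_int : ∀ x ∈ X, Integrable (h x) D)
    (f : BlockVec q → ℝ) (hf : ∀ x, f x = ∫ ξ, h x ξ ∂D)
    (lam zeta phi beta : BlockVec q → ℝ) (hreg : RegularCost X f lam zeta phi beta)
    -- the local costs
    (hl : ι → BlockVec q → BlockVec p → ℝ) (fl : ι → BlockVec q → ℝ) (c : ℝ)
    (hlocal : LocalCosts G D X f hl fl c)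
    (x0 : BlockVec q) (hx0 : x0 ∈ X)
    -- the clusters: no two agents of one cluster are adjacent
    (s : ℕ) (cl : G.Coloring (Fin s))
    -- the samples, the update order and the extrapolation weights
    [MeasurableSpace Ω] (P : Measure Ω) [IsProbabilityMeasure P]
    (ξ : ℕ → Ω → BlockVec p) (u : ℕ → (i : ι) → Ω → EuclideanSpace ℝ (Fin (q i)))
    (hsample : IsSampling P D ξ u)
    (z : ℕ → Fin s) (w : ℕ → ι → Ω → ℝ) (w_nonneg : ∀ k i ω, 0 ≤ w k i ω)
    (w_adapted : ∀ k i, Measurable[pastSigma ξ u k] (w k i))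
    -- the scalars
    (ε ν γ α : ℝ) (hε : 0 < ε) (hν : 0 < ν) (hγ : 0 < γ) (hα : 2 + γ + 1 / ν + ν * γ ≤ α)
    (αl : ι → ℝ) (hαl : ∀ i, 1 < αl i)
    (hαl_large : ∀ x ∈ X, f x ≤ α * f x0 → ∀ i, fl i x ≤ αl i * fl i x0)
    -- the compact set on which the constants are taken, and the constants
    (XX : Set (BlockVec q))
    (hXX : XX = {x | x ∈ X ∧ f x ≤ α * f x0 ∧ ∀ i, fl i x ≤ αl i * fl i x0})
    (phi0 lam0 rho0 : ℝ) (hphi0 : phi0 = sSup (phi '' XX)) (hlam0 : lam0 = sSup (lam '' XX))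
    (hrho0 : rho0 = sInf ((fun x => min (beta x) (zeta x)) '' XX))
    (N0 : ℕ) (hN0 : N0 = maxClusterSize cl)
    -- the step size, the smoothing radii and the number of iterations
    (η : ℝ) (hη : 0 < η) (r : ι → ℝ) (hr : ∀ i, 0 < r i)
    (δ : ℝ) (hδ : δ = (((⨆ i, q i : ℕ) : ℝ) / (⨅ i, r i)) * c *
      ((⨆ i, αl i * fl i x0) + lam0 * rho0))
    (T : ℕ) (hT : T = ⌈2 * α * ν * f x0 / (η * ε)⌉₊)
    (hη_one : η ≤ 1)
    (hη₁ : η * (2 * δ * √(N0 : ℝ)) ≤ rho0)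
    (hη₂ : η ≤ 2 * α * f x0 / (γ * ε))
    (hη₃ : η ≤ γ * ε / (2 * α * N0 * (phi0 * δ ^ 2 + 4 * phi0 ^ 2 + phi0 + 4)))
    (hr₁ : ∀ i, r i ≤ rho0 / 2)
    (hr₂ : ∀ i, r i * (2 * phi0) ≤ √(γ * ε / (α * N0)))
    -- the iterates `x^k` and the values `x^{k_prev}`
    (x xprev : ℕ → Ω → BlockVec q)
    (hx : ∀ k ω, x k ω = (iterates hl cl x0 η r z w ξ u k ω).1)
    (hxprev : ∀ k ω, xprev k ω = (iterates hl cl x0 η r z w ξ u k ω).2)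
    (hw : ∀ k < T, ∀ i, cl i = z k → ∀ᵐ ω ∂P,
      w k i ω * ‖x k ω i - xprev k ω i‖ ≤
        min (η ^ (3 / 2 : ℝ)) (rho0 / (2 * √(clusterSize cl i : ℝ)))) :
    -- (i)
    1 - (1 / α) * (2 + γ + 1 / ν + ν * γ) ≤
      P.real {ω | (1 / (T : ℝ)) * ∑ k ∈ Finset.range T,
        ∑ i with cl i = z k, ‖(gradient f (x k ω)) i‖ ^ 2 < ε} ∧
    -- (ii)
    ∀ (T0 : ℕ) (ε' : ℝ), EssentiallyCyclic T0 T z → 0 < ε' → ε' ≤ rho0 →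
      (∀ k < T, ∀ i, cl i = z k → ∀ᵐ ω ∂P,
        w k i ω * (2 * ((T0 : ℝ) - 1) * clusterSize cl i * ‖x k ω i - xprev k ω i‖) ≤ ε') →
      η * (2 * δ * ((T0 : ℝ) - 1) * N0) ≤ ε' →
      1 - (1 / α) * (2 + γ + 1 / ν + ν * γ) ≤
        P.real {ω | (1 / (T : ℝ)) * ∑ k ∈ Finset.range T, ‖gradient f (x k ω)‖ ^ 2 <
          2 * T0 * (ε + phi0 ^ 2 * ε' ^ 2)} := by
  have hf_nonneg : ∀ y, 0 ≤ f y := fun y => by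
    rw [hf]; exact integral_nonneg fun ξ => h_nonneg y ξ
  have hνγ : 0 < ν * γ := mul_pos hν hγ
  have hν' : 0 < 1 / ν := by positivity
  have hα0 : 0 < α := by linarith
  -- the bound on the step size excludes a vanishing initial cost
  have hη₂' : η * (γ * ε) ≤ 2 * α * f x0 := (le_div_iff₀ (by positivity)).1 hη₂
  have hfx0 : 0 < f x0 := by
    have : 0 < η * (γ * ε) := by positivity
    exact pos_of_mul_pos_right (this.trans_le hη₂') (by positivity)
  have hXX_iff : ∀ y, y ∈ XX ↔ y ∈ X ∧ f y ≤ α * f x0 := fun y => by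
    rw [hXX]
    exact ⟨fun h => ⟨h.1, h.2.1⟩, fun h => ⟨h.1, h.2, hαl_large y h.1 h.2⟩⟩
  have hXX_eq : XX = {y | y ∈ X ∧ f y ≤ α * f x0} := Set.ext hXX_iff
  have hx0K : x0 ∈ XX := (hXX_iff x0).2 ⟨hx0, le_mul_of_one_le_left hfx0.le (by linarith)⟩
  have := nontrivial_blockVec hq
  have hcompact : IsCompact XX := by
    rw [hXX_eq]
    exact hreg.coercive.isCompact_sublevel hreg.continuousOn _
  have hb : UniformBounds X XX f lam0 phi0 rho0 := by
    rw [hphi0, hlam0, hrho0]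
    exact hreg.uniformBounds hcompact (fun y hy => ((hXX_iff y).1 hy).1) ⟨x0, hx0K⟩
  have hφ := hb.phi0_nonneg
  have hρ := hb.rho0_pos
  set F0 := ⨆ i, αl i * fl i x0 with hF0
  have hfl : ∀ y ∈ XX, ∀ i, fl i y ≤ F0 := fun y hy i => by
    rw [hXX] at hy
    exact (hy.2.2 i).trans (le_ciSup (f := fun i => αl i * fl i x0) (Set.finite_range _).bddAbove i)
  obtain ⟨i0⟩ := ‹Nonempty ι›
  have : Nonempty ι := ⟨i0⟩
  have hF0_nonneg : 0 ≤ F0 := (hlocal.fl_nonneg i0 x0).trans (hfl x0 hx0K i0)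
  have hFnn : 0 ≤ F0 + lam0 * rho0 := add_nonneg hF0_nonneg (mul_nonneg hb.lam0_nonneg hρ.le)
  have hrmin : 0 < ⨅ i, r i := by
    obtain ⟨j, hj⟩ := exists_eq_ciInf_of_finite (f := r)
    rw [← hj]
    exact hr j
  have hrle : ∀ i, (⨅ i, r i) ≤ r i := fun i => ciInf_le (Set.finite_range _).bddBelow i
  have hqle : ∀ i, (q i : ℝ) ≤ ((⨆ i, q i : ℕ) : ℝ) := fun i => by
    exact_mod_cast le_ciSup (f := q) (Set.finite_range _).bddAbove i
  set Q := ((⨆ i, q i : ℕ) : ℝ) / (⨅ i, r i) with hQ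
  have hQnn : 0 ≤ Q := by positivity
  have hQle : ∀ i, (q i : ℝ) / r i ≤ Q := fun i =>
    div_le_div₀ (Nat.cast_nonneg _) (hqle i) hrmin (hrle i)
  have hN0pos : (0 : ℝ) < N0 := by
    rw [hN0]
    exact_mod_cast (clusterSize_pos i0).trans_le (clusterSize_le_max (cl := cl) i0)
  -- for negative `c` the local costs vanish, and `c` and `δ` can be replaced by `0`
  have hδ' : ∀ t : ℝ, 0 ≤ t → ∀ a, 0 ≤ a → η * (2 * δ * t) ≤ a → η * (2 * max δ 0 * t) ≤ a := by
    intro t ht a ha h1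
    rcases le_total δ 0 with h2 | h2
    · rw [max_eq_right h2]; simpa using ha
    · rwa [max_eq_left h2]
  have hδsq : (max δ 0) ^ 2 ≤ δ ^ 2 := by
    rcases le_total δ 0 with h2 | h2
    · rw [max_eq_right h2]; simpa using sq_nonneg δ
    · rw [max_eq_left h2]
  have hstep_mul := hδ' (√(N0 : ℝ)) (Real.sqrt_nonneg _) rho0 hρ.le hη₁
  have H : IsRun G D X XX f hl fl (max c 0) lam0 phi0 rho0 x0 cl P ξ u z w η r (max δ 0)
      (γ * ε / (2 * α * N0)) (α * f x0) T :=
    { bounds := hb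
      mem_iff := hXX_iff
      start_mem := hx0K
      cost_nonneg := hf_nonneg
      localCosts := hlocal.mono_const (le_max_left _ _)
      sampling := hsample
      dim_pos := hq
      c_nonneg := le_max_right _ _
      weight_nonneg := w_nonneg
      weight_adapted := w_adapted
      estimate_le := by
        refine ⟨F0, hfl, fun i => ?_⟩
        rcases le_total c 0 with h2 | h2
        · rw [max_eq_right h2]
          simp
        · rw [max_eq_left h2]
          refine le_trans ?_ (le_max_left _ _)
          rw [hδ, mul_assoc]
          exact mul_le_mul_of_nonneg_right (hQle i) (mul_nonneg h2 hFnn)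
      step_pos := hη
      step_le_one := hη_one
      step_mul_le := fun i => by
        have h1 : (0 : ℝ) < √(clusterSize cl i : ℝ) :=
          Real.sqrt_pos.2 (by exact_mod_cast clusterSize_pos i)
        have h2 : √(clusterSize cl i : ℝ) ≤ √(N0 : ℝ) := by
          rw [hN0]
          exact Real.sqrt_le_sqrt (by exact_mod_cast clusterSize_le_max i)
        rw [le_div_iff₀ (by positivity)]
        have h3 : 0 ≤ η * max δ 0 := mul_nonneg hη.le (le_max_right _ _)
        have h4 := mul_le_mul_of_nonneg_left h2 h3
        linarith
      step_budget := by
        have h1 : 0 < phi0 * δ ^ 2 + 4 * phi0 ^ 2 + phi0 + 4 := by positivity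
        rw [← div_div, le_div_iff₀ h1] at hη₃
        refine le_trans (mul_le_mul_of_nonneg_left ?_ hη.le) hη₃
        have := mul_le_mul_of_nonneg_left hδsq hφ
        linarith
      radius_pos := hr
      radius_le := hr₁
      radius_budget := fun i => by
        have h1 := pow_le_pow_left₀ (mul_nonneg (hr i).le (by positivity)) (hr₂ i) 2
        rw [Real.sq_sqrt (by positivity)] at h1
        have h2 : γ * ε / (2 * α * N0) / 2 = γ * ε / (α * N0) / 4 := by
          field_simp
          norm_num
        rw [h2]
        linarith
      extrapolation_le := fun k hk i hi => by
        simpa only [hx, hxprev] using hw k hk i hi }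
  have hstate : ∀ k ω, x k ω = H.state k ω := hx
  have hTpos : 0 < T := by
    rw [hT]
    exact Nat.ceil_pos.2 (by positivity)
  have hTpos' : (0 : ℝ) < T := by exact_mod_cast hTpos
  have hprob : 1 - (1 / α) * (2 + γ + 1 / ν + ν * γ) ≤
      P.real {ω | ω ∈ H.stay T ∧ ∑ k ∈ Finset.range T, H.activeGrad k ω < T * ε} := by
    refine le_trans ?_ (H.prob_stay_and_small hε (by positivity) hTpos)
    have h1 := failure_bound hfx0 hη hε hα0 hν hγ hT hη₂'
    have h2 : (maxClusterSize cl : ℝ) * (η * (γ * ε / (2 * α * N0))) =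
        η * (γ * ε / (2 * α)) := by
      rw [← hN0]
      field_simp
    rw [h2]
    linarith
  refine ⟨hprob.trans (measureReal_mono fun ω hω => ?_), ?_⟩
  · have h1 : ∑ k ∈ Finset.range T, ∑ i with cl i = z k, ‖(gradient f (x k ω)) i‖ ^ 2 < T * ε := by
      simp only [hstate]
      exact hω.2
    simp only [Set.mem_ofPred_eq]
    rw [one_div, inv_mul_lt_iff₀ hTpos']
    exact h1
  intro T0 ε' hcyc hε' _ hwε' hδε'
  have hT0 : 1 ≤ T0 := (Nat.succ_le_of_lt (z 0).pos).trans hcyc.1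
  obtain ⟨n, rfl⟩ : ∃ n, T0 = n + 1 := ⟨T0 - 1, by omega⟩
  have hn : (((n + 1 : ℕ) : ℝ) - 1) = n := by push_cast; ring
  rw [hn] at hδε'
  simp only [hn] at hwε'
  have hδn : η * (2 * max δ 0 * n * maxClusterSize cl) ≤ ε' := by
    have h1 := hδ' (n * N0) (by positivity) ε' hε'.le (by linarith)
    rw [← hN0]
    linarith
  -- the almost sure bounds on all steps
  have hae : ∀ᵐ ω ∂P, ∀ k, k < T → ∀ i, cl i = z k →
      ‖H.extra k ω i‖ ≤ rho0 / (2 * √(clusterSize cl i : ℝ)) ∧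
      (H.state k ω ∈ XX → ‖H.estimate k ω i‖ ≤ max δ 0) ∧
      2 * n * clusterSize cl i * ‖H.extra k ω i‖ ≤ ε' := by
    rw [ae_all_iff]
    intro k
    by_cases hk : k < T
    · have h1 : ∀ᵐ ω ∂P, ∀ i, cl i = z k →
          2 * n * clusterSize cl i * ‖H.extra k ω i‖ ≤ ε' := by
        rw [ae_all_iff]
        intro i
        by_cases hi : cl i = z k
        · filter_upwards [hwε' k hk i hi] with ω hω _
          rw [hx, hxprev] at hω
          rw [H.norm_extra]
          linarith
        · exact Eventually.of_forall fun ω h => absurd h hi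
      filter_upwards [H.ae_regular hk, h1] with ω h2 h3 _ i hi
      exact ⟨(h2 i hi).2.1, (h2 i hi).2.2, h3 i hi⟩
    · exact Eventually.of_forall fun ω h => absurd h hk
  refine hprob.trans (ENNReal.toReal_mono (measure_ne_top _ _) (measure_mono_ae ?_))
  filter_upwards [hae] with ω hω hE
  obtain ⟨hstay, hsmall⟩ := hE
  have hxK : ∀ k ≤ T, H.state k ω ∈ XX := hstay
  have hstepρ : ∀ k < T, ‖H.state (k + 1) ω - H.state k ω‖ ≤ rho0 := fun k hk => by
    rw [H.state_succ, add_sub_cancel_left]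
    exact H.norm_displacement_le (fun i hi => (hω k hk i hi).1)
      (fun i hi => (hω k hk i hi).2.1 (hxK k hk.le))
  have hstepε : ∀ k < T, n * ‖H.state (k + 1) ω - H.state k ω‖ ≤ ε' := fun k hk => by
    rw [H.state_succ, add_sub_cancel_left]
    exact H.mul_norm_displacement_le (le_max_right _ _) hε'.le
      (fun i hi => (hω k hk i hi).2.2) (fun i hi => (hω k hk i hi).2.1 (hxK k hk.le)) hδn
  suffices hsum : ∑ k ∈ Finset.range T, ‖gradient f (H.state k ω)‖ ^ 2 <
      T * (2 * (n + 1) * (ε + phi0 ^ 2 * ε' ^ 2)) by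
    change (1 / (T : ℝ)) * ∑ k ∈ Finset.range T, ‖gradient f (x k ω)‖ ^ 2 <
      2 * ((n + 1 : ℕ) : ℝ) * (ε + phi0 ^ 2 * ε' ^ 2)
    simp only [hstate]
    rw [one_div, inv_mul_lt_iff₀ hTpos']
    push_cast
    exact hsum
  rcases le_or_gt (n + 1) T with hnT | hnT
  · have h1 := hb.sum_gradient_le (cl := cl) (z := z) (x := fun k => H.state k ω) hnT hxK hstepρ
      hstepε fun j a ha => hcyc.2 j a (a + n) ha (by omega)
    refine h1.trans_lt ?_
    have h2 : (T : ℝ) * (2 * (n + 1) * (ε + phi0 ^ 2 * ε' ^ 2)) =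
        2 * (n + 1) * (T * ε + T * (phi0 ^ 2 * ε' ^ 2)) := by ring
    rw [h2]
    refine mul_lt_mul_of_pos_left ?_ (by positivity)
    exact add_lt_add_left hsmall _
  -- with fewer than `T0` steps there is no information on the update order; all iterates are close
  -- to `x0`, and the gradient at `x0` is small
  have hTn : T ≤ n := Nat.lt_succ_iff.1 hnT
  refine hb.sum_gradient_lt_of_start (x := fun k => H.state k ω) hε'.le hTpos hTn hxK hstepρ
    hstepε ?_
  change ‖gradient f x0‖ ^ 2 < _
  rcases lt_or_ge c 1 with hc | hc
  · rw [hlocal.gradient_eq_zero hb.isOpen hc hx0, norm_zero, zero_pow two_ne_zero]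
    positivity
  have hδlam : 2 * lam0 ≤ δ := by
    have h1 : 2 ≤ Q * rho0 := by
      have h2 : (1 : ℝ) ≤ ((⨆ i, q i : ℕ) : ℝ) :=
        le_trans (by exact_mod_cast hq i0) (hqle i0)
      have h3 := (hrle i0).trans (hr₁ i0)
      have h4 := mul_le_mul_of_nonneg_right h2 hρ.le
      rw [hQ, div_mul_eq_mul_div, le_div_iff₀ hrmin]
      linarith
    rw [hδ, mul_assoc]
    have h2 : lam0 * rho0 ≤ c * (F0 + lam0 * rho0) := by
      have := mul_le_mul_of_nonneg_right hc hFnn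
      linarith
    have h3 := mul_le_mul_of_nonneg_left h2 hQnn
    have h4 := mul_le_mul_of_nonneg_right h1 hb.lam0_nonneg
    linarith
  refine hb.sq_norm_gradient_start_lt hx0K hf_nonneg hη hε (Nat.cast_pos.1 hN0pos) hTpos hTn
    (by linarith [hb.norm_gradient_le x0 hx0K]) hη₁ hδε' ?_
  have hαν : 1 ≤ α * ν := by
    have h3 := mul_le_mul_of_nonneg_right hα hν.le
    have h4 : (2 + γ + 1 / ν + ν * γ) * ν = 1 + (2 * ν + γ * ν + ν * γ * ν) := by
      field_simp
      ring
    have : 0 < 2 * ν + γ * ν + ν * γ * ν := by positivity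
    linarith
  have h3 : 2 * α * ν * f x0 ≤ T * (η * ε) := by
    have := Nat.le_ceil (2 * α * ν * f x0 / (η * ε))
    rwa [← hT, div_le_iff₀ (by positivity)] at this
  have h4 := mul_le_mul_of_nonneg_right hαν hfx0.le
  linarith
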